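/- **Setting.** Fix $n,L,M,p,q\in\mathbb N_0$, a budget $\kappa\ge 0$, and deterministic initial data $a_{-L}^{-1}=(a_{-1},\dots,a_{-L})\in(\mathbb R^q)^L$, $b_{-M}^{-1}=(b_{-1},\dots,b_{-M})\in(\mathbb R^p)^M$, known to the encoder and the decoder. The channel with inputs $A_i\in\mathbb R^q$ and outputs $B_i\in\mathbb R^p$ is $$B_i=\sum_{j=1}^M C_{i,i-j}B_{i-j}+\sum_{j=0}^L D_{i,i-j}A_{i-j}+V_i,\qquad i=0,\dots,n,$$ with $B_{-M}^{-1}=b_{-M}^{-1}$, $A_{-L}^{-1}=a_{-L}^{-1}$, where $V_i\sim N(0,K_{V_i})$, $K_{V_i}\succ0$, and $V_i$ is independent of $(V^{i-1},A^i)$. The cost is $\gamma_i=\langle A_{i-L}^i,R_L(i)A_{i-L}^i\rangle+\langle B_{i-M}^i,Q_M(i)B_{i-M}^i\rangle$ with $R_L(i)\succ0$ and $Q_M(i)\succeq0$ symmetric. A channel input distribution is a sequence of stochastic kernels $P_i(da_i|a^{i-1},b^{i-1})$, $i=0,\dots,n$; together with the channel it induces the joint law $\mathbf P^P$ of $(A_i,B_i,V_i)_{i\le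 n}$. It is feasible if $\frac1{n+1}\sum_{i=0}^n\mathbf E^P\{\gamma_i\}\le\kappa$. The FTFI capacity is $$C(\kappa)=\sup_{P\text{ feasible}}I(A^n\to B^n),\qquad I(A^n\to B^n)=\sum_{i=0}^n I(A^i;B_i|B^{i-1}),$$ with $\sup\emptyset=-\infty$. $H$ denotes (conditional) differential entropy in nats. A sequence $\pi_i(da_i|a_{i-L}^{i-1},b^{i-1})$, $i=0,\dots,n$, is called Gaussian if all these conditional laws are (possibly degenerate) Gaussian and the induced process $(A_i,B_i,V_i)_{i\le n}$ is jointly Gaussian. **Theorem.** (0) For every feasible $P$ the entropies $H(B_i|B^{i-1})$ and $H(V^n)$ exist and are finite, and $I(A^n\to B^n)=\sum_{i=0}^nH(B_i|B^{i-1})-H(V^n)$. Moreover $$C(\kappa)=\sup\Big\{\sum_{i=0}^nH(B_i|B^{i-1})-H(V^n)\Big\},$$ the supremum being over the feasible input distributions of the form $\pi_i(da_i|a_{i-L}^{i-1},b^{i-1})$. (a) The same formula holds with the supremum restricted to Gaussian feasible $\pi_i(da_i|a_{i-L}^{i-1},b^{i-1})$. If a feasible input distribution exists, then there is an optimal one (attaining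 $C(\kappa)$) that is Gaussian and of the form $\pi_i(da_i|a_{i-L}^{i-1},b^{i-1})$; in particular the joint process $(A_i,B_i,V_i)_{i\le n}$ that it induces is jointly Gaussian. (b) Consider linear realizations: processes that satisfy the channel model above together with $$A_i=\Gamma^{i-1}B^{i-1}+\sum_{j=1}^L\Lambda_{i,i-j}A_{i-j}+\sum_{j=1}^L\Theta_{i,j}\,a_{-j}+Z_i,\qquad i=0,\dots,n,$$ where $B^{i-1}=(b_{-M},\dots,b_{-1},B_0,\dots,B_{i-1})$, $\Gamma^{i-1},\Lambda_{i,i-j},\Theta_{i,j}$ are deterministic matrices, $Z_i\sim N(0,K_{Z_i})$ with $K_{Z_i}\succeq0$, $Z_0,\dots,Z_n$ are independent, $Z_i$ is independent of $(A^{i-1},B^{i-1})$, and $Z^i$ is independent of $V^i$. Each linear realization has the joint law of $(A_i,B_i,V_i)_{i\le n}$ induced by some Gaussian $\pi_i(da_i|a_{i-L}^{i-1},b^{i-1})$; if a feasible input distribution exists, some optimal Gaussian one as in (a) has a linear realization; and $$C(\kappa)=\sup\Big\{\sum_{i=0}^nH(B_i|B^{i-1})-H(V^n)\Big\},$$ the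 supremum being over the linear realizations (that is, over $\Gamma^{i-1},\Lambda_{i,i-j},\Theta_{i,j},K_{Z_i}$) with $\frac1{n+1}\sum_{i=0}^n\mathbf E\{\gamma_i\}\le\kappa$. If $a_{-L}^{-1}=0$ or $b_{-M}^{-1}\neq0$, then the last two claims also hold with $\Theta=0$, that is, for $A_i=\Gamma^{i-1}B^{i-1}+\sum_{j=1}^L\Lambda_{i,i-j}A_{i-j}+Z_i$. -/

import Mathlib

open MeasureTheory ProbabilityTheory InformationTheory
open scoped ENNReal

noncomputable section

namespace FTFI

/-- Vectors in `ℝ^d`, written in coordinates. -/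
abbrev Vec (d : ℕ) : Type := Fin d → ℝ

/-! ### Entropy and directed information -/

section Information

variable {Ω E F G : Type*} [MeasurableSpace Ω]

/-- Differential entropy `H = - ∫ log f dν` (in nats), with `f` the Lebesgue density of `ν`. -/
def diffEntropy [MeasureSpace E] (ν : Measure E) : ℝ :=
  -∫ x, Real.log (ν.rnDeriv volume x).toReal ∂ν

/-- The differential entropy of `ν` exists as a finite number. -/
def HasDiffEntropy [MeasureSpace E] (ν : Measure E) : Prop :=
  ν ≪ (volume : Measure E) ∧ Integrable (fun x => Real.log (ν.rnDeriv volume x).toReal) ν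

/-- Conditional differential entropy `H(X | Y)`: the mean, over the law of `Y`, of the differential
entropy of the regular conditional law of `X` given `Y = y`. -/
def condEntropy [MeasureSpace E] [StandardBorelSpace E] [Nonempty E] [MeasurableSpace F]
    (X : Ω → E) (Y : Ω → F) (μ : Measure Ω) [IsFiniteMeasure μ] : ℝ :=
  ∫ y, diffEntropy (condDistrib X Y μ y) ∂(μ.map Y)

/-- The conditional differential entropy `H(X | Y)` exists as a finite number. -/
def HasCondEntropy [MeasureSpace E] [StandardBorelSpace E] [Nonempty E] [MeasurableSpace F]
    (X : Ω → E) (Y : Ω → F) (μ : Measure Ω) [IsFiniteMeasure μ] : Prop :=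
  (∀ᵐ y ∂(μ.map Y), HasDiffEntropy (condDistrib X Y μ y)) ∧
    Integrable (fun y => diffEntropy (condDistrib X Y μ y)) (μ.map Y)

/-- Conditional mutual information `I(U; Z | W) = D(P_{W,U,Z} ‖ P_{W,U} ⊗ P_{Z|W})`. -/
def condMutualInfo [MeasurableSpace E] [StandardBorelSpace E] [Nonempty E] [MeasurableSpace F]
    [MeasurableSpace G] (U : Ω → G) (Z : Ω → E) (W : Ω → F)
    (μ : Measure Ω) [IsFiniteMeasure μ] : ℝ≥0∞ :=
  klDiv (μ.map fun ω => ((W ω, U ω), Z ω))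
    ((μ.map fun ω => (W ω, U ω)) ⊗ₘ (condDistrib Z W μ).prodMkRight G)

/-- The segment `X_0, …, X_{N-1}` of a process. -/
def seg {d : ℕ} (X : ℕ → Ω → Vec d) (N : ℕ) (ω : Ω) : Fin N → Vec d := fun k => X k ω

/-- Directed information `I(A^n → B^n) = ∑_{i=0}^n I(A^i; B_i | B^{i-1})`. -/
def directedInfo {p q : ℕ} (n : ℕ) (μ : Measure Ω) [IsFiniteMeasure μ]
    (A : ℕ → Ω → Vec q) (B : ℕ → Ω → Vec p) : ℝ≥0∞ :=
  ∑ i ∈ Finset.range (n + 1), condMutualInfo (seg A (i + 1)) (B i) (seg B i) μ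

/-- `∑_{i=0}^n H(B_i | B^{i-1}) - H(V^n)`. -/
def entropyPayoff {p : ℕ} (n : ℕ) (μ : Measure Ω) [IsFiniteMeasure μ]
    (B V : ℕ → Ω → Vec p) : ℝ :=
  ∑ i ∈ Finset.range (n + 1), condEntropy (B i) (seg B i) μ
    - diffEntropy (μ.map (seg V (n + 1)))

/-- All entropies that occur in `entropyPayoff` exist as finite numbers. -/
def EntropiesExist {p : ℕ} (n : ℕ) (μ : Measure Ω) [IsFiniteMeasure μ]
    (B V : ℕ → Ω → Vec p) : Prop :=
  (∀ i ≤ n, HasCondEntropy (B i) (seg B i) μ) ∧ HasDiffEntropy (μ.map (seg V (n + 1)))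

end Information

/-! ### The channel -/

/-- `lag init x i j` is `x_{i-j}`, where the values at negative times are the initial data
`init = (x_{-1}, x_{-2}, …, x_{-m})`. -/
def lag {d m : ℕ} (init : Fin m → Vec d) (x : ℕ → Vec d) (i j : ℕ) : Vec d :=
  if j ≤ i then x (i - j)
  else if h : j - i - 1 < m then init ⟨j - i - 1, h⟩ else 0

/-- A finite sequence, continued by zeros. -/
def extend {d N : ℕ} (x : Fin N → Vec d) (k : ℕ) : Vec d :=
  if h : k < N then x ⟨k, h⟩ else 0

/-- The Gaussian law `N(0, K)` on `ℝ^d`. -/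
def gaussianLaw {d : ℕ} (K : Matrix (Fin d) (Fin d) ℝ) : Measure (Vec d) :=
  (multivariateGaussian 0 K).map WithLp.ofLp

instance {d : ℕ} (K : Matrix (Fin d) (Fin d) ℝ) : IsProbabilityMeasure (gaussianLaw K) :=
  Measure.isProbabilityMeasure_map (by fun_prop)

/-- The data of a Gaussian linear channel model with input memory `L` and output memory `M`,
with inputs in `ℝ^q` and outputs in `ℝ^p`. -/
structure GLCM (p q L M : ℕ) where
  /-- `C i j` is `C_{i,i-(j+1)}`, `0 ≤ j < M`. -/
  C : ℕ → Fin M → Matrix (Fin p) (Fin p) ℝ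
  /-- `D i j` is `D_{i,i-j}`, `0 ≤ j ≤ L`. -/
  D : ℕ → Fin (L + 1) → Matrix (Fin p) (Fin q) ℝ
  /-- the covariance matrix of `V_i` -/
  KV : ℕ → Matrix (Fin p) (Fin p) ℝ
  /-- the input cost matrix `R_L(i)`; the block index `j` belongs to `A_{i-j}` -/
  R : ℕ → Matrix (Fin (L + 1) × Fin q) (Fin (L + 1) × Fin q) ℝ
  /-- the output cost matrix `Q_M(i)`; the block index `j` belongs to `B_{i-j}` -/
  Q : ℕ → Matrix (Fin (M + 1) × Fin p) (Fin (M + 1) × Fin p) ℝ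
  /-- the initial inputs `a_{-1}, …, a_{-L}` -/
  a : Fin L → Vec q
  /-- the initial outputs `b_{-1}, …, b_{-M}` -/
  b : Fin M → Vec p

/-- A sequence of channel input distributions `P_i(da_i | a^{i-1}, b^{i-1})`; the initial data,
being fixed, are not listed among the arguments. -/
structure InputDist (p q : ℕ) where
  kernel : ∀ i : ℕ, Kernel ((Fin i → Vec q) × (Fin i → Vec p)) (Vec q)
  markov : ∀ i, IsMarkovKernel (kernel i)

/-- A sequence of channel input distributions `π_i(da_i | a_{i-L}^{i-1}, b^{i-1})`; the window
`a_{i-L}^{i-1}` is listed as `(a_{i-1}, …, a_{i-L})`. -/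
structure LimitedInputDist (p q L : ℕ) where
  kernel : ∀ i : ℕ, Kernel ((Fin L → Vec q) × (Fin i → Vec p)) (Vec q)
  markov : ∀ i, IsMarkovKernel (kernel i)

/-- Values of `(A_0^{N-1}, B_0^{N-1}, V_0^{N-1})`. -/
abbrev Hist (p q N : ℕ) : Type := (Fin N → Vec q) × (Fin N → Vec p) × (Fin N → Vec p)

lemma measurable_extend {d N : ℕ} (k : ℕ) :
    Measurable (fun x : Fin N → Vec d => extend x k) := by
  unfold extend
  split_ifs
  · exact measurable_pi_apply _
  · exact measurable_const

lemma measurable_lag_extend {d m N : ℕ} (init : Fin m → Vec d) (i j : ℕ) :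
    Measurable (fun x : Fin N → Vec d => lag init (extend x) i j) := by
  unfold lag
  split_ifs
  · exact measurable_extend _
  · exact measurable_const
  · exact measurable_const

namespace GLCM

variable {p q L M : ℕ} (ch : GLCM p q L M)

/-- `∑_{j=1}^M C_{i,i-j} b_{i-j} + ∑_{j=0}^L D_{i,i-j} a_{i-j}`. -/
def mean (i : ℕ) (x : ℕ → Vec q) (y : ℕ → Vec p) : Vec p :=
  ∑ j : Fin M, (ch.C i j).mulVec (lag ch.b y i (j + 1))
    + ∑ j : Fin (L + 1), (ch.D i j).mulVec (lag ch.a x i j)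

/-- The stacked vector `a_{i-L}^i`. -/
def inputWindow (i : ℕ) (x : ℕ → Vec q) : Fin (L + 1) × Fin q → ℝ :=
  fun jk => lag ch.a x i jk.1 jk.2

/-- The stacked vector `b_{i-M}^i`. -/
def outputWindow (i : ℕ) (y : ℕ → Vec p) : Fin (M + 1) × Fin p → ℝ :=
  fun jk => lag ch.b y i jk.1 jk.2

/-- The cost `⟨a_{i-L}^i, R_L(i) a_{i-L}^i⟩ + ⟨b_{i-M}^i, Q_M(i) b_{i-M}^i⟩`. -/
def cost (i : ℕ) (x : ℕ → Vec q) (y : ℕ → Vec p) : ℝ :=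
  ch.inputWindow i x ⬝ᵥ (ch.R i).mulVec (ch.inputWindow i x)
    + ch.outputWindow i y ⬝ᵥ (ch.Q i).mulVec (ch.outputWindow i y)

/-- The average cost `(n+1)⁻¹ ∑_{i=0}^n E[γ_i]`, possibly infinite. -/
def avgCost {Ω : Type*} [MeasurableSpace Ω] (n : ℕ) (μ : Measure Ω)
    (A : ℕ → Ω → Vec q) (B : ℕ → Ω → Vec p) : ℝ≥0∞ :=
  ((n : ℝ≥0∞) + 1)⁻¹ * ∑ i ∈ Finset.range (n + 1),
    ∫⁻ ω, ENNReal.ofReal (ch.cost i (fun k => A k ω) (fun k => B k ω)) ∂μ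

/-- Appends to a history the input `a_N`, the noise `v_N` and the channel output they produce. -/
def step (N : ℕ) (x : (Hist p q N × Vec q) × Vec p) : Hist p q (N + 1) :=
  let a : Fin (N + 1) → Vec q := Fin.snoc (α := fun _ => Vec q) x.1.1.1 x.1.2
  (a,
    Fin.snoc (α := fun _ => Vec p) x.1.1.2.1 (ch.mean N (extend a) (extend x.1.1.2.1) + x.2),
    Fin.snoc (α := fun _ => Vec p) x.1.1.2.2 x.2)

lemma measurable_step (N : ℕ) : Measurable (ch.step N) := by
  have hs : ∀ {d : ℕ}, Measurable (fun z : (Fin N → Vec d) × Vec d =>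
      (Fin.snoc (α := fun _ => Vec d) z.1 z.2 : Fin (N + 1) → Vec d)) := by
    intro d
    refine measurable_pi_lambda _ fun k => ?_
    refine Fin.lastCases ?_ (fun k => ?_) k
    · simpa using measurable_snd
    · simp only [Fin.snoc_castSucc]
      exact (measurable_pi_apply k).comp measurable_fst
  have ha : Measurable (fun x : (Hist p q N × Vec q) × Vec p =>
      (Fin.snoc (α := fun _ => Vec q) x.1.1.1 x.1.2 : Fin (N + 1) → Vec q)) :=
    hs.comp (measurable_fst.fst.fst.prodMk measurable_fst.snd)
  have hmul : ∀ {d e : ℕ} (K : Matrix (Fin d) (Fin e) ℝ), Measurable (fun v => K.mulVec v) :=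
    fun K => (Continuous.matrix_mulVec continuous_const continuous_id).measurable
  have hm : Measurable (fun x : (Hist p q N × Vec q) × Vec p =>
      ch.mean N (extend (Fin.snoc (α := fun _ => Vec q) x.1.1.1 x.1.2 : Fin (N + 1) → Vec q))
        (extend x.1.1.2.1)) := by
    unfold mean
    refine Measurable.add (Finset.measurable_sum _ fun j _ => ?_)
      (Finset.measurable_sum _ fun j _ => ?_)
    · exact (hmul _).comp ((measurable_lag_extend _ _ _).comp (by fun_prop))
    · exact (hmul _).comp ((measurable_lag_extend _ _ _).comp ha)
  refine ha.prodMk (Measurable.prodMk ?_ ?_)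
  · exact hs.comp (measurable_fst.fst.snd.fst.prodMk (hm.add measurable_snd))
  · exact hs.comp (measurable_fst.fst.snd.snd.prodMk measurable_snd)

/-- The joint law of `(A_0^{N-1}, B_0^{N-1}, V_0^{N-1})` induced by the channel input distributions
`P`: given the past, `A_N` is drawn from `P_N(· | A^{N-1}, B^{N-1})`, the noise `V_N ~ N(0, K_{V_N})`
is drawn independently of everything before it, and the channel equation gives `B_N`. -/
def jointLaw (P : InputDist p q) : (N : ℕ) → Measure (Hist p q N)
  | 0 => Measure.dirac 0
  | N + 1 =>
    (((jointLaw P N) ⊗ₘ ((P.kernel N).comap (fun h : Hist p q N => (h.1, h.2.1)) (by fun_prop))).prod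
      (gaussianLaw (ch.KV N))).map (ch.step N)

instance (P : InputDist p q) (N : ℕ) : IsProbabilityMeasure (ch.jointLaw P N) := by
  induction N with
  | zero => unfold jointLaw; infer_instance
  | succ N ih =>
    have := P.markov N
    unfold jointLaw
    exact Measure.isProbabilityMeasure_map (ch.measurable_step N).aemeasurable

/-- The channel input distributions with full memory given by ones with input memory `L`. -/
def ofLimited (π : LimitedInputDist p q L) : InputDist p q where
  kernel i := (π.kernel i).comap
    (fun h => ((fun j : Fin L => lag ch.a (extend h.1) i (j + 1)), h.2))
    ((measurable_pi_lambda _ fun _ =>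
      (measurable_lag_extend _ _ _).comp measurable_fst).prodMk measurable_snd)
  markov i := by
    have := π.markov i
    infer_instance

end GLCM

section Coordinates

variable {p q N : ℕ}

/-- The input process on the canonical space. -/
def inputs (k : ℕ) (h : Hist p q N) : Vec q := extend h.1 k

/-- The output process on the canonical space. -/
def outputs (k : ℕ) (h : Hist p q N) : Vec p := extend h.2.1 k

/-- The noise process on the canonical space. -/
def noises (k : ℕ) (h : Hist p q N) : Vec p := extend h.2.2 k

end Coordinates

namespace GLCM

variable {p q L M : ℕ} (ch : GLCM p q L M)

/-- The average cost constraint `(n+1)⁻¹ ∑_{i=0}^n E^P[γ_i] ≤ κ`. -/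
def Feasible (n : ℕ) (κ : ℝ) (P : InputDist p q) : Prop :=
  ch.avgCost n (ch.jointLaw P (n + 1)) inputs outputs ≤ ENNReal.ofReal κ

/-- The directed information `I(A^n → B^n)` under `P`. -/
def info (n : ℕ) (P : InputDist p q) : ℝ≥0∞ :=
  directedInfo n (ch.jointLaw P (n + 1)) inputs outputs

/-- `∑_{i=0}^n H(B_i | B^{i-1}) - H(V^n)` under `P`. -/
def payoff (n : ℕ) (P : InputDist p q) : ℝ :=
  entropyPayoff n (ch.jointLaw P (n + 1)) outputs noises

/-- The finite transmission feedback information capacity: the supremum of `I(A^n → B^n)` over all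
channel input distributions `P_i(da_i | a^{i-1}, b^{i-1})` that satisfy the cost constraint
(`⊥ = -∞` if there are none). -/
def capacity (n : ℕ) (κ : ℝ) : EReal :=
  ⨆ (P : InputDist p q) (_ : ch.Feasible n κ P), (ch.info n P : EReal)

/-- `π` is Gaussian: every `π_i(· | a_{i-L}^{i-1}, b^{i-1})`, `i ≤ n`, is a Gaussian law, and the
joint process `(A_i, B_i, V_i)`, `i ≤ n`, is jointly Gaussian. -/
def GaussianInput (n : ℕ) (π : LimitedInputDist p q L) : Prop :=
  (∀ i ≤ n, ∀ h, IsGaussian (π.kernel i h)) ∧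
    IsGaussian (ch.jointLaw (ch.ofLimited π) (n + 1))

end GLCM

/-! ### Linear realizations -/

/-- The coefficients of a linear realization of the inputs. -/
structure LinearParams (p q L M : ℕ) where
  /-- `Γ i j` is the block of `Γ^{i-1}` that multiplies `B_{i-(j+1)}`, `0 ≤ j < M + i`, so that
  `Γ^{i-1}` acts on `b_{-M}, …, b_{-1}, B_0, …, B_{i-1}`. -/
  Γ : (i : ℕ) → Fin (M + i) → Matrix (Fin q) (Fin p) ℝ
  /-- `Λ i j` is `Λ_{i,i-(j+1)}`, `0 ≤ j < L`. -/
  Λ : ℕ → Fin L → Matrix (Fin q) (Fin q) ℝ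
  /-- `Θ i j` multiplies the known initial input `a_{-(j+1)}`, `0 ≤ j < L`. -/
  Θ : ℕ → Fin L → Matrix (Fin q) (Fin q) ℝ
  /-- the covariance matrix of `Z_i` -/
  KZ : ℕ → Matrix (Fin q) (Fin q) ℝ

/-- The processes `(A, B, V, Z)` form a linear realization, up to time `n`, with coefficients `θ`. -/
structure IsLinearRealization {p q L M : ℕ} (ch : GLCM p q L M) (n : ℕ) (θ : LinearParams p q L M)
    {Ω : Type*} [MeasurableSpace Ω] (μ : Measure Ω)
    (A : ℕ → Ω → Vec q) (B V : ℕ → Ω → Vec p) (Z : ℕ → Ω → Vec q) : Prop where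
  measurable_A : ∀ i ≤ n, Measurable (A i)
  measurable_B : ∀ i ≤ n, Measurable (B i)
  measurable_V : ∀ i ≤ n, Measurable (V i)
  measurable_Z : ∀ i ≤ n, Measurable (Z i)
  input_eq : ∀ i ≤ n, ∀ ω, A i ω =
    ∑ j : Fin (M + i), (θ.Γ i j).mulVec (lag ch.b (fun k => B k ω) i (j + 1))
      + ∑ j : Fin L, (θ.Λ i j).mulVec (lag ch.a (fun k => A k ω) i (j + 1))
      + ∑ j : Fin L, (θ.Θ i j).mulVec (ch.a j) + Z i ω
  output_eq : ∀ i ≤ n, ∀ ω, B i ω = ch.mean i (fun k => A k ω) (fun k => B k ω) + V i ω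
  noise_law : ∀ i ≤ n, μ.map (V i) = gaussianLaw (ch.KV i)
  noise_indep : ∀ i ≤ n, IndepFun (V i) (fun ω => (seg V i ω, seg A (i + 1) ω)) μ
  innov_indep_past : ∀ i ≤ n, IndepFun (Z i) (fun ω => (seg A i ω, seg B i ω)) μ
  innov_indep_noise : ∀ i ≤ n, IndepFun (seg Z (i + 1)) (seg V (i + 1)) μ
  innov_cov : ∀ i ≤ n, (θ.KZ i).PosSemidef
  innov_law : ∀ i ≤ n, μ.map (Z i) = gaussianLaw (θ.KZ i)
  innov_indep : iIndepFun (fun k : Fin (n + 1) => Z k) μ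

/-- The values of `∑_{i=0}^n H(B_i | B^{i-1}) - H(V^n)` over all linear realizations that satisfy
the cost constraint and whose coefficients satisfy `adm`. -/
def linearValues {p q L M : ℕ} (ch : GLCM p q L M) (n : ℕ) (κ : ℝ)
    (adm : LinearParams p q L M → Prop) : Set EReal :=
  {x | ∃ θ : LinearParams p q L M, adm θ ∧
    ∃ (Ω : Type) (_ : MeasurableSpace Ω) (μ : Measure Ω) (_ : IsProbabilityMeasure μ)
      (A : ℕ → Ω → Vec q) (B V : ℕ → Ω → Vec p) (Z : ℕ → Ω → Vec q),
      IsLinearRealization ch n θ μ A B V Z ∧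
      ch.avgCost n μ A B ≤ ENNReal.ofReal κ ∧
      x = ((entropyPayoff n μ B V : ℝ) : EReal)}

/-- `(A, B, V, Z)` is a linear realization with coefficients `θ` for which `(A_i, B_i, V_i)`,
`i ≤ n`, has the joint law induced by `P`. -/
def Realizes {p q L M : ℕ} (ch : GLCM p q L M) (n : ℕ) (θ : LinearParams p q L M)
    {Ω : Type*} [MeasurableSpace Ω] (μ : Measure Ω)
    (A : ℕ → Ω → Vec q) (B V : ℕ → Ω → Vec p) (Z : ℕ → Ω → Vec q) (P : InputDist p q) : Prop :=
  IsLinearRealization ch n θ μ A B V Z ∧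
    μ.map (fun ω => (seg A (n + 1) ω, seg B (n + 1) ω, seg V (n + 1) ω)) = ch.jointLaw P (n + 1)

end FTFI

end

open FTFI

/-!
Each use of the channel adds to a function of the past an independent Gaussian vector with a
positive definite covariance matrix. Hence, whatever the input distribution is, `B_i` has a bounded
positive conditional density given `B^{i-1}`, all entropies are finite as soon as the second moments
are, and `I(A^i; B_i | B^{i-1}) = H(B_i | B^{i-1}) - H(V_i)` (`condMutualInfo_output`,
`SatisfiesChannel.directedInfo_eq`). As the law of the noise is fixed, the problem is to maximize
`∑ H(B_i | B^{i-1})`, which is `H(B^n)` by the chain rule (`map_seg_eq_withDensity`,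
`SatisfiesChannel.integrable_log_and_sum_condEntropy`).

By Gibbs' inequality, `H(B^n)` is at most the entropy of the Gaussian law with the same mean and
covariance (`SatisfiesChannel.sum_condEntropy_le_gaussEntropy`), an increasing function of the
determinant of the covariance. The cost, too, depends only on the second moments. So the problem is
relaxed to one about the second-moment matrices `S` of the vector `(1, A^n, B^n)`: those that are
`Compatible` with the channel (the noise is orthogonal to the past and has the right covariance) and
satisfy the cost constraint form the closed set `admissible`, which is compact because the weights
of the inputs in the cost are positive definite (`isCompact_admissible`). Therefore the determinant
of the output covariance `outCov` has a maximizer (`exists_isMaxOn_det_outCov`).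

The maximizer need not come from an input distribution with limited memory, but it can be replaced
by one that does. Regress `A_i`, in the geometry given by `S`, on the last `L` inputs, on all
outputs, and on the known initial data (`exists_regresses`), and use the coefficients for a linear
realization (`isLinearRealization_traj`). The channel and the cost at time `i` involve only the
inputs `A_{i-L}, …, A_i`, so that both second-moment matrices obey the same recursion on the
variables that matter (`toBilin'_eq_of_regresses`); consequently the realization has the same
cost and the same output covariance. Its outputs are Gaussian, so it attains the bound
(`exists_optimal_linearInput`). Conversely, the joint law of a linear realization is Gaussian and is
determined by its coefficients (`IsLinearRealization.map_hist`, `isGaussian_jointLaw_linearInput`).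

The regression is not centred: a constant is available as a regressor only through nonzero initial
data. The outputs `b` provide it through `Γ`, and if `b = 0` and `a ≠ 0`, then `Θ` has to (this is
`constFlag`). If all initial data vanish, linear realizations have mean zero; then the second-moment
matrix of the outputs takes the place of their covariance, which is harmless, as it bounds the
covariance from above and the Gaussian law of mean zero with that covariance has a larger entropy
(`meanFlag`, `outMean`, `outCov`).
-/

namespace FTFI

/-! ### Gaussian densities -/

section GaussianDensity

open scoped MatrixOrder

variable {ι : Type*} [Fintype ι] [DecidableEq ι]

/-- The density of the Gaussian law with mean `m` and invertible covariance matrix `K`. The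
normalising constant is kept in the exponent, so that the logarithm is a quadratic polynomial. -/
noncomputable def gaussPdf (m : ι → ℝ) (K : Matrix ι ι ℝ) (x : ι → ℝ) : ℝ :=
  Real.exp (-(1 / 2) * (Fintype.card ι * Real.log (2 * Real.pi) + Real.log K.det
    + (x - m) ⬝ᵥ K⁻¹.mulVec (x - m)))

lemma gaussPdf_pos (m : ι → ℝ) (K : Matrix ι ι ℝ) (x : ι → ℝ) : 0 < gaussPdf m K x :=
  Real.exp_pos _

@[fun_prop]
lemma continuous_gaussPdf (m : ι → ℝ) (K : Matrix ι ι ℝ) : Continuous (gaussPdf m K) := by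
  unfold gaussPdf
  fun_prop

lemma log_gaussPdf (m : ι → ℝ) (K : Matrix ι ι ℝ) (x : ι → ℝ) :
    Real.log (gaussPdf m K x) = -(1 / 2) * (Fintype.card ι * Real.log (2 * Real.pi)
      + Real.log K.det + (x - m) ⬝ᵥ K⁻¹.mulVec (x - m)) := by
  rw [gaussPdf, Real.log_exp]

lemma gaussPdf_le {K : Matrix ι ι ℝ} (hK : K.PosDef) (m x : ι → ℝ) :
    gaussPdf m K x ≤ gaussPdf m K m := by
  have h : 0 ≤ (x - m) ⬝ᵥ K⁻¹.mulVec (x - m) := by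
    simpa using hK.inv.posSemidef.dotProduct_mulVec_nonneg (x - m)
  unfold gaussPdf
  apply Real.exp_le_exp.2
  simp only [sub_self, zero_dotProduct]
  linarith

lemma pi_gaussianReal_eq_withDensity :
    Measure.pi (fun _ : ι => gaussianReal 0 1)
      = volume.withDensity fun x => ENNReal.ofReal (gaussPdf 0 1 x) := by
  have hprod : ∀ x : ι → ℝ, gaussPdf 0 1 x = ∏ i, gaussianPDFReal 0 1 (x i) := by
    intro x
    have h2 : ∀ y : ℝ, gaussianPDFReal 0 1 y
        = Real.exp (-(1 / 2) * (Real.log (2 * Real.pi) + y * y)) := by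
      intro y
      have h2pi : (0 : ℝ) < 2 * Real.pi := by positivity
      rw [gaussianPDFReal, mul_add, Real.exp_add]
      congr 1
      · rw [Real.sqrt_eq_rpow, Real.rpow_def_of_pos (by simpa using h2pi), ← Real.exp_neg]
        congr 1
        simp only [NNReal.coe_one, mul_one]
        ring
      · congr 1
        simp only [sub_zero, NNReal.coe_one, mul_one]
        ring
    simp_rw [h2, ← Real.exp_sum, ← Finset.mul_sum, Finset.sum_add_distrib]
    simp [gaussPdf, dotProduct]
  refine Measure.pi_eq fun s hs => ?_
  have hi : ∀ i, Integrable (gaussianPDFReal 0 1) ((volume : Measure ℝ).restrict (s i)) :=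
    fun i => (integrable_gaussianPDFReal 0 1).restrict
  have hint : Integrable (fun x : ι → ℝ => ∏ i, gaussianPDFReal 0 1 (x i))
      (Measure.pi fun i => (volume : Measure ℝ).restrict (s i)) :=
    Integrable.fintype_prod hi
  rw [withDensity_apply _ (MeasurableSet.univ_pi hs), volume_pi, Measure.restrict_pi_pi]
  simp_rw [hprod]
  rw [← ofReal_integral_eq_lintegral_ofReal hint
      (ae_of_all _ fun x => Finset.prod_nonneg fun i _ => gaussianPDFReal_nonneg _ _ _),
    integral_fintype_prod_eq_prod (fun (_ : ι) (y : ℝ) => gaussianPDFReal 0 1 y),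
    ENNReal.ofReal_prod_of_nonneg
      fun i _ => integral_nonneg fun y => gaussianPDFReal_nonneg _ _ _]
  refine Finset.prod_congr rfl fun i _ => ?_
  rw [gaussianReal_apply_eq_integral 0 one_ne_zero (s i)]

/-- The change of variables `x ↦ m + T x` with `T = K^{1/2}` turns the density of the standard
Gaussian law into `gaussPdf m K`. -/
lemma map_ofLp_multivariateGaussian (m : EuclideanSpace ℝ ι) {K : Matrix ι ι ℝ} (hK : K.PosDef) :
    (multivariateGaussian m K).map WithLp.ofLp
      = volume.withDensity fun x => ENNReal.ofReal (gaussPdf m.ofLp K x) := by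
  set T : Matrix ι ι ℝ := CFC.sqrt K with hT
  have hTT : T * T = K := CFC.sqrt_mul_sqrt_self K hK.posSemidef.nonneg
  have hTsym : T.transpose = T := by
    have : T.IsHermitian := (CFC.sqrt_nonneg K).isSelfAdjoint
    simpa [Matrix.IsHermitian] using this
  have hdet : K.det = T.det * T.det := by rw [← hTT, Matrix.det_mul]
  have hdet0 : T.det ≠ 0 := fun h => by
    have := hK.det_pos
    simp [hdet, h] at this
  have hlaw : (multivariateGaussian m K).map WithLp.ofLp
      = ((Measure.pi fun _ : ι => gaussianReal 0 1).map (Matrix.toLin' T)).map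
        (fun y => m.ofLp + y) := by
    have hT' : Measurable (Matrix.toLin' T) :=
      (LinearMap.continuous_on_pi (Matrix.toLin' T)).measurable
    rw [multivariateGaussian, ← map_pi_eq_stdGaussian, Measure.map_map (by fun_prop) (by fun_prop),
      Measure.map_map (by fun_prop) (by fun_prop), Measure.map_map (by fun_prop) hT']
    rfl
  have hT' : Measurable (Matrix.toLin' T) :=
    (LinearMap.continuous_on_pi (Matrix.toLin' T)).measurable
  have hkey : ∀ x : ι → ℝ, gaussPdf 0 1 x
      = |T.det| * gaussPdf m.ofLp K (m.ofLp + Matrix.toLin' T x) := by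
    intro x
    have hlog : |T.det| = Real.exp ((1 / 2) * Real.log K.det) := by
      rw [hdet, Real.log_mul hdet0 hdet0, ← Real.log_abs, ← two_mul, ← mul_assoc]
      norm_num
      rw [Real.exp_log_eq_abs hdet0]
    have hq : (T.mulVec x) ⬝ᵥ K⁻¹.mulVec (T.mulVec x) = x ⬝ᵥ x := by
      have h1 : T * (K⁻¹ * T) = 1 := by
        have hu : IsUnit T.det := isUnit_iff_ne_zero.2 hdet0
        rw [← hTT, Matrix.mul_inv_rev, Matrix.mul_assoc, Matrix.nonsing_inv_mul T hu,
          Matrix.mul_one, Matrix.mul_nonsing_inv T hu]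
      have h2 : (T.mulVec x) = Matrix.vecMul x T := by
        rw [← Matrix.mulVec_transpose, hTsym]
      rw [Matrix.mulVec_mulVec]
      nth_rewrite 1 [h2]
      rw [← Matrix.dotProduct_mulVec, Matrix.mulVec_mulVec, h1, Matrix.one_mulVec]
    rw [hlog, gaussPdf, gaussPdf, ← Real.exp_add]
    congr 1
    simp only [Matrix.toLin'_apply, add_sub_cancel_left, hq, Matrix.det_one, Real.log_one,
      inv_one, Matrix.one_mulVec, sub_zero]
    ring
  rw [hlaw, pi_gaussianReal_eq_withDensity]
  refine Measure.ext_of_lintegral _ fun f hf => ?_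
  have hg : Measurable fun x : ι → ℝ => ENNReal.ofReal (gaussPdf m.ofLp K x) := by fun_prop
  have hg0 : Measurable fun x : ι → ℝ => ENNReal.ofReal (gaussPdf 0 1 x) := by fun_prop
  rw [lintegral_map hf (by fun_prop), lintegral_map (by fun_prop) hT',
    lintegral_withDensity_eq_lintegral_mul _ hg0 (by fun_prop),
    lintegral_withDensity_eq_lintegral_mul _ hg hf]
  simp only [Pi.mul_apply, hkey, ENNReal.ofReal_mul (abs_nonneg T.det), mul_assoc]
  rw [lintegral_const_mul _ (by fun_prop)]
  rw [← lintegral_map (μ := volume) (g := Matrix.toLin' T)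
    (f := fun y => ENNReal.ofReal (gaussPdf m.ofLp K (m.ofLp + y)) * f (m.ofLp + y))
    (by fun_prop) hT', Real.map_matrix_volume_pi_eq_smul_volume_pi hdet0, lintegral_smul_measure,
    smul_eq_mul, ← mul_assoc, ← ENNReal.ofReal_mul (abs_nonneg _), ← abs_mul,
    mul_inv_cancel₀ hdet0, abs_one, ENNReal.ofReal_one, one_mul]
  exact lintegral_add_left_eq_self (fun y => ENNReal.ofReal (gaussPdf m.ofLp K y) * f y) m.ofLp


/-- A Gaussian law is determined by its means and covariances, so if the covariance matrix is
invertible it has the density `gaussPdf`. -/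
lemma eq_withDensity_gaussPdf_of_isGaussian {ν : Measure (ι → ℝ)} [IsGaussian ν] {m : ι → ℝ}
    {K : Matrix ι ι ℝ} (hK : K.PosDef) (hm : ∀ i, ∫ x, x i ∂ν = m i)
    (hcov : ∀ i j, cov[fun x => x i, fun x => x j; ν] = K i j) :
    ν = volume.withDensity fun x => ENNReal.ofReal (gaussPdf m K x) := by
  let e : EuclideanSpace ℝ ι ≃L[ℝ] (ι → ℝ) := PiLp.continuousLinearEquiv 2 ℝ fun _ : ι => ℝ
  have hmeas : ∀ i, Measurable fun x : EuclideanSpace ℝ ι => x i := fun i => by fun_prop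
  have hν : ν.map e.symm = multivariateGaussian (WithLp.toLp 2 m) K := by
    have hid : Integrable id (ν.map e.symm) := IsGaussian.integrable_id
    have hid' : Integrable id (multivariateGaussian (WithLp.toLp 2 m) K) :=
      IsGaussian.integrable_id
    refine IsGaussian.ext ?_ ?_
    · rw [integral_id_multivariateGaussian']
      ext i
      have h1 := (EuclideanSpace.proj (𝕜 := ℝ) i).integral_comp_comm hid
      have h2 : (∫ x, id x ∂(ν.map e.symm)) i = ∫ x, x i ∂(ν.map e.symm) := by
        simpa using h1.symm
      rw [h2, integral_map (by fun_prop) (by fun_prop)]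
      exact hm i
    · rw [← ContinuousLinearMap.toBilinForm_inj]
      refine LinearMap.BilinForm.ext_basis (EuclideanSpace.basisFun ι ℝ).toBasis fun i j => ?_
      rw [ContinuousLinearMap.toBilinForm_apply, ContinuousLinearMap.toBilinForm_apply,
        covarianceBilin_apply_eq_cov IsGaussian.memLp_two_id,
        covarianceBilin_multivariateGaussian hK.posSemidef]
      have hb : ∀ i, (fun x : EuclideanSpace ℝ ι =>
          inner ℝ ((EuclideanSpace.basisFun ι ℝ).toBasis i) x) = fun x => x i := by
        intro i
        ext x
        simp [PiLp.inner_apply]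
      rw [hb, hb, covariance_map (by fun_prop) (by fun_prop) (by fun_prop)]
      refine (hcov i j).trans ?_
      simp
  have h : ν = (ν.map e.symm).map WithLp.ofLp := by
    rw [Measure.map_map (by fun_prop) (by fun_prop)]
    exact Measure.map_id.symm
  rw [h, hν, map_ofLp_multivariateGaussian _ hK]

end GaussianDensity

lemma gaussianLaw_eq_withDensity {d : ℕ} {K : Matrix (Fin d) (Fin d) ℝ} (hK : K.PosDef) :
    gaussianLaw K = volume.withDensity fun x => ENNReal.ofReal (gaussPdf 0 K x) := by
  rw [gaussianLaw, map_ofLp_multivariateGaussian _ hK]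
  rfl

instance isGaussian_gaussianLaw {d : ℕ} (K : Matrix (Fin d) (Fin d) ℝ) :
    IsGaussian (gaussianLaw K) := by
  have : gaussianLaw K = (multivariateGaussian 0 K).map
      (PiLp.continuousLinearEquiv 2 ℝ fun _ : Fin d => ℝ) := rfl
  rw [this]
  infer_instance

lemma memLp_eval_of_isGaussian {ι : Type*} [Fintype ι] (ν : Measure (ι → ℝ)) [IsGaussian ν]
    (i : ι) : MemLp (fun x => x i) 2 ν :=
  IsGaussian.memLp_dual ν (ContinuousLinearMap.proj i) 2 (by simp)

lemma measurable_vec_eval {d : ℕ} (c : Fin d) : Measurable fun x : Vec d => x c :=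
  measurable_pi_apply c

lemma integral_eval_gaussianLaw {d : ℕ} (K : Matrix (Fin d) (Fin d) ℝ) (c : Fin d) :
    ∫ x, x c ∂(gaussianLaw K) = 0 := by
  rw [gaussianLaw, integral_map (by fun_prop) (measurable_vec_eval c).aestronglyMeasurable]
  have hid : Integrable id (multivariateGaussian 0 K) := IsGaussian.integrable_id
  have h1 := (EuclideanSpace.proj (𝕜 := ℝ) c).integral_comp_comm hid
  rw [integral_id_multivariateGaussian'] at h1
  simpa using h1

lemma integral_eval_mul_eval_gaussianLaw {d : ℕ} {K : Matrix (Fin d) (Fin d) ℝ}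
    (hK : K.PosSemidef) (c e : Fin d) : ∫ x, x c * x e ∂(gaussianLaw K) = K c e := by
  have h := covariance_eval_multivariateGaussian (μ := 0) hK c e
  have h2 : cov[fun x => x c, fun x => x e; gaussianLaw K] = K c e := by
    rw [gaussianLaw, covariance_map (measurable_vec_eval c).aestronglyMeasurable
      (measurable_vec_eval e).aestronglyMeasurable (by fun_prop)]
    exact h
  rw [covariance_eq_sub (memLp_eval_of_isGaussian _ c) (memLp_eval_of_isGaussian _ e)] at h2
  simpa [integral_eval_gaussianLaw] using h2

/-! ### Entropy and divergence of measures with positive densities -/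

section Densities

variable {α : Type*} [MeasurableSpace α]

lemma integrable_withDensity_ofReal_iff {lam : Measure α} {f : α → ℝ} (hf : Measurable f)
    {g : α → ℝ} : Integrable g (lam.withDensity fun x => ENNReal.ofReal (f x)) ↔
      Integrable (fun x => (ENNReal.ofReal (f x)).toReal • g x) lam :=
  integrable_withDensity_iff_integrable_smul' hf.ennreal_ofReal (ae_of_all _ fun _ => by simp)

/-- A change of reference measure: dividing out the density `g`. -/
lemma withDensity_ofReal_div {lam : Measure α} {f g : α → ℝ} (hf : Measurable f)
    (hg : Measurable g) (hg0 : ∀ x, 0 < g x) :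
    lam.withDensity (fun x => ENNReal.ofReal (f x))
      = (lam.withDensity fun x => ENNReal.ofReal (g x)).withDensity
        fun x => ENNReal.ofReal (f x / g x) := by
  have hfg : Measurable fun x => ENNReal.ofReal (f x / g x) := (hf.div hg).ennreal_ofReal
  rw [← withDensity_mul _ hg.ennreal_ofReal hfg]
  congr 1
  ext x
  rw [Pi.mul_apply, ← ENNReal.ofReal_mul (hg0 x).le, mul_div_cancel₀ _ (hg0 x).ne']

section Divergence

variable {lam : Measure α} {f g : α → ℝ} (hf : Measurable f) (hg : Measurable g)
  (hf0 : ∀ x, 0 < f x) (hg0 : ∀ x, 0 < g x)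
  [IsProbabilityMeasure (lam.withDensity fun x => ENNReal.ofReal (g x))]

include hf hg hf0 hg0

lemma llr_withDensity : llr (lam.withDensity fun x => ENNReal.ofReal (f x))
      (lam.withDensity fun x => ENNReal.ofReal (g x))
    =ᵐ[lam.withDensity fun x => ENNReal.ofReal (f x)]
      fun x => Real.log (f x) - Real.log (g x) := by
  have hdiv := withDensity_ofReal_div (lam := lam) hf hg hg0
  have hac : lam.withDensity (fun x => ENNReal.ofReal (f x))
      ≪ lam.withDensity fun x => ENNReal.ofReal (g x) := by
    rw [hdiv]; exact withDensity_absolutelyContinuous _ _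
  have h := Measure.rnDeriv_withDensity (lam.withDensity fun x => ENNReal.ofReal (g x))
    (hf.div hg).ennreal_ofReal
  simp only [Pi.div_apply] at h
  rw [← hdiv] at h
  filter_upwards [hac.ae_le h] with x hx
  rw [llr, hx, ENNReal.toReal_ofReal (div_pos (hf0 x) (hg0 x)).le,
    Real.log_div (hf0 x).ne' (hg0 x).ne']

variable [IsProbabilityMeasure (lam.withDensity fun x => ENNReal.ofReal (f x))]
  (hlf : Integrable (fun x => Real.log (f x))
    (lam.withDensity fun x => ENNReal.ofReal (f x)))
  (hlg : Integrable (fun x => Real.log (g x)) (lam.withDensity fun x => ENNReal.ofReal (f x)))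

include hlf hlg

lemma klDiv_withDensity : klDiv (lam.withDensity fun x => ENNReal.ofReal (f x))
      (lam.withDensity fun x => ENNReal.ofReal (g x))
    = ENNReal.ofReal (∫ x, Real.log (f x) ∂(lam.withDensity fun x => ENNReal.ofReal (f x))
      - ∫ x, Real.log (g x) ∂(lam.withDensity fun x => ENNReal.ofReal (f x))) := by
  have hllr := llr_withDensity (lam := lam) hf hg hf0 hg0
  have hac : lam.withDensity (fun x => ENNReal.ofReal (f x))
      ≪ lam.withDensity fun x => ENNReal.ofReal (g x) := by
    rw [withDensity_ofReal_div (lam := lam) hf hg hg0]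
    exact withDensity_absolutelyContinuous _ _
  rw [klDiv_of_ac_of_integrable hac ((integrable_congr hllr).2 (hlf.sub hlg)),
    integral_congr_ae hllr, integral_sub hlf hlg]
  simp

/-- Gibbs' inequality. -/
lemma integral_log_le_integral_log :
    ∫ x, Real.log (g x) ∂(lam.withDensity fun x => ENNReal.ofReal (f x))
      ≤ ∫ x, Real.log (f x) ∂(lam.withDensity fun x => ENNReal.ofReal (f x)) := by
  have hllr := llr_withDensity (lam := lam) hf hg hf0 hg0
  have hac : lam.withDensity (fun x => ENNReal.ofReal (f x))
      ≪ lam.withDensity fun x => ENNReal.ofReal (g x) := by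
    rw [withDensity_ofReal_div (lam := lam) hf hg hg0]
    exact withDensity_absolutelyContinuous _ _
  have h := integral_llr_add_sub_measure_univ_nonneg hac
    ((integrable_congr hllr).2 (hlf.sub hlg))
  rw [integral_congr_ae hllr, integral_sub hlf hlg] at h
  simpa using h

end Divergence

/-- A bounded probability density has a finite entropy as soon as the logarithm of some other
density `g` is integrable: by `log t ≤ t - 1`, `log f ≥ log g - g / f`, and `g / f` has a finite
mean. -/
lemma integrable_log_of_le {lam : Measure α} {f g : α → ℝ} (hf : Measurable f)
    (hg : Measurable g) (hf0 : ∀ x, 0 < f x) (hg0 : ∀ x, 0 < g x)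
    [IsProbabilityMeasure (lam.withDensity fun x => ENNReal.ofReal (f x))]
    {C : ℝ} (hC : ∀ x, f x ≤ C) (hgint : ∫⁻ x, ENNReal.ofReal (g x) ∂lam ≠ ∞)
    (hlg : Integrable (fun x => Real.log (g x)) (lam.withDensity fun x => ENNReal.ofReal (f x))) :
    Integrable (fun x => Real.log (f x)) (lam.withDensity fun x => ENNReal.ofReal (f x)) := by
  have hgf : Integrable (fun x => g x / f x)
      (lam.withDensity fun x => ENNReal.ofReal (f x)) := by
    rw [integrable_withDensity_ofReal_iff hf]
    have : (fun x => (ENNReal.ofReal (f x)).toReal • (g x / f x)) = g := by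
      ext x
      rw [ENNReal.toReal_ofReal (hf0 x).le, smul_eq_mul, mul_div_cancel₀ _ (hf0 x).ne']
    rw [this]
    exact (lintegral_ofReal_ne_top_iff_integrable hg.aestronglyMeasurable
      (ae_of_all _ fun x => (hg0 x).le)).1 hgint
  refine Integrable.mono' ((integrable_const |Real.log C|).add (hlg.abs.add hgf))
    (Real.measurable_log.comp hf).aestronglyMeasurable (ae_of_all _ fun x => ?_)
  have h1 : Real.log (f x) ≤ Real.log C := Real.log_le_log (hf0 x) (hC x)
  have h2 : Real.log (g x) - g x / f x ≤ Real.log (f x) := by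
    have := Real.log_le_sub_one_of_pos (div_pos (hg0 x) (hf0 x))
    rw [Real.log_div (hg0 x).ne' (hf0 x).ne'] at this
    linarith
  have h3 : 0 ≤ g x / f x := (div_pos (hg0 x) (hf0 x)).le
  simp only [Pi.add_apply, Real.norm_eq_abs]
  rw [abs_le]
  constructor
  · linarith [neg_abs_le (Real.log (g x)), abs_nonneg (Real.log C)]
  · linarith [le_abs_self (Real.log C), abs_nonneg (Real.log (g x))]

end Densities

section Entropy

variable {E : Type*} [MeasureSpace E] [SigmaFinite (volume : Measure E)] {f : E → ℝ}

lemma log_rnDeriv_withDensity (hf : Measurable f) (hf0 : ∀ x, 0 ≤ f x) :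
    (fun x => Real.log (((volume : Measure E).withDensity fun x => ENNReal.ofReal (f x)).rnDeriv
      volume x).toReal) =ᵐ[volume.withDensity fun x => ENNReal.ofReal (f x)]
      fun x => Real.log (f x) := by
  have hac : (volume : Measure E).withDensity (fun x => ENNReal.ofReal (f x)) ≪ volume :=
    withDensity_absolutelyContinuous _ _
  filter_upwards [hac.ae_le (Measure.rnDeriv_withDensity (volume : Measure E) hf.ennreal_ofReal)]
    with x hx
  rw [hx, ENNReal.toReal_ofReal (hf0 x)]

lemma diffEntropy_withDensity (hf : Measurable f) (hf0 : ∀ x, 0 ≤ f x) :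
    diffEntropy ((volume : Measure E).withDensity fun x => ENNReal.ofReal (f x))
      = -∫ x, Real.log (f x) ∂(volume.withDensity fun x => ENNReal.ofReal (f x)) := by
  rw [diffEntropy, integral_congr_ae (log_rnDeriv_withDensity hf hf0)]

lemma hasDiffEntropy_withDensity (hf : Measurable f) (hf0 : ∀ x, 0 ≤ f x)
    (h : Integrable (fun x => Real.log (f x))
      (volume.withDensity fun x => ENNReal.ofReal (f x))) :
    HasDiffEntropy ((volume : Measure E).withDensity fun x => ENNReal.ofReal (f x)) :=
  ⟨withDensity_absolutelyContinuous _ _,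
    (integrable_congr (log_rnDeriv_withDensity hf hf0)).2 h⟩

end Entropy

/-- `log` of a Gaussian density is a quadratic polynomial, hence integrable under any law with
finite second moments. -/
lemma integrable_log_gaussPdf {Ω ι : Type*} [Fintype ι] [DecidableEq ι] [MeasurableSpace Ω]
    {μ : Measure Ω} [IsFiniteMeasure μ] {X : Ω → ι → ℝ} (hX : ∀ c, MemLp (fun ω => X ω c) 2 μ)
    (m : ι → ℝ) (K : Matrix ι ι ℝ) :
    Integrable (fun ω => Real.log (gaussPdf m K (X ω))) μ := by
  simp_rw [log_gaussPdf, dotProduct, Matrix.mulVec, dotProduct, Finset.mul_sum]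
  have hd : ∀ c, MemLp (fun ω => (X ω - m) c) 2 μ := fun c => (hX c).sub (memLp_const _)
  refine Integrable.const_mul (Integrable.add (integrable_const _) ?_) _
  refine integrable_finsetSum _ fun i _ => integrable_finsetSum _ fun j _ => ?_
  have := ((hd i).integrable_mul (hd j)).const_mul (K⁻¹ i j)
  refine this.congr (ae_of_all _ fun ω => ?_)
  simp only [Pi.mul_apply]
  ring

/-! ### One use of a channel with additive Gaussian noise -/

section AdditiveNoise

lemma map_prod_withDensity_add {X : Type*} [MeasurableSpace X] {d : ℕ} {ρ : Measure X} [SFinite ρ]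
    {m : X → Vec d} (hm : Measurable m) {φ : Vec d → ℝ≥0∞} (hφ : Measurable φ) :
    (ρ.prod (volume.withDensity φ)).map (fun x => (x.1, m x.1 + x.2))
      = (ρ.prod volume).withDensity fun x => φ (x.2 - m x.1) := by
  refine Measure.ext_of_lintegral _ fun h hh => ?_
  rw [lintegral_map hh (by fun_prop), prod_withDensity_right hφ,
    lintegral_withDensity_eq_lintegral_mul _ (by fun_prop) (by fun_prop),
    lintegral_withDensity_eq_lintegral_mul _ (by fun_prop) hh,
    lintegral_prod _ (by fun_prop), lintegral_prod _ (by fun_prop)]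
  refine lintegral_congr fun x => ?_
  simp only [Pi.mul_apply]
  rw [← lintegral_add_left_eq_self (fun y => φ (y - m x) * h (x, y)) (m x)]
  simp

lemma lintegral_gaussPdf {d : ℕ} {K : Matrix (Fin d) (Fin d) ℝ} (hK : K.PosDef) :
    ∫⁻ x : Vec d, ENNReal.ofReal (gaussPdf 0 K x) = 1 := by
  have h : (gaussianLaw K) Set.univ = 1 := measure_univ
  rwa [gaussianLaw_eq_withDensity hK, withDensity_apply _ MeasurableSet.univ,
    Measure.restrict_univ] at h

variable {Ω F G : Type*} [MeasurableSpace Ω] [MeasurableSpace F] [MeasurableSpace G]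
  [StandardBorelSpace G] [Nonempty G] {d : ℕ} (μ : Measure Ω) [IsProbabilityMeasure μ]
  (W : Ω → F) (U : Ω → G) (m : F × G → Vec d) (K : Matrix (Fin d) (Fin d) ℝ)

/-- The conditional density of the output given `W`: the density of the noise, shifted by
the mean `m (W, U)` and averaged over the conditional law of `U` given `W`. -/
noncomputable def outputDensity (w : F) (b : Vec d) : ℝ :=
  ∫ u, gaussPdf 0 K (b - m (w, u)) ∂(condDistrib U W μ w)

variable {μ W U m K} (hm : Measurable m) (hK : K.PosDef)

include hK in
lemma integrable_noise_density (hm : Measurable m) (w : F) (b : Vec d) :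
    Integrable (fun u => gaussPdf 0 K (b - m (w, u))) (condDistrib U W μ w) := by
  refine Integrable.of_bound (C := gaussPdf 0 K 0) ?_ (ae_of_all _ fun u => ?_)
  · have : Measurable fun u => gaussPdf 0 K (b - m (w, u)) := by fun_prop
    exact this.aestronglyMeasurable
  · rw [Real.norm_eq_abs, abs_of_pos (gaussPdf_pos _ _ _)]
    exact gaussPdf_le hK 0 _

include hm in
lemma measurable_outputDensity : Measurable (Function.uncurry (outputDensity μ W U m K)) := by
  have h : Measurable fun x : (F × Vec d) × G => gaussPdf 0 K (x.1.2 - m (x.1.1, x.2)) := by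
    fun_prop
  have := StronglyMeasurable.integral_kernel_prod_right'
    (κ := (condDistrib U W μ).comap (Prod.fst : F × Vec d → F) measurable_fst) h.stronglyMeasurable
  exact this.measurable

include hm hK

lemma outputDensity_pos (w : F) (b : Vec d) : 0 < outputDensity μ W U m K w b := by
  refine (integral_pos_iff_support_of_nonneg (fun u => (gaussPdf_pos _ _ _).le)
    (integrable_noise_density hK hm w b)).2 ?_
  have : Function.support (fun u => gaussPdf 0 K (b - m (w, u))) = Set.univ := by
    ext u; simp [(gaussPdf_pos _ _ _).ne']
  rw [this]
  simp

lemma outputDensity_le (w : F) (b : Vec d) : outputDensity μ W U m K w b ≤ gaussPdf 0 K 0 := by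
  calc outputDensity μ W U m K w b ≤ ∫ _, gaussPdf 0 K 0 ∂(condDistrib U W μ w) :=
        integral_mono (integrable_noise_density hK hm w b) (integrable_const _)
          fun _ => gaussPdf_le hK 0 _
    _ = gaussPdf 0 K 0 := by simp

lemma ofReal_outputDensity (w : F) (b : Vec d) : ENNReal.ofReal (outputDensity μ W U m K w b)
    = ∫⁻ u, ENNReal.ofReal (gaussPdf 0 K (b - m (w, u))) ∂(condDistrib U W μ w) :=
  ofReal_integral_eq_lintegral_ofReal (integrable_noise_density hK hm w b)
    (ae_of_all _ fun _ => (gaussPdf_pos _ _ _).le)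

variable {V B : Ω → Vec d} (hW : Measurable W) (hU : Measurable U) (hV : Measurable V)
  (hB : Measurable B) (hVlaw : μ.map V = gaussianLaw K)
  (hind : IndepFun V (fun ω => (W ω, U ω)) μ)
  (hout : ∀ᵐ ω ∂μ, B ω = m (W ω, U ω) + V ω)

include hW hU hV hB hVlaw hind hout

omit [StandardBorelSpace G] [Nonempty G] hB in
/-- The conditional density of the output given `(W, U)` is the shifted density of the noise. -/
lemma map_input_output : μ.map (fun ω => ((W ω, U ω), B ω))
    = ((μ.map fun ω => (W ω, U ω)).prod volume).withDensity
      fun x => ENNReal.ofReal (gaussPdf 0 K (x.2 - m x.1)) := by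
  have h1 : μ.map (fun ω => ((W ω, U ω), B ω))
      = (μ.map fun ω => ((W ω, U ω), V ω)).map fun x => (x.1, m x.1 + x.2) := by
    rw [Measure.map_map (by fun_prop) (by fun_prop)]
    refine Measure.map_congr ?_
    filter_upwards [hout] with ω hω
    simp [hω]
  have h2 : μ.map (fun ω => ((W ω, U ω), V ω))
      = (μ.map fun ω => (W ω, U ω)).prod (μ.map V) :=
    (indepFun_iff_map_prod_eq_prod_map_map (by fun_prop) (by fun_prop)).1 hind.symm
  rw [h1, h2, hVlaw, gaussianLaw_eq_withDensity hK, map_prod_withDensity_add hm (by fun_prop)]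

lemma map_output : μ.map (fun ω => (W ω, B ω))
    = ((μ.map W).prod volume).withDensity
      fun x => ENNReal.ofReal (outputDensity μ W U m K x.1 x.2) := by
  have hf : Measurable fun x : F × Vec d =>
      ENNReal.ofReal (outputDensity μ W U m K x.1 x.2) :=
    (measurable_outputDensity hm).ennreal_ofReal
  have h1 : μ.map (fun ω => (W ω, B ω))
      = (μ.map fun ω => ((W ω, U ω), B ω)).map fun x => (x.1.1, x.2) := by
    rw [Measure.map_map (by fun_prop) (by fun_prop)]
    rfl
  rw [h1, map_input_output hm hK hW hU hV hVlaw hind hout]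
  refine Measure.ext_of_lintegral _ fun h hh => ?_
  rw [lintegral_map hh (by fun_prop),
    lintegral_withDensity_eq_lintegral_mul _ (by fun_prop) (by fun_prop),
    lintegral_withDensity_eq_lintegral_mul _ hf hh,
    lintegral_prod _ (by fun_prop), lintegral_prod _ (by fun_prop),
    ← compProd_map_condDistrib hU.aemeasurable, Measure.lintegral_compProd (by fun_prop)]
  refine lintegral_congr fun w => ?_
  rw [lintegral_lintegral_swap (by fun_prop)]
  refine lintegral_congr fun b => ?_
  simp only [Pi.mul_apply]
  rw [lintegral_mul_const _ (by fun_prop), ofReal_outputDensity hm hK]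

lemma isProbabilityMeasure_output : IsProbabilityMeasure (((μ.map W).prod volume).withDensity
      fun x => ENNReal.ofReal (outputDensity μ W U m K x.1 x.2)) := by
  rw [← map_output hm hK hW hU hV hB hVlaw hind hout]
  exact Measure.isProbabilityMeasure_map (by fun_prop)

omit hK hW hU hV hB hVlaw hind hout in
lemma withDensity_outputDensity_apply (w : F) :
    (Kernel.const F (volume : Measure (Vec d))).withDensity
      (fun w b => ENNReal.ofReal (outputDensity μ W U m K w b)) w
    = volume.withDensity fun b => ENNReal.ofReal (outputDensity μ W U m K w b) := by
  rw [Kernel.withDensity_apply _ (measurable_outputDensity hm).ennreal_ofReal, Kernel.const_apply]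

omit hW hU hV hB hVlaw hind hout in
lemma isMarkovKernel_outputDensity : IsMarkovKernel
    ((Kernel.const F (volume : Measure (Vec d))).withDensity
      fun w b => ENNReal.ofReal (outputDensity μ W U m K w b)) := by
  refine ⟨fun w => ⟨?_⟩⟩
  rw [withDensity_outputDensity_apply hm, withDensity_apply _ MeasurableSet.univ,
    Measure.restrict_univ]
  simp_rw [ofReal_outputDensity hm hK]
  rw [lintegral_lintegral_swap (by fun_prop)]
  have : ∀ u, ∫⁻ b, ENNReal.ofReal (gaussPdf 0 K (b - m (w, u))) = 1 := fun u => by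
    rw [lintegral_sub_right_eq_self (fun b => ENNReal.ofReal (gaussPdf 0 K b)),
      lintegral_gaussPdf hK]
  simp [this]

lemma condDistrib_output : condDistrib B W μ =ᵐ[μ.map W]
    (Kernel.const F (volume : Measure (Vec d))).withDensity
      fun w b => ENNReal.ofReal (outputDensity μ W U m K w b) := by
  have := isMarkovKernel_outputDensity (μ := μ) (W := W) (U := U) hm hK
  refine condDistrib_ae_eq_of_measure_eq_compProd W hB.aemeasurable ?_
  rw [Measure.compProd_withDensity (measurable_outputDensity hm).ennreal_ofReal,
    Measure.compProd_const, map_output hm hK hW hU hV hB hVlaw hind hout]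


lemma diffEntropy_condDistrib_output : (fun w => diffEntropy (condDistrib B W μ w)) =ᵐ[μ.map W]
    fun w => -∫ b, Real.log (outputDensity μ W U m K w b) ∂(condDistrib B W μ w) := by
  filter_upwards [condDistrib_output hm hK hW hU hV hB hVlaw hind hout] with w hw
  rw [hw, withDensity_outputDensity_apply hm, diffEntropy_withDensity]
  · exact (measurable_outputDensity hm).comp measurable_prodMk_left
  · exact fun b => (outputDensity_pos hm hK w b).le

variable (hB2 : ∀ c, MemLp (fun ω => B ω c) 2 μ)
include hB2

lemma integrable_log_outputDensity :
    Integrable (fun ω => Real.log (outputDensity μ W U m K (W ω) (B ω))) μ := by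
  have hlaw := map_output hm hK hW hU hV hB hVlaw hind hout
  have := isProbabilityMeasure_output hm hK hW hU hV hB hVlaw hind hout
  have hf := measurable_outputDensity (μ := μ) (W := W) (U := U) (K := K) hm
  have hWB : Measurable fun ω => (W ω, B ω) := by fun_prop
  have key : Integrable (fun x : F × Vec d => Real.log (outputDensity μ W U m K x.1 x.2))
      (((μ.map W).prod volume).withDensity
        fun x => ENNReal.ofReal (outputDensity μ W U m K x.1 x.2)) := by
    refine integrable_log_of_le (g := fun x => gaussPdf 0 K x.2) hf (by fun_prop)
      (fun x => outputDensity_pos hm hK _ _) (fun x => gaussPdf_pos _ _ _)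
      (fun x => outputDensity_le hm hK _ _) ?_ ?_
    · have : IsProbabilityMeasure (μ.map W) := Measure.isProbabilityMeasure_map (by fun_prop)
      rw [lintegral_prod _ (by fun_prop)]
      simp [lintegral_gaussPdf hK]
    · rw [← hlaw]
      have hm' : Measurable fun x : F × Vec d => Real.log (gaussPdf 0 K x.2) :=
        Real.measurable_log.comp (by fun_prop)
      exact (integrable_map_measure hm'.aestronglyMeasurable hWB.aemeasurable).2
        (integrable_log_gaussPdf hB2 0 K)
  rw [← hlaw] at key
  exact (integrable_map_measure (Real.measurable_log.comp hf).aestronglyMeasurable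
    hWB.aemeasurable).1 key

lemma integrable_log_outputDensity_compProd :
    Integrable (fun x : F × Vec d => Real.log (outputDensity μ W U m K x.1 x.2))
      (μ.map W ⊗ₘ condDistrib B W μ) := by
  have hf := measurable_outputDensity (μ := μ) (W := W) (U := U) (K := K) hm
  rw [compProd_map_condDistrib hB.aemeasurable]
  exact (integrable_map_measure (Real.measurable_log.comp hf).aestronglyMeasurable
    (by fun_prop)).2 (integrable_log_outputDensity hm hK hW hU hV hB hVlaw hind hout hB2)

lemma hasCondEntropy_output : HasCondEntropy B W μ := by
  have hint := integrable_log_outputDensity_compProd hm hK hW hU hV hB hVlaw hind hout hB2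
  constructor
  · filter_upwards [condDistrib_output hm hK hW hU hV hB hVlaw hind hout,
      ((Measure.integrable_compProd_iff hint.1).1 hint).1] with w hw hi
    rw [hw, withDensity_outputDensity_apply hm] at hi ⊢
    exact hasDiffEntropy_withDensity ((measurable_outputDensity hm).comp measurable_prodMk_left)
      (fun b => (outputDensity_pos hm hK w b).le) hi
  · refine (integrable_congr
      (diffEntropy_condDistrib_output hm hK hW hU hV hB hVlaw hind hout)).2 ?_
    simpa using (Integrable.integral_compProd hint).neg

lemma condEntropy_output :
    condEntropy B W μ = -∫ ω, Real.log (outputDensity μ W U m K (W ω) (B ω)) ∂μ := by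
  have hint := integrable_log_outputDensity_compProd hm hK hW hU hV hB hVlaw hind hout hB2
  have hf := measurable_outputDensity (μ := μ) (W := W) (U := U) (K := K) hm
  have hlf : Measurable fun x : F × Vec d => Real.log (outputDensity μ W U m K x.1 x.2) :=
    Real.measurable_log.comp hf
  rw [condEntropy, integral_congr_ae
    (diffEntropy_condDistrib_output hm hK hW hU hV hB hVlaw hind hout), integral_neg,
    ← Measure.integral_compProd hint, compProd_map_condDistrib hB.aemeasurable,
    integral_map (by fun_prop) hlf.aestronglyMeasurable]

/-- The mutual information of the channel use is `H(B | W) - H(V)`. -/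
lemma condMutualInfo_output : condMutualInfo U B W μ
      = ENNReal.ofReal (condEntropy B W μ + ∫ v, Real.log (gaussPdf 0 K v) ∂(gaussianLaw K)) ∧
    0 ≤ condEntropy B W μ + ∫ v, Real.log (gaussPdf 0 K v) ∂(gaussianLaw K) := by
  have hlaw := map_input_output hm hK hW hU hV hVlaw hind hout
  have hf := measurable_outputDensity (μ := μ) (W := W) (U := U) (K := K) hm
  have hWU : Measurable fun ω => (W ω, U ω) := by fun_prop
  have hWUB : Measurable fun ω => ((W ω, U ω), B ω) := by fun_prop
  have hρ : IsProbabilityMeasure (μ.map fun ω => (W ω, U ω)) :=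
    Measure.isProbabilityMeasure_map hWU.aemeasurable
  have hker := isMarkovKernel_outputDensity (μ := μ) (W := W) (U := U) hm hK
  have hprodlaw : ((μ.map fun ω => (W ω, U ω)) ⊗ₘ (condDistrib B W μ).prodMkRight G)
      = ((μ.map fun ω => (W ω, U ω)).prod volume).withDensity
        fun x => ENNReal.ofReal (outputDensity μ W U m K x.1.1 x.2) := by
    have hae : ((condDistrib B W μ).prodMkRight G) =ᵐ[μ.map fun ω => (W ω, U ω)]
        ((Kernel.const F (volume : Measure (Vec d))).withDensity
          fun w b => ENNReal.ofReal (outputDensity μ W U m K w b)).prodMkRight G := by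
      have hc := condDistrib_output hm hK hW hU hV hB hVlaw hind hout
      have hfst : (μ.map fun ω => (W ω, U ω)).map Prod.fst = μ.map W := by
        rw [Measure.map_map measurable_fst hWU]; rfl
      rw [← hfst] at hc
      filter_upwards [ae_of_ae_map measurable_fst.aemeasurable hc] with x hx
      simp only [Kernel.prodMkRight_apply, hx]
    have hk2 : ((Kernel.const F (volume : Measure (Vec d))).withDensity
          fun w b => ENNReal.ofReal (outputDensity μ W U m K w b)).prodMkRight G
        = (Kernel.const (F × G) (volume : Measure (Vec d))).withDensity
          fun x b => ENNReal.ofReal (outputDensity μ W U m K x.1 b) := by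
      ext1 x
      have hmx : Measurable (Function.uncurry fun (x : F × G) (b : Vec d) =>
          ENNReal.ofReal (outputDensity μ W U m K x.1 b)) :=
        (hf.comp ((measurable_fst.comp measurable_fst).prodMk measurable_snd)).ennreal_ofReal
      rw [Kernel.prodMkRight_apply, withDensity_outputDensity_apply hm,
        Kernel.withDensity_apply _ hmx, Kernel.const_apply]
    rw [Measure.compProd_congr hae, hk2]
    have : IsMarkovKernel ((Kernel.const (F × G) (volume : Measure (Vec d))).withDensity
        fun x b => ENNReal.ofReal (outputDensity μ W U m K x.1 b)) := by
      rw [← hk2]; infer_instance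
    rw [Measure.compProd_withDensity, Measure.compProd_const]
    exact (hf.comp ((measurable_fst.comp measurable_fst).prodMk measurable_snd)).ennreal_ofReal
  have h1 : IsProbabilityMeasure (((μ.map fun ω => (W ω, U ω)).prod volume).withDensity
      fun x => ENNReal.ofReal (gaussPdf 0 K (x.2 - m x.1))) := by
    rw [← hlaw]; exact Measure.isProbabilityMeasure_map hWUB.aemeasurable
  have h2 : IsProbabilityMeasure (((μ.map fun ω => (W ω, U ω)).prod volume).withDensity
      fun x => ENNReal.ofReal (outputDensity μ W U m K x.1.1 x.2)) := by
    rw [← hprodlaw]; infer_instance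
  have hfm : Measurable fun x : (F × G) × Vec d => gaussPdf 0 K (x.2 - m x.1) := by fun_prop
  have hgm : Measurable fun x : (F × G) × Vec d => outputDensity μ W U m K x.1.1 x.2 :=
    hf.comp ((measurable_fst.comp measurable_fst).prodMk measurable_snd)
  have hlfm : Measurable fun x : (F × G) × Vec d =>
      Real.log (gaussPdf 0 K (x.2 - m x.1)) := Real.measurable_log.comp hfm
  have hlgm : Measurable fun x : (F × G) × Vec d =>
      Real.log (outputDensity μ W U m K x.1.1 x.2) := Real.measurable_log.comp hgm
  have hlogφ : Measurable fun v : Vec d => Real.log (gaussPdf 0 K v) :=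
    Real.measurable_log.comp (by fun_prop)
  have hVint : Integrable (fun v => Real.log (gaussPdf 0 K v)) (gaussianLaw K) :=
    integrable_log_gaussPdf (X := id) (fun c => memLp_eval_of_isGaussian _ c) 0 K
  have hVae : (fun ω => Real.log (gaussPdf 0 K (B ω - m (W ω, U ω))))
      =ᵐ[μ] fun ω => Real.log (gaussPdf 0 K (V ω)) := by
    filter_upwards [hout] with ω hω
    rw [hω, add_sub_cancel_left]
  have hVint' : Integrable (fun ω => Real.log (gaussPdf 0 K (V ω))) μ := by
    rw [← hVlaw] at hVint
    exact (integrable_map_measure hlogφ.aestronglyMeasurable hV.aemeasurable).1 hVint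
  have hI1 : Integrable (fun x : (F × G) × Vec d => Real.log (gaussPdf 0 K (x.2 - m x.1)))
      (((μ.map fun ω => (W ω, U ω)).prod volume).withDensity
        fun x => ENNReal.ofReal (gaussPdf 0 K (x.2 - m x.1))) := by
    rw [← hlaw]
    refine (integrable_map_measure (Real.measurable_log.comp hfm).aestronglyMeasurable
      hWUB.aemeasurable).2 ?_
    exact (integrable_congr hVae).2 hVint'
  have hI2 : Integrable (fun x : (F × G) × Vec d => Real.log (outputDensity μ W U m K x.1.1 x.2))
      (((μ.map fun ω => (W ω, U ω)).prod volume).withDensity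
        fun x => ENNReal.ofReal (gaussPdf 0 K (x.2 - m x.1))) := by
    rw [← hlaw]
    exact (integrable_map_measure (Real.measurable_log.comp hgm).aestronglyMeasurable
      hWUB.aemeasurable).2 (integrable_log_outputDensity hm hK hW hU hV hB hVlaw hind hout hB2)
  have e1 : ∫ x, Real.log (gaussPdf 0 K (x.2 - m x.1))
        ∂(((μ.map fun ω => (W ω, U ω)).prod volume).withDensity
          fun x => ENNReal.ofReal (gaussPdf 0 K (x.2 - m x.1)))
      = ∫ v, Real.log (gaussPdf 0 K v) ∂(gaussianLaw K) := by
    rw [← hlaw, integral_map hWUB.aemeasurable hlfm.aestronglyMeasurable,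
      ← hVlaw, integral_map hV.aemeasurable hlogφ.aestronglyMeasurable]
    exact integral_congr_ae hVae
  have e2 : ∫ x, Real.log (outputDensity μ W U m K x.1.1 x.2)
        ∂(((μ.map fun ω => (W ω, U ω)).prod volume).withDensity
          fun x => ENNReal.ofReal (gaussPdf 0 K (x.2 - m x.1)))
      = -condEntropy B W μ := by
    rw [← hlaw, integral_map hWUB.aemeasurable hlgm.aestronglyMeasurable,
      condEntropy_output hm hK hW hU hV hB hVlaw hind hout hB2, neg_neg]
  constructor
  · rw [condMutualInfo, hprodlaw, hlaw, klDiv_withDensity hfm hgm (fun x => gaussPdf_pos _ _ _)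
      (fun x => outputDensity_pos hm hK _ _) hI1 hI2, e1, e2]
    congr 1
    ring
  · have := integral_log_le_integral_log hfm hgm (fun x => gaussPdf_pos _ _ _)
      (fun x => outputDensity_pos hm hK _ _) hI1 hI2
    rw [e1, e2] at this
    linarith

end AdditiveNoise

/-! ### The chain rule for densities -/

section ChainRule

lemma measurePreserving_init_last (d N : ℕ) :
    MeasurePreserving (fun x : Fin (N + 1) → Vec d => ((fun k : Fin N => x k.castSucc),
      x (Fin.last N))) volume (volume.prod volume) := by
  have h1 := volume_preserving_piFinSuccAbove (fun _ : Fin (N + 1) => Vec d) (Fin.last N)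
  have h2 : MeasurePreserving Prod.swap
      ((volume : Measure (Vec d)).prod (volume : Measure (Fin N → Vec d)))
      (volume.prod volume) := Measure.measurePreserving_swap
  have h3 := h2.comp h1
  convert! h3 using 1
  ext x k
  · simp [MeasurableEquiv.piFinSuccAbove, Fin.insertNthEquiv, Fin.init]
  · simp [MeasurableEquiv.piFinSuccAbove, Fin.insertNthEquiv]

/-- The product `∏_{i<N} f_i(x_i | x_0, …, x_{i-1})` of conditional densities. -/
noncomputable def segDensity {d : ℕ} (f : ∀ i : ℕ, (Fin i → Vec d) → Vec d → ℝ) :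
    (N : ℕ) → (Fin N → Vec d) → ℝ
  | 0, _ => 1
  | N + 1, x => segDensity f N (fun k => x k.castSucc)
      * f N (fun k => x k.castSucc) (x (Fin.last N))

variable {Ω : Type*} [MeasurableSpace Ω] {d N : ℕ} {f : ∀ i : ℕ, (Fin i → Vec d) → Vec d → ℝ}

lemma measurable_segDensity (hf : ∀ i < N, Measurable (Function.uncurry (f i))) :
    Measurable (segDensity f N) := by
  induction N with
  | zero => exact measurable_const
  | succ N ih =>
    have hx := (measurePreserving_init_last d N).measurable
    exact ((ih fun i hi => hf i (by omega)).comp hx.fst).mul ((hf N (by omega)).comp hx)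

lemma segDensity_pos (hf : ∀ i < N, ∀ w b, 0 < f i w b) (x : Fin N → Vec d) :
    0 < segDensity f N x := by
  induction N with
  | zero => exact one_pos
  | succ N ih => exact mul_pos (ih (fun i hi => hf i (by omega)) _) (hf N (by omega) _ _)

omit [MeasurableSpace Ω] in
lemma log_segDensity_seg (hf : ∀ i < N, ∀ w b, 0 < f i w b) (X : ℕ → Ω → Vec d) (ω : Ω) :
    Real.log (segDensity f N (seg X N ω))
      = ∑ i ∈ Finset.range N, Real.log (f i (seg X i ω) (X i ω)) := by
  induction N with
  | zero => simp [segDensity]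
  | succ N ih =>
    have h1 := segDensity_pos (fun i hi => hf i (by omega)) (seg X N ω)
    have h2 := hf N (by omega) (seg X N ω) (X N ω)
    rw [Finset.sum_range_succ, ← ih fun i hi => hf i (by omega), ← Real.log_mul h1.ne' h2.ne']
    rfl

lemma measurable_seg {X : ℕ → Ω → Vec d} (hX : ∀ i < N, Measurable (X i)) :
    Measurable (seg X N) :=
  measurable_pi_lambda _ fun k => hX k k.2

/-- If `f_i` is a density of `X_i` given `X_0, …, X_{i-1}` for `i < N`, then the product of the
`f_i` is a density of `(X_0, …, X_{N-1})`. -/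
lemma map_seg_eq_withDensity {μ : Measure Ω} [IsProbabilityMeasure μ] {X : ℕ → Ω → Vec d}
    (hX : ∀ i < N, Measurable (X i)) (hf : ∀ i < N, Measurable (Function.uncurry (f i)))
    (hf0 : ∀ i < N, ∀ w b, 0 < f i w b)
    (hlaw : ∀ i < N, μ.map (fun ω => (seg X i ω, X i ω))
      = ((μ.map (seg X i)).prod volume).withDensity fun x => ENNReal.ofReal (f i x.1 x.2)) :
    μ.map (seg X N) = volume.withDensity fun x => ENNReal.ofReal (segDensity f N x) := by
  induction N with
  | zero =>
    have hν : IsProbabilityMeasure (μ.map (seg X 0)) :=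
      Measure.isProbabilityMeasure_map (measurable_seg hX).aemeasurable
    have hv : (volume : Measure (Fin 0 → Vec d)) = Measure.dirac default := by
      rw [volume_pi, Measure.pi_of_empty _ default]
    have h1 : (fun x : Fin 0 → Vec d => ENNReal.ofReal (segDensity f 0 x)) = 1 := by
      ext x; simp [segDensity]
    rw [h1, withDensity_one, hv]
    refine Measure.ext fun s _ => ?_
    rcases s.eq_empty_or_nonempty with h | h
    · simp [h]
    · simp [Subsingleton.eq_univ_of_nonempty h]
  | succ N ih =>
    have ih := ih (fun i hi => hX i (by omega)) (fun i hi => hf i (by omega))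
      (fun i hi => hf0 i (by omega)) (fun i hi => hlaw i (by omega))
    have hmp := measurePreserving_init_last d N
    have hfN : Measurable fun x : (Fin N → Vec d) × Vec d => ENNReal.ofReal (f N x.1 x.2) :=
      (hf N (by omega)).ennreal_ofReal
    have hFN : Measurable fun x => ENNReal.ofReal (segDensity f N x) :=
      (measurable_segDensity fun i hi => hf i (by omega)).ennreal_ofReal
    have hF : Measurable fun x => ENNReal.ofReal (segDensity f (N + 1) x) :=
      (measurable_segDensity hf).ennreal_ofReal
    have hs : Measurable (seg X N) := measurable_seg fun i hi => hX i (by omega)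
    have hN : Measurable (X N) := hX N (by omega)
    have hsnoc : Measurable fun z : (Fin N → Vec d) × Vec d =>
        (Fin.snoc (α := fun _ => Vec d) z.1 z.2 : Fin (N + 1) → Vec d) := by
      refine measurable_pi_lambda _ fun k => ?_
      refine Fin.lastCases ?_ (fun k => ?_) k
      · simpa using measurable_snd
      · simp only [Fin.snoc_castSucc]
        exact (measurable_pi_apply k).comp measurable_fst
    have hsn : μ.map (seg X (N + 1)) = (μ.map fun ω => (seg X N ω, X N ω)).map fun z =>
        (Fin.snoc (α := fun _ => Vec d) z.1 z.2 : Fin (N + 1) → Vec d) := by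
      rw [Measure.map_map hsnoc (hs.prodMk hN)]
      congr 1
      ext ω k
      refine Fin.lastCases ?_ (fun k => ?_) k <;> simp [seg]
    rw [hsn, hlaw N (by omega), ih, prod_withDensity_left hFN]
    refine Measure.ext_of_lintegral _ fun h hh => ?_
    have hfst : Measurable fun z : (Fin N → Vec d) × Vec d =>
        ENNReal.ofReal (segDensity f N z.1) := hFN.comp measurable_fst
    have hhs : Measurable fun z : (Fin N → Vec d) × Vec d =>
        h (Fin.snoc (α := fun _ => Vec d) z.1 z.2) := hh.comp hsnoc
    rw [lintegral_map hh hsnoc, lintegral_withDensity_eq_lintegral_mul _ hfN hhs,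
      lintegral_withDensity_eq_lintegral_mul _ hfst (hfN.mul hhs),
      lintegral_withDensity_eq_lintegral_mul _ hF hh,
      ← hmp.lintegral_comp (hfst.mul (hfN.mul hhs))]
    refine lintegral_congr fun x => ?_
    have hx : (Fin.snoc (α := fun _ => Vec d) (fun k : Fin N => x k.castSucc) (x (Fin.last N)) :
        Fin (N + 1) → Vec d) = x := Fin.snoc_init_self x
    simp only [Pi.mul_apply, hx, segDensity]
    rw [ENNReal.ofReal_mul (segDensity_pos (fun i hi => hf0 i (by omega)) _).le, mul_assoc]

end ChainRule

lemma measurePreserving_curry (ι κ : Type*) [Fintype ι] [Fintype κ] :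
    MeasurePreserving (MeasurableEquiv.curry ι κ ℝ) volume volume := by
  refine MeasurePreserving.symm (MeasurableEquiv.curry ι κ ℝ).symm
    ⟨(MeasurableEquiv.curry ι κ ℝ).symm.measurable, ?_⟩
  symm
  refine Measure.pi_eq fun s hs => ?_
  have : (MeasurableEquiv.curry ι κ ℝ).symm ⁻¹' Set.univ.pi s
      = Set.univ.pi fun i => Set.univ.pi fun j => s (i, j) := by
    ext x
    simp [Set.mem_pi, MeasurableEquiv.coe_curry_symm, Function.uncurry]
  rw [MeasurableEquiv.map_apply, this, volume_pi, Measure.pi_pi, Fintype.prod_prod_type]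
  simp_rw [volume_pi, Measure.pi_pi]

/-! ### Entropies of channel processes -/

lemma lag_congr {d m : ℕ} (init : Fin m → Vec d) {x x' : ℕ → Vec d} {i j : ℕ}
    (h : j ≤ i → x (i - j) = x' (i - j)) : lag init x i j = lag init x' i j := by
  unfold lag
  split_ifs with hj
  · exact h hj
  · rfl
  · rfl

lemma extend_seg {Ω : Type*} {d N k : ℕ} (X : ℕ → Ω → Vec d) (ω : Ω) (hk : k < N) :
    extend (seg X N ω) k = X k ω := by
  simp [extend, hk, seg]

namespace GLCM

variable {p q L M : ℕ} (ch : GLCM p q L M)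

lemma mean_congr {i : ℕ} {x x' : ℕ → Vec q} {y y' : ℕ → Vec p} (hx : ∀ k ≤ i, x k = x' k)
    (hy : ∀ k < i, y k = y' k) : ch.mean i x y = ch.mean i x' y' := by
  unfold mean
  congr 1
  · refine Finset.sum_congr rfl fun j _ => ?_
    rw [lag_congr ch.b fun hj => hy _ (by omega)]
  · refine Finset.sum_congr rfl fun j _ => ?_
    rw [lag_congr ch.a fun hj => hx _ (by omega)]

lemma cost_congr {i : ℕ} {x x' : ℕ → Vec q} {y y' : ℕ → Vec p} (hx : ∀ k ≤ i, x k = x' k)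
    (hy : ∀ k ≤ i, y k = y' k) : ch.cost i x y = ch.cost i x' y' := by
  have h1 : ch.inputWindow i x = ch.inputWindow i x' := by
    ext jk
    rw [inputWindow, inputWindow, lag_congr ch.a fun hj => hx _ (by omega)]
  have h2 : ch.outputWindow i y = ch.outputWindow i y' := by
    ext jk
    rw [outputWindow, outputWindow, lag_congr ch.b fun hj => hy _ (by omega)]
  rw [cost, cost, h1, h2]

lemma measurable_mulVec {d e : ℕ} (K : Matrix (Fin d) (Fin e) ℝ) :
    Measurable fun v : Vec e => K.mulVec v :=
  (Continuous.matrix_mulVec continuous_const continuous_id).measurable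

lemma measurable_mean_extend (i N N' : ℕ) :
    Measurable fun x : (Fin N → Vec p) × (Fin N' → Vec q) =>
      ch.mean i (extend x.2) (extend x.1) := by
  unfold mean
  refine Measurable.add (Finset.measurable_sum _ fun j _ => ?_)
    (Finset.measurable_sum _ fun j _ => ?_)
  · exact (measurable_mulVec _).comp ((measurable_lag_extend _ _ _).comp measurable_fst)
  · exact (measurable_mulVec _).comp ((measurable_lag_extend _ _ _).comp measurable_snd)

end GLCM

/-- The processes `(A, B, V)` satisfy the channel equation up to time `n`, with a noise that has
the right law and is independent of the past, whatever the inputs are. -/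
structure SatisfiesChannel {p q L M : ℕ} (ch : GLCM p q L M) (n : ℕ)
    {Ω : Type*} [MeasurableSpace Ω] (μ : Measure Ω)
    (A : ℕ → Ω → Vec q) (B V : ℕ → Ω → Vec p) : Prop where
  measurable_A : ∀ i ≤ n, Measurable (A i)
  measurable_B : ∀ i ≤ n, Measurable (B i)
  measurable_V : ∀ i ≤ n, Measurable (V i)
  output_eq : ∀ i ≤ n, ∀ᵐ ω ∂μ,
    B i ω = ch.mean i (fun k => A k ω) (fun k => B k ω) + V i ω
  noise_law : ∀ i ≤ n, μ.map (V i) = gaussianLaw (ch.KV i)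
  noise_indep : ∀ i ≤ n,
    IndepFun (V i) (fun ω => (seg A (i + 1) ω, seg B i ω, seg V i ω)) μ

namespace SatisfiesChannel

variable {p q L M : ℕ} {ch : GLCM p q L M} {n : ℕ} {Ω : Type*} [MeasurableSpace Ω]
  {μ : Measure Ω} [IsProbabilityMeasure μ] {A : ℕ → Ω → Vec q} {B V : ℕ → Ω → Vec p}
  (h : SatisfiesChannel ch n μ A B V) (hKV : ∀ i ≤ n, (ch.KV i).PosDef)

include h

omit [IsProbabilityMeasure μ] in
lemma measurable_seg_A {N : ℕ} (hN : N ≤ n + 1) : Measurable (seg A N) :=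
  measurable_seg fun i hi => h.measurable_A i (by omega)

omit [IsProbabilityMeasure μ] in
lemma measurable_seg_B {N : ℕ} (hN : N ≤ n + 1) : Measurable (seg B N) :=
  measurable_seg fun i hi => h.measurable_B i (by omega)

omit [IsProbabilityMeasure μ] in
lemma measurable_seg_V {N : ℕ} (hN : N ≤ n + 1) : Measurable (seg V N) :=
  measurable_seg fun i hi => h.measurable_V i (by omega)

omit [IsProbabilityMeasure μ] in
lemma output_eq_seg {i : ℕ} (hi : i ≤ n) : ∀ᵐ ω ∂μ,
    B i ω = ch.mean i (extend (seg A (i + 1) ω)) (extend (seg B i ω)) + V i ω := by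
  filter_upwards [h.output_eq i hi] with ω hω
  rw [hω]
  congr 1
  exact ch.mean_congr (fun k hk => (extend_seg A ω (by omega)).symm)
    fun k hk => (extend_seg B ω hk).symm

omit [IsProbabilityMeasure μ] in
lemma noise_indep_seg {i : ℕ} (hi : i ≤ n) :
    IndepFun (V i) (fun ω => (seg B i ω, seg A (i + 1) ω)) μ :=
  (h.noise_indep i hi).comp measurable_id
    (measurable_snd.fst.prodMk measurable_fst : Measurable fun x :
      (Fin (i + 1) → Vec q) × (Fin i → Vec p) × (Fin i → Vec p) => (x.2.1, x.1))

omit [IsProbabilityMeasure μ] in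
lemma memLp_noise {i : ℕ} (hi : i ≤ n) (c : Fin p) : MemLp (fun ω => V i ω c) 2 μ := by
  have h1 := memLp_eval_of_isGaussian (gaussianLaw (ch.KV i)) c
  rw [← h.noise_law i hi] at h1
  exact h1.comp_of_map (h.measurable_V i hi).aemeasurable

/-- The conditional density of `B_i` given `B^{i-1}`. -/
noncomputable def condDensity (ch : GLCM p q L M) (μ : Measure Ω) [IsProbabilityMeasure μ]
    (A : ℕ → Ω → Vec q) (B : ℕ → Ω → Vec p) (i : ℕ) : (Fin i → Vec p) → Vec p → ℝ :=
  outputDensity μ (seg B i) (seg A (i + 1)) (fun x => ch.mean i (extend x.2) (extend x.1)) (ch.KV i)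

/-- `E[log φ_{V_i}(V_i)] = -H(V_i)`. -/
noncomputable def noiseLog (ch : GLCM p q L M) (i : ℕ) : ℝ :=
  ∫ v, Real.log (gaussPdf 0 (ch.KV i) v) ∂(gaussianLaw (ch.KV i))

include hKV

lemma map_seg_V : μ.map (seg V (n + 1)) = volume.withDensity fun x =>
    ENNReal.ofReal (segDensity (fun i _ v => gaussPdf 0 (ch.KV i) v) (n + 1) x) := by
  refine map_seg_eq_withDensity (fun i hi => h.measurable_V i (by omega)) (fun i hi => ?_)
    (fun i hi w b => gaussPdf_pos _ _ _) fun i hi => ?_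
  · exact (continuous_gaussPdf _ _).measurable.comp measurable_snd
  · have hs := h.measurable_seg_V (N := i) (by omega)
    have hV := h.measurable_V i (by omega)
    have hind : IndepFun (seg V i) (V i) μ :=
      ((h.noise_indep i (by omega)).comp measurable_id
        (measurable_snd.snd : Measurable fun x :
          (Fin (i + 1) → Vec q) × (Fin i → Vec p) × (Fin i → Vec p) => x.2.2)).symm
    have : IsProbabilityMeasure (μ.map (seg V i)) :=
      Measure.isProbabilityMeasure_map hs.aemeasurable
    rw [(indepFun_iff_map_prod_eq_prod_map_map hs.aemeasurable hV.aemeasurable).1 hind,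
      h.noise_law i (by omega), gaussianLaw_eq_withDensity (hKV i (by omega)),
      prod_withDensity_right (by fun_prop)]

omit hKV in
lemma integral_log_noise {i : ℕ} (hi : i ≤ n) :
    Integrable (fun ω => Real.log (gaussPdf 0 (ch.KV i) (V i ω))) μ ∧
      ∫ ω, Real.log (gaussPdf 0 (ch.KV i) (V i ω)) ∂μ = noiseLog ch i := by
  have hm : Measurable fun v : Vec p => Real.log (gaussPdf 0 (ch.KV i) v) :=
    Real.measurable_log.comp (by fun_prop)
  refine ⟨integrable_log_gaussPdf (fun c => h.memLp_noise hi c) _ _, ?_⟩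
  rw [noiseLog, ← h.noise_law i hi, integral_map (h.measurable_V i hi).aemeasurable
    hm.aestronglyMeasurable]

lemma noise_entropy : HasDiffEntropy (μ.map (seg V (n + 1))) ∧
    diffEntropy (μ.map (seg V (n + 1))) = -∑ i ∈ Finset.range (n + 1), noiseLog ch i := by
  have hlaw := h.map_seg_V hKV
  have hpos : ∀ i < n + 1, ∀ (_ : Fin i → Vec p) (b : Vec p), 0 < gaussPdf 0 (ch.KV i) b :=
    fun i _ _ b => gaussPdf_pos _ _ _
  have hm : Measurable (segDensity (fun i (_ : Fin i → Vec p) v => gaussPdf 0 (ch.KV i) v)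
      (n + 1)) := measurable_segDensity fun i _ =>
    (continuous_gaussPdf _ _).measurable.comp measurable_snd
  have hs := h.measurable_seg_V le_rfl
  have hlm : Measurable fun x => Real.log (segDensity
      (fun i (_ : Fin i → Vec p) v => gaussPdf 0 (ch.KV i) v) (n + 1) x) :=
    Real.measurable_log.comp hm
  have hint : Integrable (fun x => Real.log (segDensity
      (fun i (_ : Fin i → Vec p) v => gaussPdf 0 (ch.KV i) v) (n + 1) x))
      (μ.map (seg V (n + 1))) := by
    refine (integrable_map_measure hlm.aestronglyMeasurable hs.aemeasurable).2 ?_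
    simp only [Function.comp_def, log_segDensity_seg hpos]
    exact integrable_finsetSum _ fun i hi =>
      (h.integral_log_noise (by simpa using Nat.lt_succ_iff.1 (Finset.mem_range.1 hi))).1
  constructor
  · rw [hlaw] at hint ⊢
    exact hasDiffEntropy_withDensity hm (fun x => (segDensity_pos hpos x).le) hint
  · have h1 := diffEntropy_withDensity hm fun x => (segDensity_pos hpos x).le
    rw [← hlaw] at h1
    rw [h1, integral_map hs.aemeasurable hlm.aestronglyMeasurable]
    simp only [log_segDensity_seg hpos]
    rw [integral_finsetSum _ fun i hi =>
      (h.integral_log_noise (Nat.lt_succ_iff.1 (Finset.mem_range.1 hi))).1]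
    congr 1
    exact Finset.sum_congr rfl fun i hi =>
      (h.integral_log_noise (Nat.lt_succ_iff.1 (Finset.mem_range.1 hi))).2

omit h in
lemma condDensity_pos {i : ℕ} (hi : i ≤ n) (w : Fin i → Vec p) (b : Vec p) :
    0 < condDensity ch μ A B i w b :=
  outputDensity_pos (ch.measurable_mean_extend _ _ _) (hKV i hi) w b

omit h hKV in
lemma measurable_condDensity (i : ℕ) : Measurable (Function.uncurry (condDensity ch μ A B i)) :=
  measurable_outputDensity (ch.measurable_mean_extend _ _ _)

lemma map_seg_B : μ.map (seg B (n + 1)) = volume.withDensity fun x =>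
    ENNReal.ofReal (segDensity (condDensity ch μ A B) (n + 1) x) := by
  refine map_seg_eq_withDensity (fun i hi => h.measurable_B i (by omega))
    (fun i hi => measurable_condDensity i) (fun i hi => condDensity_pos hKV (by omega))
    fun i hi => ?_
  exact map_output (ch.measurable_mean_extend _ _ _) (hKV i (by omega))
    (h.measurable_seg_B (by omega)) (h.measurable_seg_A (by omega)) (h.measurable_V i (by omega))
    (h.measurable_B i (by omega)) (h.noise_law i (by omega)) (h.noise_indep_seg (by omega))
    (h.output_eq_seg (by omega))

variable (hB : ∀ i ≤ n, ∀ c, MemLp (fun ω => B i ω c) 2 μ)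
include hB

lemma entropiesExist : EntropiesExist n μ B V := by
  refine ⟨fun i hi => ?_, (h.noise_entropy hKV).1⟩
  exact hasCondEntropy_output (ch.measurable_mean_extend _ _ _) (hKV i hi)
    (h.measurable_seg_B (by omega)) (h.measurable_seg_A (by omega)) (h.measurable_V i hi)
    (h.measurable_B i hi) (h.noise_law i hi) (h.noise_indep_seg hi)
    (h.output_eq_seg hi) (hB i hi)

lemma condMutualInfo_eq {i : ℕ} (hi : i ≤ n) :
    condMutualInfo (seg A (i + 1)) (B i) (seg B i) μ
      = ENNReal.ofReal (condEntropy (B i) (seg B i) μ + noiseLog ch i) ∧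
    0 ≤ condEntropy (B i) (seg B i) μ + noiseLog ch i :=
  condMutualInfo_output (ch.measurable_mean_extend _ _ _) (hKV i hi)
    (h.measurable_seg_B (by omega)) (h.measurable_seg_A (by omega)) (h.measurable_V i hi)
    (h.measurable_B i hi) (h.noise_law i hi) (h.noise_indep_seg hi)
    (h.output_eq_seg hi) (hB i hi)

/-- `I(A^n → B^n) = ∑ H(B_i | B^{i-1}) - H(V^n)`. -/
lemma directedInfo_eq : (directedInfo n μ A B : EReal) = (entropyPayoff n μ B V : EReal) := by
  have hi : ∀ i ∈ Finset.range (n + 1), i ≤ n := fun i hi =>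
    Nat.lt_succ_iff.1 (Finset.mem_range.1 hi)
  rw [directedInfo, Finset.sum_congr rfl fun i h' => (h.condMutualInfo_eq hKV hB (hi i h')).1,
    ← ENNReal.ofReal_sum_of_nonneg fun i h' => (h.condMutualInfo_eq hKV hB (hi i h')).2,
    EReal.coe_ennreal_ofReal, max_eq_left (Finset.sum_nonneg fun i h' =>
      (h.condMutualInfo_eq hKV hB (hi i h')).2), entropyPayoff, (h.noise_entropy hKV).2,
    Finset.sum_add_distrib, sub_neg_eq_add]

/-- The chain rule `∑ H(B_i | B^{i-1}) = H(B^n)`, together with the integrability of the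
logarithm of the density of `B^n`. -/
lemma integrable_log_and_sum_condEntropy :
    Integrable (fun x => Real.log (segDensity (condDensity ch μ A B) (n + 1) x))
      (μ.map (seg B (n + 1))) ∧
    ∑ i ∈ Finset.range (n + 1), condEntropy (B i) (seg B i) μ
      = -∫ x, Real.log (segDensity (condDensity ch μ A B) (n + 1) x) ∂(μ.map (seg B (n + 1))) := by
  have hi : ∀ i ∈ Finset.range (n + 1), i ≤ n := fun i hi =>
    Nat.lt_succ_iff.1 (Finset.mem_range.1 hi)
  have hpos : ∀ i < n + 1, ∀ w b, 0 < condDensity ch μ A B i w b :=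
    fun i hi => condDensity_pos hKV (by omega)
  have hs := h.measurable_seg_B le_rfl
  have hlm : Measurable fun x => Real.log (segDensity (condDensity ch μ A B) (n + 1) x) :=
    Real.measurable_log.comp (measurable_segDensity fun i _ => measurable_condDensity i)
  have hint : ∀ i ∈ Finset.range (n + 1),
      Integrable (fun ω => Real.log (condDensity ch μ A B i (seg B i ω) (B i ω))) μ :=
    fun i h' => integrable_log_outputDensity (ch.measurable_mean_extend _ _ _) (hKV i (hi i h'))
      (h.measurable_seg_B (by grind)) (h.measurable_seg_A (by grind)) (h.measurable_V i (hi i h'))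
      (h.measurable_B i (hi i h')) (h.noise_law i (hi i h')) (h.noise_indep_seg (hi i h'))
      (h.output_eq_seg (hi i h')) (hB i (hi i h'))
  constructor
  · refine (integrable_map_measure hlm.aestronglyMeasurable hs.aemeasurable).2 ?_
    simp only [Function.comp_def, log_segDensity_seg hpos]
    exact integrable_finsetSum _ hint
  · rw [integral_map hs.aemeasurable hlm.aestronglyMeasurable]
    simp only [log_segDensity_seg hpos]
    rw [integral_finsetSum _ hint, ← Finset.sum_neg_distrib]
    refine Finset.sum_congr rfl fun i h' => ?_
    exact condEntropy_output (ch.measurable_mean_extend _ _ _) (hKV i (hi i h'))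
      (h.measurable_seg_B (by grind)) (h.measurable_seg_A (by grind)) (h.measurable_V i (hi i h'))
      (h.measurable_B i (hi i h')) (h.noise_law i (hi i h')) (h.noise_indep_seg (hi i h'))
      (h.output_eq_seg (hi i h')) (hB i (hi i h'))

/-- Gibbs' inequality for the outputs: the entropy is at most the cross entropy relative to any
probability density `g`. -/
lemma sum_condEntropy_le {g : (Fin (n + 1) → Vec p) → ℝ} (hg : Measurable g)
    (hg0 : ∀ x, 0 < g x)
    (hgprob : IsProbabilityMeasure ((volume : Measure (Fin (n + 1) → Vec p)).withDensity
      fun x => ENNReal.ofReal (g x)))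
    (hlg : Integrable (fun ω => Real.log (g (seg B (n + 1) ω))) μ) :
    ∑ i ∈ Finset.range (n + 1), condEntropy (B i) (seg B i) μ
      ≤ -∫ ω, Real.log (g (seg B (n + 1) ω)) ∂μ := by
  obtain ⟨hint, hsum⟩ := h.integrable_log_and_sum_condEntropy hKV hB
  have hs := h.measurable_seg_B le_rfl
  have hlgm : Measurable fun x => Real.log (g x) := Real.measurable_log.comp hg
  have hlg' := (integrable_map_measure hlgm.aestronglyMeasurable hs.aemeasurable).2 hlg
  rw [hsum, ← integral_map hs.aemeasurable hlgm.aestronglyMeasurable]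
  have hp : IsProbabilityMeasure (μ.map (seg B (n + 1))) :=
    Measure.isProbabilityMeasure_map hs.aemeasurable
  have hlaw := h.map_seg_B hKV
  rw [hlaw] at hint hlg' hp ⊢
  have := integral_log_le_integral_log
    (measurable_segDensity fun i _ => measurable_condDensity i) hg
    (segDensity_pos fun i hi => condDensity_pos hKV (by omega)) hg0 hint hlg'
  linarith

lemma sum_condEntropy_eq {g : (Fin (n + 1) → Vec p) → ℝ} (hg : Measurable g)
    (hg0 : ∀ x, 0 < g x)
    (hglaw : μ.map (seg B (n + 1)) = volume.withDensity fun x => ENNReal.ofReal (g x)) :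
    ∑ i ∈ Finset.range (n + 1), condEntropy (B i) (seg B i) μ
      = -∫ ω, Real.log (g (seg B (n + 1) ω)) ∂μ := by
  have hs := h.measurable_seg_B le_rfl
  have hlgm : Measurable fun x => Real.log (g x) := Real.measurable_log.comp hg
  have h1 := diffEntropy_withDensity hg fun x => (hg0 x).le
  have h2 := diffEntropy_withDensity
    (measurable_segDensity (N := n + 1) fun i _ =>
      measurable_condDensity (ch := ch) (μ := μ) (A := A) (B := B) i)
    fun x => (segDensity_pos (fun i hi => condDensity_pos hKV (by omega)) x).le
  rw [← hglaw] at h1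
  rw [← h.map_seg_B hKV] at h2
  rw [(h.integrable_log_and_sum_condEntropy hKV hB).2, ← h2, h1,
    integral_map hs.aemeasurable hlgm.aestronglyMeasurable]

end SatisfiesChannel

/-! ### Linear forms in the inputs and outputs -/

section Bilinear

variable {ι : Type*} [Fintype ι] [DecidableEq ι] {S : Matrix ι ι ℝ}

lemma toBilin'_self_nonneg (hS : S.PosSemidef) (w : ι → ℝ) : 0 ≤ Matrix.toBilin' S w w := by
  rw [Matrix.toBilin'_apply']
  simpa using hS.dotProduct_mulVec_nonneg w

lemma toBilin'_comm (hS : S.PosSemidef) (v w : ι → ℝ) :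
    Matrix.toBilin' S v w = Matrix.toBilin' S w v := by
  have h : S.transpose = S := by simpa using hS.isHermitian.eq
  rw [Matrix.toBilin'_apply', Matrix.toBilin'_apply', Matrix.dotProduct_mulVec, dotProduct_comm,
    ← Matrix.mulVec_transpose, h]

lemma toBilin'_sq_le (hS : S.PosSemidef) (v w : ι → ℝ) :
    Matrix.toBilin' S v w ^ 2 ≤ Matrix.toBilin' S v v * Matrix.toBilin' S w w :=
  LinearMap.BilinForm.apply_sq_le_of_symm _ (toBilin'_self_nonneg hS)
    ⟨fun v w => toBilin'_comm hS v w⟩ v w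

/-- Regression: modulo a linear combination of the vectors `g t`, every vector is orthogonal to
all of them, even if the positive semidefinite form `S` is degenerate. -/
lemma exists_regression {T : Type*} [Fintype T] (hS : S.PosSemidef) (g : T → ι → ℝ) (w : ι → ℝ) :
    ∃ x : T → ℝ, ∀ t, Matrix.toBilin' S (w - ∑ s, x s • g s) (g t) = 0 := by
  obtain ⟨R, hR⟩ : ∃ R : Matrix ι ι ℝ, S = R.transpose * R := by
    open scoped MatrixOrder in
    refine ⟨CFC.sqrt S, ?_⟩
    have hT : (CFC.sqrt S).IsHermitian := (CFC.sqrt_nonneg S).isSelfAdjoint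
    have hT' : (CFC.sqrt S).transpose = CFC.sqrt S := by
      simpa [Matrix.IsHermitian] using hT
    rw [hT', CFC.sqrt_mul_sqrt_self S hS.nonneg]
  let φ : (ι → ℝ) →ₗ[ℝ] EuclideanSpace ℝ ι :=
    (WithLp.linearEquiv 2 ℝ (ι → ℝ)).symm.toLinearMap ∘ₗ R.mulVecLin
  have hφ : ∀ v w, Matrix.toBilin' S v w = inner ℝ (φ v) (φ w) := by
    intro v w
    rw [Matrix.toBilin'_apply', hR, ← Matrix.mulVec_mulVec, Matrix.dotProduct_mulVec,
      Matrix.vecMul_transpose]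
    simp [φ, EuclideanSpace.inner_eq_star_dotProduct, dotProduct_comm]
  let N : Submodule ℝ (EuclideanSpace ℝ ι) := Submodule.span ℝ (Set.range fun t => φ (g t))
  have hmem : N.starProjection (φ w) ∈ N := N.starProjection_apply_mem _
  obtain ⟨x, hx⟩ := (Submodule.mem_span_range_iff_exists_fun ℝ).1 hmem
  refine ⟨x, fun t => ?_⟩
  rw [hφ, map_sub, map_sum]
  simp_rw [map_smul]
  rw [hx]
  exact Submodule.starProjection_inner_eq_zero _ _ (Submodule.subset_span ⟨t, rfl⟩)

/-- A bilinear identity on a set of vectors extends to the span. -/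
lemma toBilin'_eq_of_mem_span {S' : Matrix ι ι ℝ} {s : Set (ι → ℝ)}
    (h : ∀ v ∈ s, ∀ w ∈ s, Matrix.toBilin' S v w = Matrix.toBilin' S' v w) {v w : ι → ℝ}
    (hv : v ∈ Submodule.span ℝ s) (hw : w ∈ Submodule.span ℝ s) :
    Matrix.toBilin' S v w = Matrix.toBilin' S' v w := by
  induction hv, hw using Submodule.span_induction₂ with
  | mem_mem x y hx hy => exact h x hx y hy
  | zero_left y hy => simp
  | zero_right x hx => simp
  | add_left x y z _ _ _ h1 h2 => simp [h1, h2]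
  | add_right x y z _ _ _ h1 h2 => simp [h1, h2]
  | smul_left r x y _ _ h1 => simp [h1]
  | smul_right r x y _ _ h1 => simp [h1]

lemma toBilin'_eq_zero_of_mem_span {s : Set (ι → ℝ)} {v w : ι → ℝ}
    (h : ∀ w ∈ s, Matrix.toBilin' S v w = 0) (hw : w ∈ Submodule.span ℝ s) :
    Matrix.toBilin' S v w = 0 := by
  induction hw using Submodule.span_induction with
  | mem x hx => exact h x hx
  | zero => simp
  | add x y _ _ h1 h2 => simp [h1, h2]
  | smul r x _ h1 => simp [h1]

end Bilinear

/-- The coordinates of `(1, A^n, B^n)`. -/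
abbrev Idx (p q n : ℕ) : Type := Option ((Fin (n + 1) × Fin q) ⊕ (Fin (n + 1) × Fin p))

/-- A linear form in `(1, A^n, B^n)`, written in coordinates. -/
abbrev Form (p q n : ℕ) : Type := Idx p q n → ℝ

section Forms

variable {p q L M : ℕ} (ch : GLCM p q L M) (n : ℕ)

/-- The vector `(1, A^n, B^n)`. -/
def coord {n : ℕ} (x : ℕ → Vec q) (y : ℕ → Vec p) : Idx p q n → ℝ
  | none => 1
  | some (.inl (k, c)) => x k c
  | some (.inr (k, c)) => y k c

/-- The value of a linear form. -/
def evalForm {n : ℕ} (x : ℕ → Vec q) (y : ℕ → Vec p) : Form p q n →ₗ[ℝ] ℝ where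
  toFun w := w ⬝ᵥ coord x y
  map_add' v w := add_dotProduct _ _ _
  map_smul' r w := by simp

/-- The constant form `1`. -/
def formOne : Form p q n := Pi.single none 1

/-- The form `A_k`, coordinatewise. -/
def formA (k : ℕ) (c : Fin q) : Form p q n :=
  if h : k < n + 1 then Pi.single (some (.inl (⟨k, h⟩, c))) 1 else 0

/-- The form `B_k`, coordinatewise. -/
def formB (k : ℕ) (c : Fin p) : Form p q n :=
  if h : k < n + 1 then Pi.single (some (.inr (⟨k, h⟩, c))) 1 else 0

/-- The form `x_{i-j}`; at negative times, the initial data as multiples of the form `1`. -/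
def lagForm {d m : ℕ} (init : Fin m → Vec d) (X : ℕ → Fin d → Form p q n) (i j : ℕ) (c : Fin d) :
    Form p q n :=
  if j ≤ i then X (i - j) c
  else if h : j - i - 1 < m then init ⟨j - i - 1, h⟩ c • formOne n else 0

/-- The form `A_{i-j}`, including the initial data. -/
def lagA (i j : ℕ) (c : Fin q) : Form p q n := lagForm n ch.a (formA n) i j c

/-- The form `B_{i-j}`, including the initial data. -/
def lagB (i j : ℕ) (c : Fin p) : Form p q n := lagForm n ch.b (formB n) i j c

/-- The noise `V_i = B_i - ∑ C B - ∑ D A`, as a form. -/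
def formV (i : ℕ) (c : Fin p) : Form p q n :=
  formB n i c - (∑ j : Fin M, ∑ d, ch.C i j c d • lagB ch n i (j + 1) d
    + ∑ j : Fin (L + 1), ∑ d, ch.D i j c d • lagA ch n i j d)

open Classical in
/-- Whether the initial inputs are used as regressors: they are not if they vanish, nor if the
known outputs `b` already provide a nonzero constant. -/
noncomputable def constFlag : ℝ := if ch.a = 0 ∨ ch.b ≠ 0 then 0 else 1

open Classical in
/-- `1` if the initial data provide a nonzero constant, and `0` otherwise. -/
noncomputable def meanFlag : ℝ := if ch.a = 0 ∧ ch.b = 0 then 0 else 1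

/-- The indices of the coefficients in a linear realization at time `i`. -/
abbrev Reg (p q L M i : ℕ) : Type :=
  (Fin (M + i) × Fin p) ⊕ (Fin L × Fin q) ⊕ (Fin L × Fin q)

/-- The variables on which `A_i` depends linearly in a linear realization. -/
noncomputable def reg (i : ℕ) : Reg p q L M i → Form p q n
  | .inl (j, d) => lagB ch n i (j + 1) d
  | .inr (.inl (j, d)) => lagA ch n i (j + 1) d
  | .inr (.inr (j, d)) => (constFlag ch * ch.a j d) • formOne n

/-- The innovation `Z_i` of a linear realization, as a form. -/
def formZ (θ : LinearParams p q L M) (i : ℕ) (c : Fin q) : Form p q n :=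
  formA n i c - (∑ j : Fin (M + i), ∑ d, θ.Γ i j c d • lagB ch n i (j + 1) d
    + ∑ j : Fin L, ∑ d, θ.Λ i j c d • lagA ch n i (j + 1) d
    + ∑ j : Fin L, ∑ d, (θ.Θ i j c d * ch.a j d) • formOne n)

section Eval

variable {n} (x : ℕ → Vec q) (y : ℕ → Vec p)

lemma evalForm_one : evalForm x y (formOne n) = 1 := by
  simp [evalForm, formOne, coord]

lemma evalForm_A {k : ℕ} (hk : k ≤ n) (c : Fin q) : evalForm x y (formA n k c) = x k c := by
  simp [evalForm, formA, coord, Nat.lt_succ_iff.2 hk]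

lemma evalForm_B {k : ℕ} (hk : k ≤ n) (c : Fin p) : evalForm x y (formB n k c) = y k c := by
  simp [evalForm, formB, coord, Nat.lt_succ_iff.2 hk]

lemma evalForm_lagA {i : ℕ} (hi : i ≤ n) (j : ℕ) (c : Fin q) :
    evalForm x y (lagA ch n i j c) = lag ch.a x i j c := by
  unfold lagA lagForm lag
  split_ifs
  · exact evalForm_A x y (by omega) c
  · rw [map_smul, evalForm_one, smul_eq_mul, mul_one]
  · simp

lemma evalForm_lagB {i : ℕ} (hi : i ≤ n) (j : ℕ) (c : Fin p) :
    evalForm x y (lagB ch n i j c) = lag ch.b y i j c := by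
  unfold lagB lagForm lag
  split_ifs
  · exact evalForm_B x y (by omega) c
  · rw [map_smul, evalForm_one, smul_eq_mul, mul_one]
  · simp

lemma evalForm_V {i : ℕ} (hi : i ≤ n) (c : Fin p) :
    evalForm x y (formV ch n i c) = y i c - ch.mean i x y c := by
  simp only [formV, map_sub, map_add, map_sum, map_smul, evalForm_B x y hi, evalForm_lagA ch x y hi,
    evalForm_lagB ch x y hi, GLCM.mean, Pi.add_apply, Finset.sum_apply, Matrix.mulVec, dotProduct,
    smul_eq_mul]

lemma evalForm_Z (θ : LinearParams p q L M) {i : ℕ} (hi : i ≤ n) (c : Fin q) :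
    evalForm x y (formZ ch n θ i c) = x i c -
      (∑ j : Fin (M + i), (θ.Γ i j).mulVec (lag ch.b y i (j + 1))
      + ∑ j : Fin L, (θ.Λ i j).mulVec (lag ch.a x i (j + 1))
      + ∑ j : Fin L, (θ.Θ i j).mulVec (ch.a j)) c := by
  simp only [formZ, map_sub, map_add, map_sum, map_smul, evalForm_A x y hi, evalForm_lagA ch x y hi,
    evalForm_lagB ch x y hi, evalForm_one, Pi.add_apply, Finset.sum_apply, Matrix.mulVec,
    dotProduct, smul_eq_mul, mul_one]

end Eval

/-! ### Second moments that are compatible with the channel -/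

/-- `S` is a second-moment matrix of `(1, A^n, B^n)` that is compatible with the channel: the noise
has mean zero and the right covariance, and is uncorrelated with the past. -/
structure Compatible (S : Matrix (Idx p q n) (Idx p q n) ℝ) : Prop where
  posSemidef : S.PosSemidef
  one_one : Matrix.toBilin' S (formOne n) (formOne n) = 1
  noise_one : ∀ i ≤ n, ∀ c, Matrix.toBilin' S (formV ch n i c) (formOne n) = 0
  noise_noise : ∀ i ≤ n, ∀ c d,
    Matrix.toBilin' S (formV ch n i c) (formV ch n i d) = ch.KV i c d
  noise_A : ∀ i ≤ n, ∀ k ≤ i, ∀ c d, Matrix.toBilin' S (formV ch n i c) (formA n k d) = 0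
  noise_B : ∀ i ≤ n, ∀ k < i, ∀ c d, Matrix.toBilin' S (formV ch n i c) (formB n k d) = 0

/-- In `S`, the innovations `Z_i` of `θ` are orthogonal to the regressors, and have the covariance
matrix `K_{Z_i}`. -/
structure Regresses (θ : LinearParams p q L M) (S : Matrix (Idx p q n) (Idx p q n) ℝ) : Prop where
  orthogonal : ∀ i ≤ n, ∀ c t, Matrix.toBilin' S (formZ ch n θ i c) (reg ch n i t) = 0
  innov_cov : ∀ i ≤ n, ∀ c d,
    Matrix.toBilin' S (formZ ch n θ i c) (formZ ch n θ i d) = θ.KZ i c d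

/-- The span of `A^i`, `B^{i-1}` and the constants. -/
def pastSpan (i : ℕ) : Submodule ℝ (Form p q n) :=
  Submodule.span ℝ ({formOne n} ∪ {w | ∃ k ≤ i, ∃ c, w = formA n k c}
    ∪ {w | ∃ k < i, ∃ c, w = formB n k c})

/-- The span of the regressors at time `i`. -/
noncomputable def regSpan (i : ℕ) : Submodule ℝ (Form p q n) :=
  Submodule.span ℝ (Set.range (reg ch n i))

/-- The span of the regressors, the innovation and the noise at time `i`. -/
noncomputable def stepSpan (θ : LinearParams p q L M) (i : ℕ) : Submodule ℝ (Form p q n) :=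
  Submodule.span ℝ (Set.range (reg ch n i) ∪ Set.range (formZ ch n θ i)
    ∪ Set.range (formV ch n i))

section Spans

variable {n}

lemma formOne_mem_pastSpan (i : ℕ) : formOne n ∈ pastSpan (p := p) (q := q) n i :=
  Submodule.subset_span (by simp)

lemma formA_mem_pastSpan {i k : ℕ} (hk : k ≤ i) (c : Fin q) :
    formA n k c ∈ pastSpan (p := p) n i :=
  Submodule.subset_span (Or.inl (Or.inr ⟨k, hk, c, rfl⟩))

lemma formB_mem_pastSpan {i k : ℕ} (hk : k < i) (c : Fin p) :
    formB n k c ∈ pastSpan (q := q) n i :=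
  Submodule.subset_span (Or.inr ⟨k, hk, c, rfl⟩)

lemma lagForm_mem {d m : ℕ} {init : Fin m → Vec d} {X : ℕ → Fin d → Form p q n} {i j : ℕ}
    {c : Fin d} {N : Submodule ℝ (Form p q n)} (h1 : formOne n ∈ N)
    (hX : j ≤ i → X (i - j) c ∈ N) : lagForm n init X i j c ∈ N := by
  unfold lagForm
  split_ifs with hj
  · exact hX hj
  · exact N.smul_mem _ h1
  · exact N.zero_mem

lemma lagForm_succ {d m : ℕ} (init : Fin m → Vec d) (X : ℕ → Fin d → Form p q n) (i j : ℕ)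
    (c : Fin d) : lagForm n init X (i + 1) (j + 1) c = lagForm n init X i j c := by
  unfold lagForm
  simp only [Nat.add_le_add_iff_right, Nat.add_sub_add_right]

lemma reg_mem_pastSpan (i : ℕ) (t : Reg p q L M i) : reg ch n i t ∈ pastSpan n i := by
  rcases t with ⟨j, d⟩ | ⟨j, d⟩ | ⟨j, d⟩
  · exact lagForm_mem (formOne_mem_pastSpan i) fun _ => formB_mem_pastSpan (by omega) d
  · exact lagForm_mem (formOne_mem_pastSpan i) fun _ => formA_mem_pastSpan (by omega) d
  · exact Submodule.smul_mem _ _ (formOne_mem_pastSpan i)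

lemma formZ_mem_pastSpan (θ : LinearParams p q L M) (i : ℕ) (c : Fin q) :
    formZ ch n θ i c ∈ pastSpan n i := by
  refine Submodule.sub_mem _ (formA_mem_pastSpan le_rfl c) (Submodule.add_mem _
    (Submodule.add_mem _ ?_ ?_) ?_) <;>
  refine Submodule.sum_mem _ fun j _ => Submodule.sum_mem _ fun d _ => Submodule.smul_mem _ _ ?_
  · exact lagForm_mem (formOne_mem_pastSpan i) fun _ => formB_mem_pastSpan (by omega) d
  · exact lagForm_mem (formOne_mem_pastSpan i) fun _ => formA_mem_pastSpan (by omega) d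
  · exact formOne_mem_pastSpan i

lemma Compatible.noise_past {S : Matrix (Idx p q n) (Idx p q n) ℝ} (hS : Compatible ch n S)
    {i : ℕ} (hi : i ≤ n) (c : Fin p) {w : Form p q n} (hw : w ∈ pastSpan n i) :
    Matrix.toBilin' S (formV ch n i c) w = 0 := by
  refine toBilin'_eq_zero_of_mem_span (fun w hw => ?_) hw
  rcases hw with (rfl | ⟨k, hk, d, rfl⟩) | ⟨k, hk, d, rfl⟩
  · exact hS.noise_one i hi c
  · exact hS.noise_A i hi k hk c d
  · exact hS.noise_B i hi k hk c d

variable (θ : LinearParams p q L M) (hΘ : ∀ i c d (j : Fin L),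
  ∃ r, θ.Θ i j c d * ch.a j d = r * (constFlag ch * ch.a j d))

lemma reg_mem_stepSpan (i : ℕ) (t : Reg p q L M i) : reg ch n i t ∈ stepSpan ch n θ i :=
  Submodule.subset_span (Or.inl (Or.inl ⟨t, rfl⟩))

include hΘ in
lemma formA_mem_stepSpan (i : ℕ) (c : Fin q) : formA n i c ∈ stepSpan ch n θ i := by
  have h : formA n i c = formZ ch n θ i c
      + (∑ j : Fin (M + i), ∑ d, θ.Γ i j c d • lagB ch n i (j + 1) d
    + ∑ j : Fin L, ∑ d, θ.Λ i j c d • lagA ch n i (j + 1) d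
    + ∑ j : Fin L, ∑ d, (θ.Θ i j c d * ch.a j d) • formOne n) := by
    rw [formZ, sub_add_cancel]
  rw [h]
  refine Submodule.add_mem _ (Submodule.subset_span (Or.inl (Or.inr ⟨c, rfl⟩)))
    (Submodule.add_mem _ (Submodule.add_mem _ ?_ ?_) ?_) <;>
  refine Submodule.sum_mem _ fun j _ => Submodule.sum_mem _ fun d _ => ?_
  · exact Submodule.smul_mem _ _ (reg_mem_stepSpan ch θ i (.inl (j, d)))
  · exact Submodule.smul_mem _ _ (reg_mem_stepSpan ch θ i (.inr (.inl (j, d))))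
  · obtain ⟨r, hr⟩ := hΘ i c d j
    rw [hr, mul_smul]
    exact Submodule.smul_mem _ _ (reg_mem_stepSpan ch θ i (.inr (.inr (j, d))))

include hΘ in
lemma lagA_mem_stepSpan (i : ℕ) {j : ℕ} (hj : j ≤ L) (c : Fin q) :
    lagA ch n i j c ∈ stepSpan ch n θ i := by
  rcases j with _ | j
  · simpa [lagA, lagForm] using formA_mem_stepSpan ch θ hΘ i c
  · exact reg_mem_stepSpan ch θ i (.inr (.inl (⟨j, hj⟩, c)))

include hΘ in
lemma lagB_mem_stepSpan (i : ℕ) {j : ℕ} (hj : j ≤ M + i) (c : Fin p) :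
    lagB ch n i j c ∈ stepSpan ch n θ i := by
  have hreg : ∀ j < M + i, ∀ d, lagB ch n i (j + 1) d ∈ stepSpan ch n θ i := fun j hj d =>
    reg_mem_stepSpan ch θ i (.inl (⟨j, hj⟩, d))
  rcases j with _ | j
  · have h : formB n i c = formV ch n i c
        + (∑ j : Fin M, ∑ d, ch.C i j c d • lagB ch n i (j + 1) d
          + ∑ j : Fin (L + 1), ∑ d, ch.D i j c d • lagA ch n i j d) := by
      rw [formV, sub_add_cancel]
    have h0 : lagB ch n i 0 c = formB n i c := by simp [lagB, lagForm]
    rw [h0, h]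
    refine Submodule.add_mem _ (Submodule.subset_span (Or.inr ⟨c, rfl⟩))
      (Submodule.add_mem _ ?_ ?_) <;>
    refine Submodule.sum_mem _ fun j _ => Submodule.sum_mem _ fun d _ => Submodule.smul_mem _ _ ?_
    · exact hreg j (by omega) d
    · exact lagA_mem_stepSpan ch θ hΘ i (by omega) d
  · exact hreg j hj c

include hΘ in
lemma regSpan_succ_le (i : ℕ) : regSpan ch n (i + 1) ≤ stepSpan ch n θ i := by
  refine Submodule.span_le.2 ?_
  rintro _ ⟨t, rfl⟩
  rcases t with ⟨j, d⟩ | ⟨j, d⟩ | ⟨j, d⟩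
  · change lagB ch n (i + 1) (j + 1) d ∈ _
    rw [lagB, lagForm_succ]
    exact lagB_mem_stepSpan ch θ hΘ i (by omega) d
  · change lagA ch n (i + 1) (j + 1) d ∈ _
    rw [lagA, lagForm_succ]
    exact lagA_mem_stepSpan ch θ hΘ i (by omega) d
  · exact reg_mem_stepSpan ch θ i (.inr (.inr (j, d)))

lemma reg_zero_mem (t : Reg p q L M 0) : ∃ r : ℝ, reg ch n 0 t = r • formOne n := by
  have h : ∀ {d m : ℕ} (init : Fin m → Vec d) (X : ℕ → Fin d → Form p q n) (j : ℕ) (c : Fin d),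
      ∃ r : ℝ, lagForm n init X 0 (j + 1) c = r • formOne n := by
    intro d m init X j c
    unfold lagForm
    split_ifs with h1 h2
    · omega
    · exact ⟨_, rfl⟩
    · exact ⟨0, by simp⟩
  rcases t with ⟨j, d⟩ | ⟨j, d⟩ | ⟨j, d⟩
  · exact h ch.b (formB n) _ _
  · exact h ch.a (formA n) _ _
  · exact ⟨_, rfl⟩

variable {ch θ} {S S' : Matrix (Idx p q n) (Idx p q n) ℝ}

include hΘ in
/-- Two compatible second-moment matrices with the same regression coefficients agree on the
variables that occur at time `i`: both are determined by the same linear recursion, in which the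
innovation and the noise are orthogonal to the past. -/
theorem toBilin'_eq_of_regresses (hS : Compatible ch n S) (hS' : Compatible ch n S')
    (hr : Regresses ch n θ S) (hr' : Regresses ch n θ S') {i : ℕ} (hi : i ≤ n) {v w : Form p q n}
    (hv : v ∈ stepSpan ch n θ i) (hw : w ∈ stepSpan ch n θ i) :
    Matrix.toBilin' S v w = Matrix.toBilin' S' v w := by
  induction i generalizing v w with
  | zero =>
    refine step hS hS' hr hr' hi (fun s t => ?_) hv hw
    obtain ⟨r, hr⟩ := reg_zero_mem (n := n) ch s
    obtain ⟨r', hr'⟩ := reg_zero_mem (n := n) ch t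
    simp [hr, hr', hS.one_one, hS'.one_one]
  | succ i ih =>
    refine step hS hS' hr hr' hi (fun s t => ?_) hv hw
    exact ih (by omega) (regSpan_succ_le ch θ hΘ i (Submodule.subset_span ⟨s, rfl⟩))
      (regSpan_succ_le ch θ hΘ i (Submodule.subset_span ⟨t, rfl⟩))
where
  step (hS : Compatible ch n S) (hS' : Compatible ch n S')
    (hr : Regresses ch n θ S) (hr' : Regresses ch n θ S') {i : ℕ} (hi : i ≤ n)
    (hreg : ∀ s t, Matrix.toBilin' S (reg ch n i s) (reg ch n i t)
      = Matrix.toBilin' S' (reg ch n i s) (reg ch n i t)) {v w : Form p q n}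
    (hv : v ∈ stepSpan ch n θ i) (hw : w ∈ stepSpan ch n θ i) :
    Matrix.toBilin' S v w = Matrix.toBilin' S' v w := by
    have hc := toBilin'_comm hS.posSemidef
    have hc' := toBilin'_comm hS'.posSemidef
    refine toBilin'_eq_of_mem_span (fun v hv w hw => ?_) hv hw
    have hVr := fun c t => hS.noise_past ch hi c (reg_mem_pastSpan ch i t)
    have hVr' := fun c t => hS'.noise_past ch hi c (reg_mem_pastSpan ch i t)
    have hVz := fun c d => hS.noise_past ch hi c (formZ_mem_pastSpan ch θ i d)
    have hVz' := fun c d => hS'.noise_past ch hi c (formZ_mem_pastSpan ch θ i d)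
    rcases hv with (⟨s, rfl⟩ | ⟨c, rfl⟩) | ⟨c, rfl⟩ <;>
    rcases hw with (⟨t, rfl⟩ | ⟨d, rfl⟩) | ⟨d, rfl⟩
    · exact hreg s t
    · rw [hc, hc', hr.orthogonal i hi, hr'.orthogonal i hi]
    · rw [hc, hc', hVr, hVr']
    · rw [hr.orthogonal i hi, hr'.orthogonal i hi]
    · rw [hr.innov_cov i hi, hr'.innov_cov i hi]
    · rw [hc, hc', hVz, hVz']
    · rw [hVr, hVr']
    · rw [hVz, hVz']
    · rw [hS.noise_noise i hi, hS'.noise_noise i hi]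

end Spans

end Forms

/-! ### Regression coefficients and the output covariance -/

section OutputMoments

variable {p q L M : ℕ} {ch : GLCM p q L M} {n : ℕ}

lemma formB_sub_formV_mem_pastSpan (i : ℕ) (c : Fin p) :
    formB n i c - formV ch n i c ∈ pastSpan n i := by
  rw [formV, sub_sub_cancel]
  refine Submodule.add_mem _ ?_ ?_ <;>
  refine Submodule.sum_mem _ fun j _ => Submodule.sum_mem _ fun d _ => Submodule.smul_mem _ _ ?_
  · exact lagForm_mem (formOne_mem_pastSpan i) fun _ => formB_mem_pastSpan (by omega) d
  · exact lagForm_mem (formOne_mem_pastSpan i) fun _ => formA_mem_pastSpan (by omega) d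

/-- Every second-moment matrix admits regression coefficients. The second property says that the
terms `Θ a` are multiples of the constant regressor in `reg`, which is scaled by `constFlag`. -/
lemma exists_regresses {S : Matrix (Idx p q n) (Idx p q n) ℝ} (hS : S.PosSemidef) :
    ∃ θ : LinearParams p q L M, Regresses ch n θ S ∧
      (∀ i c d (j : Fin L), ∃ r, θ.Θ i j c d * ch.a j d = r * (constFlag ch * ch.a j d)) ∧
      (ch.a = 0 ∨ ch.b ≠ 0 → θ.Θ = 0) ∧ ∀ i, (θ.KZ i).PosSemidef := by
  choose x hx using fun i c => exists_regression hS (reg ch n i) (formA n i c)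
  let Z : ℕ → Fin q → Form p q n := fun i c => formA n i c - ∑ t, x i c t • reg ch n i t
  let θ : LinearParams p q L M :=
    { Γ := fun i j => Matrix.of fun c d => x i c (.inl (j, d))
      Λ := fun i j => Matrix.of fun c d => x i c (.inr (.inl (j, d)))
      Θ := fun i j => Matrix.of fun c d => x i c (.inr (.inr (j, d))) * constFlag ch
      KZ := fun i => Matrix.of fun c d => Matrix.toBilin' S (Z i c) (Z i d) }
  have hZ : ∀ i c, formZ ch n θ i c = Z i c := by
    intro i c
    simp only [Z, formZ, Fintype.sum_sum_type, Fintype.sum_prod_type, reg, θ, Matrix.of_apply,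
      add_assoc, smul_smul, mul_assoc]
  refine ⟨θ, ⟨fun i _ c t => ?_, fun i _ c d => ?_⟩, fun i c d j =>
    ⟨x i c (.inr (.inr (j, d))), ?_⟩, fun h => ?_,
    fun i => ?_⟩
  · rw [hZ]
    exact hx i c t
  · rw [hZ, hZ]
    rfl
  · exact mul_assoc (x i c (.inr (.inr (j, d)))) _ _
  · ext i j c d
    simp [θ, constFlag, if_pos h]
  · refine Matrix.PosSemidef.of_dotProduct_mulVec_nonneg ?_ fun u => ?_
    · ext c d
      simp [θ, toBilin'_comm hS (Z i d) (Z i c)]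
    · have h := toBilin'_self_nonneg hS (∑ c, u c • Z i c)
      simp only [map_sum, map_smul, LinearMap.sum_apply, LinearMap.smul_apply, smul_eq_mul] at h
      refine h.trans_eq ?_
      simp only [θ, dotProduct, Matrix.mulVec, Matrix.of_apply, Pi.star_apply, star_trivial,
        Finset.mul_sum]
      rw [Finset.sum_comm]
      exact Finset.sum_congr rfl fun c _ => Finset.sum_congr rfl fun d _ => by ring

lemma meanFlag_eq_zero_or_one : meanFlag ch = 0 ∨ meanFlag ch = 1 := by
  unfold meanFlag
  split_ifs <;> simp

lemma formOne_mem_regSpan (h : meanFlag ch = 1) (i : ℕ) : formOne n ∈ regSpan ch n i := by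
  have hne : ¬(ch.a = 0 ∧ ch.b = 0) := fun h' => by simp [meanFlag, h'] at h
  have key : ∀ (t : Reg p q L M i) (r : ℝ), r ≠ 0 → reg ch n i t = r • formOne n →
      formOne n ∈ regSpan ch n i := fun t r hr ht => by
    have h1 : formOne n = r⁻¹ • reg ch n i t := by rw [ht, smul_smul, inv_mul_cancel₀ hr, one_smul]
    rw [h1]
    exact Submodule.smul_mem _ _ (Submodule.subset_span ⟨t, rfl⟩)
  by_cases hb : ch.b = 0
  · have ha : ch.a ≠ 0 := fun ha => hne ⟨ha, hb⟩
    obtain ⟨j, hj⟩ := Function.ne_iff.1 ha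
    obtain ⟨d, hd⟩ := Function.ne_iff.1 hj
    refine key (.inr (.inr (j, d))) (ch.a j d) hd ?_
    simp [reg, constFlag, ha, hb]
  · obtain ⟨j, hj⟩ := Function.ne_iff.1 hb
    obtain ⟨d, hd⟩ := Function.ne_iff.1 hj
    refine key (.inl (⟨i + j, by omega⟩, d)) (ch.b j d) hd ?_
    have h1 : ¬ i + (j : ℕ) + 1 ≤ i := by omega
    have h2 : i + (j : ℕ) + 1 - i - 1 = j := by omega
    simp only [reg, lagB, lagForm, h1, h2, dite_true, if_false, Fin.is_lt, Fin.eta]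

lemma regSpan_le_stepSpan (θ : LinearParams p q L M) (i : ℕ) :
    regSpan ch n i ≤ stepSpan ch n θ i :=
  Submodule.span_le.2 fun _ ⟨t, ht⟩ => ht ▸ reg_mem_stepSpan ch θ i t

variable {θ : LinearParams p q L M} (hΘ : ∀ i c d (j : Fin L),
  ∃ r, θ.Θ i j c d * ch.a j d = r * (constFlag ch * ch.a j d))
  {S S' : Matrix (Idx p q n) (Idx p q n) ℝ}

include hΘ

/-- Without a nonzero constant in the initial data, a linear realization has mean zero. -/
lemma one_orthogonal_stepSpan (h : meanFlag ch = 0) (hS : Compatible ch n S)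
    (hz : ∀ i ≤ n, ∀ c, Matrix.toBilin' S (formOne n) (formZ ch n θ i c) = 0) {i : ℕ} (hi : i ≤ n)
    {w : Form p q n} (hw : w ∈ stepSpan ch n θ i) :
    Matrix.toBilin' S (formOne n) w = 0 := by
  have hne : ch.a = 0 ∧ ch.b = 0 := by
    by_contra h'
    simp [meanFlag, h'] at h
  have hstep : ∀ i ≤ n, (∀ t, Matrix.toBilin' S (formOne n) (reg ch n i t) = 0) →
      ∀ w ∈ stepSpan ch n θ i, Matrix.toBilin' S (formOne n) w = 0 := by
    intro i hi hreg w hw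
    refine toBilin'_eq_zero_of_mem_span (fun w hw => ?_) hw
    rcases hw with (⟨t, rfl⟩ | ⟨d, rfl⟩) | ⟨d, rfl⟩
    · exact hreg t
    · exact hz i hi d
    · rw [toBilin'_comm hS.posSemidef]
      exact hS.noise_one i hi d
  induction i generalizing w with
  | zero =>
    refine hstep 0 hi (fun t => ?_) w hw
    have hreg : reg ch n 0 t = 0 := by
      rcases t with ⟨j, d⟩ | ⟨j, d⟩ | ⟨j, d⟩
      · simp [reg, lagB, lagForm, hne]
      · simp [reg, lagA, lagForm, hne]
      · simp [reg, hne]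
    simp [hreg]
  | succ i ih =>
    refine hstep (i + 1) hi (fun t => ?_) w hw
    exact ih (by omega) (regSpan_succ_le ch θ hΘ i (Submodule.subset_span ⟨t, rfl⟩))

lemma formB_mem_stepSpan {k : ℕ} (hk : k ≤ n) (c : Fin p) :
    formB n k c ∈ stepSpan ch n θ n := by
  have h : formB n k c = lagB ch n n (n - k) c := by
    rw [lagB, lagForm, if_pos (by omega), Nat.sub_sub_self hk]
  rw [h]
  exact lagB_mem_stepSpan ch θ hΘ n (by omega) c

omit hΘ

/-- The mean of the outputs according to `S`, or zero if the initial data vanish. -/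
noncomputable def outMean (ch : GLCM p q L M) (S : Matrix (Idx p q n) (Idx p q n) ℝ) :
    Fin (n + 1) × Fin p → ℝ :=
  fun j => meanFlag ch * Matrix.toBilin' S (formOne n) (formB n j.1 j.2)

/-- The covariance matrix of the outputs according to `S`, or their second-moment matrix if
the initial data vanish: in that case the linear realizations have mean zero, and a mean would be
absorbed into the covariance. -/
noncomputable def outCov (ch : GLCM p q L M) (S : Matrix (Idx p q n) (Idx p q n) ℝ) :
    Matrix (Fin (n + 1) × Fin p) (Fin (n + 1) × Fin p) ℝ :=
  Matrix.of fun j k => Matrix.toBilin' S (formB n j.1 j.2) (formB n k.1 k.2)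
    - meanFlag ch * (Matrix.toBilin' S (formOne n) (formB n j.1 j.2)
      * Matrix.toBilin' S (formOne n) (formB n k.1 k.2))

/-- The mean of the cost `γ_i` according to `S`. -/
noncomputable def costForm (ch : GLCM p q L M) (S : Matrix (Idx p q n) (Idx p q n) ℝ) (i : ℕ) :
    ℝ :=
  ∑ j, ∑ k, ch.R i j k * Matrix.toBilin' S (lagA ch n i j.1 j.2) (lagA ch n i k.1 k.2)
    + ∑ j, ∑ k, ch.Q i j k * Matrix.toBilin' S (lagB ch n i j.1 j.2) (lagB ch n i k.1 k.2)

section Compare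

variable (hS : Compatible ch n S) (hS' : Compatible ch n S')
    (hr : Regresses ch n θ S) (hr' : Regresses ch n θ S')

include hΘ hS hS' hr hr'

lemma costForm_eq {i : ℕ} (hi : i ≤ n) : costForm ch S i = costForm ch S' i := by
  unfold costForm
  congr 1 <;> refine Finset.sum_congr rfl fun j _ => Finset.sum_congr rfl fun k _ => ?_
  · rw [toBilin'_eq_of_regresses hΘ hS hS' hr hr' hi
      (lagA_mem_stepSpan ch θ hΘ i (by omega) _) (lagA_mem_stepSpan ch θ hΘ i (by omega) _)]
  · rw [toBilin'_eq_of_regresses hΘ hS hS' hr hr' hi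
      (lagB_mem_stepSpan ch θ hΘ i (by omega) _) (lagB_mem_stepSpan ch θ hΘ i (by omega) _)]

lemma outCov_eq : outCov ch S = outCov ch S' := by
  have hB := fun (j : Fin (n + 1) × Fin p) =>
    formB_mem_stepSpan (k := j.1) hΘ (Nat.lt_succ_iff.1 j.1.2) j.2
  ext j k
  rw [outCov, outCov, Matrix.of_apply, Matrix.of_apply,
    toBilin'_eq_of_regresses hΘ hS hS' hr hr' le_rfl (hB j) (hB k)]
  rcases meanFlag_eq_zero_or_one (ch := ch) with h | h
  · simp [h]
  · have h1 : formOne n ∈ stepSpan ch n θ n :=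
      regSpan_le_stepSpan θ n (formOne_mem_regSpan h n)
    rw [toBilin'_eq_of_regresses hΘ hS hS' hr hr' le_rfl h1 (hB j),
      toBilin'_eq_of_regresses hΘ hS hS' hr hr' le_rfl h1 (hB k)]

end Compare

lemma toBilin'_formB_formV (hS : Compatible ch n S) {k j : ℕ} (hk : k ≤ n) (hj : j ≤ k)
    (c d : Fin p) : Matrix.toBilin' S (formB n j d) (formV ch n k c)
      = if j = k then ch.KV k d c else 0 := by
  rw [toBilin'_comm hS.posSemidef]
  split_ifs with h
  · subst h
    have h1 := hS.noise_past ch hk c (formB_sub_formV_mem_pastSpan (ch := ch) j d)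
    rw [map_sub, hS.noise_noise j hk, sub_eq_zero] at h1
    rw [h1, ← hS.noise_noise j hk d c, toBilin'_comm hS.posSemidef, hS.noise_noise j hk]
  · exact hS.noise_B k hk j (by omega) c d

/-- The noise makes the output covariance invertible: a form `w` in the outputs with variance zero
is orthogonal to every `V_k`, so its coefficients vanish, the latest ones first. -/
lemma posDef_outCov (hKV : ∀ i ≤ n, (ch.KV i).PosDef) (hS : Compatible ch n S) :
    (outCov ch S).PosDef := by
  have hsymm : (outCov ch S).IsHermitian := by
    ext j k
    simp only [outCov, Matrix.conjTranspose_apply, Matrix.of_apply, star_trivial]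
    rw [toBilin'_comm hS.posSemidef (formB n k.1 k.2), mul_comm (Matrix.toBilin' S (formOne n) _)]
  refine Matrix.PosDef.of_dotProduct_mulVec_pos hsymm fun u hu => ?_
  set e := meanFlag ch with he
  set w : Form p q n := ∑ j, u j • formB n j.1 j.2 with hw
  set s := Matrix.toBilin' S (formOne n) w with hs
  set w' : Form p q n := w - (e * s) • formOne n with hw'
  have hee : e * e = e := by rcases meanFlag_eq_zero_or_one (ch := ch) with h | h <;> simp [he, h]
  have h1 : star u ⬝ᵥ (outCov ch S).mulVec u = Matrix.toBilin' S w w - e * (s * s) := by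
    have hs' : s = ∑ j, u j * Matrix.toBilin' S (formOne n) (formB n j.1 j.2) := by
      simp [hs, hw, map_sum]
    have hww : Matrix.toBilin' S w w = ∑ j, ∑ k,
        u j * (u k * Matrix.toBilin' S (formB n j.1 j.2) (formB n k.1 k.2)) := by
      simp only [hw, map_sum, map_smul, LinearMap.sum_apply, LinearMap.smul_apply, smul_eq_mul,
        Finset.mul_sum]
      rw [Finset.sum_comm]
      exact Finset.sum_congr rfl fun c _ => Finset.sum_congr rfl fun d _ => by ring
    rw [hww, hs', Finset.sum_mul_sum, Finset.mul_sum, ← Finset.sum_sub_distrib]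
    simp only [dotProduct, Matrix.mulVec, Finset.mul_sum, ← Finset.sum_sub_distrib, outCov,
      Matrix.of_apply, Pi.star_apply, star_trivial]
    exact Finset.sum_congr rfl fun j _ => Finset.sum_congr rfl fun k _ => by ring
  have h2 : Matrix.toBilin' S w' w' = Matrix.toBilin' S w w - e * (s * s) := by
    have h3 : Matrix.toBilin' S w (formOne n) = s := toBilin'_comm hS.posSemidef _ _
    simp only [hw', map_sub, map_smul, LinearMap.sub_apply, LinearMap.smul_apply, smul_eq_mul, h3,
      hS.one_one, ← hs]
    linear_combination (s * s) * hee
  rw [h1, ← h2]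
  refine lt_of_le_of_ne (toBilin'_self_nonneg hS.posSemidef w') fun h0 => hu ?_
  have hV : ∀ k ≤ n, ∀ c, Matrix.toBilin' S w (formV ch n k c) = 0 := by
    intro k hk c
    have h3 := toBilin'_sq_le hS.posSemidef w' (formV ch n k c)
    rw [← h0, zero_mul] at h3
    have h4 : Matrix.toBilin' S w' (formV ch n k c) = 0 :=
      pow_eq_zero_iff two_ne_zero |>.1 (le_antisymm h3 (sq_nonneg _))
    have h5 : Matrix.toBilin' S (formOne n) (formV ch n k c) = 0 := by
      rw [toBilin'_comm hS.posSemidef]; exact hS.noise_one k hk c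
    simpa [hw', h5] using h4
  have hdesc : ∀ m : ℕ, ∀ k : Fin (n + 1), n - k < m → ∀ c, u (k, c) = 0 := by
    intro m
    induction m with
    | zero => intro k hk; omega
    | succ m ih =>
      intro k hk
      have hkn : (k : ℕ) ≤ n := Nat.lt_succ_iff.1 k.2
      have hvec : Matrix.vecMul (fun d => u (k, d)) (ch.KV k) = 0 := by
        ext c
        have h6 := hV k hkn c
        simp only [hw, map_sum, map_smul, LinearMap.sum_apply, LinearMap.smul_apply, smul_eq_mul,
          Fintype.sum_prod_type] at h6
        rw [Finset.sum_eq_single k] at h6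
        · refine Eq.trans ?_ h6
          rw [Matrix.vecMul, dotProduct]
          refine Finset.sum_congr rfl fun d _ => ?_
          rw [toBilin'_formB_formV hS hkn le_rfl, if_pos rfl]
        · intro j _ hj
          refine Finset.sum_eq_zero fun d _ => ?_
          rcases lt_or_ge (j : ℕ) k with hlt | hge
          · rw [toBilin'_formB_formV hS hkn hlt.le, if_neg hlt.ne, mul_zero]
          · have : (k : ℕ) ≠ j := fun h => hj (Fin.ext h.symm)
            rw [ih j (by omega) d, zero_mul]
        · simp
      have h7 : (fun d => u (k, d)) = 0 := by
        by_contra h8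
        have h9 := (hKV k hkn).dotProduct_mulVec_pos h8
        rw [Matrix.dotProduct_mulVec, star_trivial, hvec] at h9
        simp at h9
      exact fun c => congrFun h7 c
  ext ⟨k, c⟩
  exact hdesc (n + 1) k (by omega) c

end OutputMoments

/-! ### Second moments of channel processes -/

section Moments

variable {p q L M : ℕ} {ch : GLCM p q L M} {n : ℕ} {Ω : Type*} [MeasurableSpace Ω]
  {μ : Measure Ω} {A : ℕ → Ω → Vec q} {B V : ℕ → Ω → Vec p}

/-- The second-moment matrix of `(1, A^n, B^n)`. -/
noncomputable def momentMatrix (n : ℕ) (μ : Measure Ω) (A : ℕ → Ω → Vec q) (B : ℕ → Ω → Vec p) :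
    Matrix (Idx p q n) (Idx p q n) ℝ :=
  Matrix.of fun j k => ∫ ω, coord (fun k => A k ω) (fun k => B k ω) j
    * coord (fun k => A k ω) (fun k => B k ω) k ∂μ

lemma memLp_lag {d m : ℕ} [IsFiniteMeasure μ] {X : ℕ → Ω → Vec d} (init : Fin m → Vec d) {i j : ℕ}
    {c : Fin d} (hX : j ≤ i → MemLp (fun ω => X (i - j) ω c) 2 μ) :
    MemLp (fun ω => lag init (fun k => X k ω) i j c) 2 μ := by
  unfold lag
  split_ifs with hj
  · exact hX hj
  · exact memLp_const _
  · exact memLp_const _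

lemma memLp_mean [IsFiniteMeasure μ] {i : ℕ} (hA : ∀ k ≤ i, ∀ c, MemLp (fun ω => A k ω c) 2 μ)
    (hB : ∀ k < i, ∀ c, MemLp (fun ω => B k ω c) 2 μ) (c : Fin p) :
    MemLp (fun ω => ch.mean i (fun k => A k ω) (fun k => B k ω) c) 2 μ := by
  simp only [GLCM.mean, Pi.add_apply, Finset.sum_apply, Matrix.mulVec, dotProduct]
  refine MemLp.add ?_ ?_ <;>
  refine memLp_finsetSum _ fun j _ => memLp_finsetSum _ fun d _ => MemLp.const_mul ?_ _
  · exact memLp_lag _ fun hj => hB _ (by omega) d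
  · exact memLp_lag _ fun hj => hA _ (by omega) d

lemma SatisfiesChannel.memLp_output [IsFiniteMeasure μ] (h : SatisfiesChannel ch n μ A B V)
    (hA : ∀ i ≤ n, ∀ c, MemLp (fun ω => A i ω c) 2 μ) :
    ∀ i ≤ n, ∀ c, MemLp (fun ω => B i ω c) 2 μ := by
  intro i
  induction i using Nat.strong_induction_on with
  | _ i ih =>
    intro hi c
    refine ((memLp_mean (ch := ch) (fun k hk => hA k (by omega)) (fun k hk => ih k hk (by omega))
      c).add (h.memLp_noise hi c)).ae_eq ?_
    filter_upwards [h.output_eq i hi] with ω hω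
    rw [hω]
    rfl

section

variable [IsFiniteMeasure μ] (hA : ∀ i ≤ n, ∀ c, MemLp (fun ω => A i ω c) 2 μ)
  (hB : ∀ i ≤ n, ∀ c, MemLp (fun ω => B i ω c) 2 μ)

include hA hB

lemma memLp_coord (j : Idx p q n) :
    MemLp (fun ω => coord (fun k => A k ω) (fun k => B k ω) j) 2 μ := by
  rcases j with _ | ⟨k, c⟩ | ⟨k, c⟩
  · exact memLp_const _
  · exact hA k (Nat.lt_succ_iff.1 k.2) c
  · exact hB k (Nat.lt_succ_iff.1 k.2) c

lemma memLp_evalForm (w : Form p q n) :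
    MemLp (fun ω => evalForm (fun k => A k ω) (fun k => B k ω) w) 2 μ :=
  memLp_finsetSum _ fun j _ => (memLp_coord hA hB j).const_mul (w j)

lemma toBilin'_momentMatrix (v w : Form p q n) :
    Matrix.toBilin' (momentMatrix n μ A B) v w
      = ∫ ω, evalForm (fun k => A k ω) (fun k => B k ω) v
        * evalForm (fun k => A k ω) (fun k => B k ω) w ∂μ := by
  have hint : ∀ j k : Idx p q n, Integrable (fun ω => coord (fun k => A k ω) (fun k => B k ω) j
      * coord (fun k => A k ω) (fun k => B k ω) k) μ :=
    fun j k => (memLp_coord hA hB j).integrable_mul (memLp_coord hA hB k)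
  have h1 : ∀ ω, evalForm (fun k => A k ω) (fun k => B k ω) v
        * evalForm (fun k => A k ω) (fun k => B k ω) w
      = ∑ j, ∑ k, v j * w k * (coord (fun k => A k ω) (fun k => B k ω) j
        * coord (fun k => A k ω) (fun k => B k ω) k) := by
    intro ω
    simp only [evalForm, LinearMap.coe_mk, AddHom.coe_mk, dotProduct, Finset.sum_mul_sum]
    exact Finset.sum_congr rfl fun j _ => Finset.sum_congr rfl fun k _ => by ring
  simp only [h1]
  rw [integral_finsetSum _ fun j _ => integrable_finsetSum _ fun k _ => (hint j k).const_mul _,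
    Matrix.toBilin'_apply]
  refine Finset.sum_congr rfl fun j _ => ?_
  rw [integral_finsetSum _ fun k _ => (hint j k).const_mul _]
  refine Finset.sum_congr rfl fun k _ => ?_
  rw [integral_const_mul, momentMatrix, Matrix.of_apply]
  ring

lemma posSemidef_momentMatrix : (momentMatrix n μ A B).PosSemidef := by
  refine Matrix.PosSemidef.of_dotProduct_mulVec_nonneg ?_ fun u => ?_
  · ext j k
    simp [momentMatrix, mul_comm]
  · have h := toBilin'_momentMatrix hA hB u u
    rw [Matrix.toBilin'_apply'] at h
    rw [star_trivial, h]
    exact integral_nonneg fun ω => mul_self_nonneg _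

end

variable [IsProbabilityMeasure μ]

lemma SatisfiesChannel.compatible (hKV : ∀ i ≤ n, (ch.KV i).PosDef)
    (h : SatisfiesChannel ch n μ A B V)
    (hA : ∀ i ≤ n, ∀ c, MemLp (fun ω => A i ω c) 2 μ) :
    Compatible ch n (momentMatrix n μ A B) := by
  have hB := h.memLp_output hA
  have hVeq : ∀ i ≤ n, ∀ c, (fun ω => evalForm (fun k => A k ω) (fun k => B k ω) (formV ch n i c))
      =ᵐ[μ] fun ω => V i ω c := by
    intro i hi c
    filter_upwards [h.output_eq i hi] with ω hω
    rw [evalForm_V ch _ _ hi, hω]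
    simp
  have hV0 : ∀ i ≤ n, ∀ c, ∫ ω, V i ω c ∂μ = 0 := by
    intro i hi c
    rw [← integral_eval_gaussianLaw (ch.KV i) c, ← h.noise_law i hi,
      integral_map (h.measurable_V i hi).aemeasurable
        (measurable_pi_apply c).aestronglyMeasurable]
  have hV : ∀ i ≤ n, ∀ c (X : Ω → ℝ), IndepFun (V i) X μ →
      AEStronglyMeasurable X μ → ∫ ω, V i ω c * X ω ∂μ = 0 := by
    intro i hi c X hX hm
    have hX' : IndepFun (fun ω => V i ω c) X μ := hX.comp (measurable_pi_apply c) measurable_id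
    rw [hX'.integral_fun_mul_eq_mul_integral
      (h.memLp_noise hi c).aestronglyMeasurable hm, hV0 i hi, zero_mul]
  refine ⟨posSemidef_momentMatrix hA hB, ?_, ?_, ?_, ?_, ?_⟩
  · rw [toBilin'_momentMatrix hA hB]
    simp [evalForm_one]
  · intro i hi c
    rw [toBilin'_momentMatrix hA hB]
    simp only [evalForm_one, mul_one]
    rw [integral_congr_ae (hVeq i hi c), hV0 i hi]
  · intro i hi c d
    refine ((toBilin'_momentMatrix hA hB _ _).trans
      (integral_congr_ae ((hVeq i hi c).mul (hVeq i hi d)))).trans ?_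
    simp only [Pi.mul_apply]
    rw [← integral_eval_mul_eval_gaussianLaw (hKV i hi).posSemidef c d, ← h.noise_law i hi,
      integral_map (h.measurable_V i hi).aemeasurable (by fun_prop)]
  · intro i hi k hk c d
    refine ((toBilin'_momentMatrix hA hB _ _).trans
      (integral_congr_ae ((hVeq i hi c).mul (ae_eq_refl _)))).trans ?_
    simp only [Pi.mul_apply, evalForm_A _ _ (hk.trans hi)]
    refine hV i hi c _ ?_ (hA k (hk.trans hi) d).aestronglyMeasurable
    exact (h.noise_indep i hi).comp measurable_id (((measurable_pi_apply d).comp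
      ((measurable_pi_apply (⟨k, by omega⟩ : Fin (i + 1))).comp measurable_fst)) :
        Measurable fun x : (Fin (i + 1) → Vec q) × (Fin i → Vec p) × (Fin i → Vec p) =>
          x.1 ⟨k, by omega⟩ d)
  · intro i hi k hk c d
    refine ((toBilin'_momentMatrix hA hB _ _).trans
      (integral_congr_ae ((hVeq i hi c).mul (ae_eq_refl _)))).trans ?_
    simp only [Pi.mul_apply, evalForm_B _ _ (hk.le.trans hi)]
    refine hV i hi c _ ?_ (hB k (hk.le.trans hi) d).aestronglyMeasurable
    exact (h.noise_indep i hi).comp measurable_id (((measurable_pi_apply d).comp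
      ((measurable_pi_apply (⟨k, by omega⟩ : Fin i)).comp measurable_snd.fst)) :
        Measurable fun x : (Fin (i + 1) → Vec q) × (Fin i → Vec p) × (Fin i → Vec p) =>
          x.2.1 ⟨k, by omega⟩ d)

/-! ### The cost constraint -/

lemma cost_eq_evalForm {i : ℕ} (hi : i ≤ n) (x : ℕ → Vec q) (y : ℕ → Vec p) :
    ch.cost i x y = ∑ j, ∑ k, ch.R i j k * (evalForm x y (lagA ch n i j.1 j.2)
        * evalForm x y (lagA ch n i k.1 k.2))
      + ∑ j, ∑ k, ch.Q i j k * (evalForm x y (lagB ch n i j.1 j.2)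
        * evalForm x y (lagB ch n i k.1 k.2)) := by
  simp only [evalForm_lagA ch x y hi, evalForm_lagB ch x y hi, GLCM.cost, GLCM.inputWindow,
    GLCM.outputWindow, dotProduct, Matrix.mulVec, Finset.mul_sum]
  congr 1 <;> exact Finset.sum_congr rfl fun j _ => Finset.sum_congr rfl fun k _ => by ring

lemma integrable_cost (hA : ∀ i ≤ n, ∀ c, MemLp (fun ω => A i ω c) 2 μ)
    (hB : ∀ i ≤ n, ∀ c, MemLp (fun ω => B i ω c) 2 μ) {i : ℕ} (hi : i ≤ n) :
    Integrable (fun ω => ch.cost i (fun k => A k ω) (fun k => B k ω)) μ ∧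
    ∫ ω, ch.cost i (fun k => A k ω) (fun k => B k ω) ∂μ
      = costForm ch (momentMatrix n μ A B) i := by
  have hint : ∀ v w : Form p q n, Integrable
      (fun ω => evalForm (fun k => A k ω) (fun k => B k ω) v
        * evalForm (fun k => A k ω) (fun k => B k ω) w) μ :=
    fun v w => (memLp_evalForm hA hB v).integrable_mul (memLp_evalForm hA hB w)
  have hsum : ∀ (d m : ℕ) (K : Matrix (Fin m × Fin d) (Fin m × Fin d) ℝ)
      (g : Fin m × Fin d → Form p q n),
      Integrable (fun ω => ∑ j, ∑ k, K j k * (evalForm (fun k => A k ω) (fun k => B k ω) (g j)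
        * evalForm (fun k => A k ω) (fun k => B k ω) (g k))) μ ∧
      ∫ ω, ∑ j, ∑ k, K j k * (evalForm (fun k => A k ω) (fun k => B k ω) (g j)
        * evalForm (fun k => A k ω) (fun k => B k ω) (g k)) ∂μ
      = ∑ j, ∑ k, K j k * Matrix.toBilin' (momentMatrix n μ A B) (g j) (g k) := by
    intro d m K g
    refine ⟨integrable_finsetSum _ fun j _ => integrable_finsetSum _ fun k _ =>
      (hint _ _).const_mul _, ?_⟩
    rw [integral_finsetSum _ fun j _ => integrable_finsetSum _ fun k _ =>
      (hint (g j) (g k)).const_mul (K j k)]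
    refine Finset.sum_congr rfl fun j _ => ?_
    rw [integral_finsetSum _ fun k _ => (hint (g j) (g k)).const_mul (K j k)]
    refine Finset.sum_congr rfl fun k _ => ?_
    rw [integral_const_mul, toBilin'_momentMatrix hA hB]
  simp only [cost_eq_evalForm hi]
  have h1 := hsum q (L + 1) (ch.R i) fun j => lagA ch n i j.1 j.2
  have h2 := hsum p (M + 1) (ch.Q i) fun j => lagB ch n i j.1 j.2
  exact ⟨h1.1.add h2.1, by rw [integral_add h1.1 h2.1, h1.2, h2.2, costForm]⟩

lemma GLCM.cost_nonneg {i : ℕ} (hR : (ch.R i).PosDef) (hQ : (ch.Q i).PosSemidef) (x : ℕ → Vec q)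
    (y : ℕ → Vec p) : 0 ≤ ch.cost i x y :=
  add_nonneg (by simpa using hR.posSemidef.dotProduct_mulVec_nonneg _)
    (by simpa using hQ.dotProduct_mulVec_nonneg _)

lemma sq_apply_le_of_posDef {ι : Type*} [Fintype ι] [DecidableEq ι] {K : Matrix ι ι ℝ}
    (hK : K.PosDef) (x : ι → ℝ) (e : ι) : x e ^ 2 ≤ K⁻¹ e e * (x ⬝ᵥ K.mulVec x) := by
  have hu : IsUnit K.det := (Matrix.isUnit_iff_isUnit_det K).1 hK.isUnit
  have h1 : K.mulVec (K⁻¹.mulVec (Pi.single e 1)) = Pi.single e 1 := by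
    rw [Matrix.mulVec_mulVec, Matrix.mul_nonsing_inv _ hu, Matrix.one_mulVec]
  have h2 := toBilin'_sq_le hK.posSemidef x (K⁻¹.mulVec (Pi.single e 1))
  simp only [Matrix.toBilin'_apply', h1] at h2
  have h3 : K⁻¹.mulVec (Pi.single e 1) ⬝ᵥ (Pi.single e 1 : ι → ℝ) = K⁻¹ e e := by
    simp
  rw [h3] at h2
  simpa [mul_comm] using h2

/-- The constant by which the cost at time `i` bounds the square of `A_{i,c}`. -/
noncomputable def inputBound (ch : GLCM p q L M) (i : ℕ) (c : Fin q) : ℝ :=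
  (ch.R i)⁻¹ (0, c) (0, c)

lemma inputBound_nonneg {i : ℕ} (hR : (ch.R i).PosDef) (c : Fin q) : 0 ≤ inputBound ch i c :=
  hR.inv.posSemidef.diag_nonneg

lemma sq_le_inputBound_mul_cost {i : ℕ} (hR : (ch.R i).PosDef) (hQ : (ch.Q i).PosSemidef)
    (x : ℕ → Vec q) (y : ℕ → Vec p) (c : Fin q) :
    x i c ^ 2 ≤ inputBound ch i c * ch.cost i x y := by
  have h1 := sq_apply_le_of_posDef hR (ch.inputWindow i x) (0, c)
  have h2 : ch.inputWindow i x (0, c) = x i c := by simp [GLCM.inputWindow, lag]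
  rw [h2] at h1
  refine h1.trans (mul_le_mul_of_nonneg_left ?_ (inputBound_nonneg hR c))
  rw [GLCM.cost]
  have := hQ.dotProduct_mulVec_nonneg (ch.outputWindow i y)
  simp only [star_trivial] at this
  linarith

variable (hR : ∀ i ≤ n, (ch.R i).PosDef) (hQ : ∀ i ≤ n, (ch.Q i).PosSemidef)
include hR hQ

lemma avgCost_eq (hA : ∀ i ≤ n, ∀ c, MemLp (fun ω => A i ω c) 2 μ)
    (hB : ∀ i ≤ n, ∀ c, MemLp (fun ω => B i ω c) 2 μ) :
    ch.avgCost n μ A B = ENNReal.ofReal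
      (((n : ℝ) + 1)⁻¹ * ∑ i ∈ Finset.range (n + 1), costForm ch (momentMatrix n μ A B) i) := by
  have hi : ∀ i ∈ Finset.range (n + 1), i ≤ n := fun i hi =>
    Nat.lt_succ_iff.1 (Finset.mem_range.1 hi)
  have h0 : ∀ i ∈ Finset.range (n + 1), 0 ≤ costForm ch (momentMatrix n μ A B) i := fun i h' => by
    rw [← (integrable_cost hA hB (hi i h')).2]
    exact integral_nonneg fun ω => GLCM.cost_nonneg (hR i (hi i h')) (hQ i (hi i h')) _ _
  rw [GLCM.avgCost, ENNReal.ofReal_mul (by positivity), ENNReal.ofReal_sum_of_nonneg h0]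
  congr 1
  · rw [ENNReal.ofReal_inv_of_pos (by positivity), ENNReal.ofReal_add (by positivity) zero_le_one]
    simp
  · refine Finset.sum_congr rfl fun i h' => ?_
    rw [← (integrable_cost hA hB (hi i h')).2,
      ofReal_integral_eq_lintegral_ofReal (integrable_cost hA hB (hi i h')).1
      (Filter.Eventually.of_forall fun ω =>
        GLCM.cost_nonneg (hR i (hi i h')) (hQ i (hi i h')) _ _)]

lemma avgCost_le_iff (hA : ∀ i ≤ n, ∀ c, MemLp (fun ω => A i ω c) 2 μ)
    (hB : ∀ i ≤ n, ∀ c, MemLp (fun ω => B i ω c) 2 μ) {κ : ℝ} (hκ : 0 ≤ κ) :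
    ch.avgCost n μ A B ≤ ENNReal.ofReal κ ↔
      ∑ i ∈ Finset.range (n + 1), costForm ch (momentMatrix n μ A B) i ≤ (n + 1) * κ := by
  rw [avgCost_eq hR hQ hA hB, ENNReal.ofReal_le_ofReal_iff hκ, inv_mul_le_iff₀ (by positivity)]

omit [IsProbabilityMeasure μ] in
lemma memLp_input_of_avgCost_ne_top (hAm : ∀ i ≤ n, Measurable (A i))
    (hcost : ch.avgCost n μ A B ≠ ∞) : ∀ i ≤ n, ∀ c, MemLp (fun ω => A i ω c) 2 μ := by
  intro i hi c
  have h1 : ∫⁻ ω, ENNReal.ofReal (ch.cost i (fun k => A k ω) (fun k => B k ω)) ∂μ ≠ ∞ := by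
    intro htop
    refine hcost ?_
    rw [GLCM.avgCost, ENNReal.sum_eq_top.2 ⟨i, Finset.mem_range.2 (by omega), htop⟩]
    exact ENNReal.mul_top (ENNReal.inv_ne_zero.2 (by finiteness))
  have hm : Measurable fun ω => A i ω c := (measurable_pi_apply c).comp (hAm i hi)
  refine (memLp_two_iff_integrable_sq hm.aestronglyMeasurable).2 ⟨by fun_prop, ?_⟩
  rw [hasFiniteIntegral_iff_ofReal (Filter.Eventually.of_forall fun ω => sq_nonneg _)]
  have h2 : ∀ ω, ENNReal.ofReal (A i ω c ^ 2) ≤ ENNReal.ofReal (inputBound ch i c) *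
      ENNReal.ofReal (ch.cost i (fun k => A k ω) (fun k => B k ω)) := fun ω => by
    rw [← ENNReal.ofReal_mul (inputBound_nonneg (hR i hi) c)]
    exact ENNReal.ofReal_le_ofReal
      (sq_le_inputBound_mul_cost (hR i hi) (hQ i hi) (fun k => A k ω) (fun k => B k ω) c)
  refine (lintegral_mono h2).trans_lt ?_
  rw [lintegral_const_mul' _ _ ENNReal.ofReal_ne_top]
  exact ENNReal.mul_lt_top ENNReal.ofReal_lt_top h1.lt_top

lemma toBilin'_momentMatrix_formA_le (hA : ∀ i ≤ n, ∀ c, MemLp (fun ω => A i ω c) 2 μ)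
    (hB : ∀ i ≤ n, ∀ c, MemLp (fun ω => B i ω c) 2 μ) {κ : ℝ} (hκ : 0 ≤ κ)
    (hcost : ch.avgCost n μ A B ≤ ENNReal.ofReal κ) {i : ℕ} (hi : i ≤ n) (c : Fin q) :
    Matrix.toBilin' (momentMatrix n μ A B) (formA n i c) (formA n i c)
      ≤ inputBound ch i c * ((n + 1) * κ) := by
  have h1 := (avgCost_le_iff hR hQ hA hB hκ).1 hcost
  have h0 : ∀ i ∈ Finset.range (n + 1), 0 ≤ costForm ch (momentMatrix n μ A B) i := fun i h' => by
    have hi := Nat.lt_succ_iff.1 (Finset.mem_range.1 h')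
    rw [← (integrable_cost hA hB hi).2]
    exact integral_nonneg fun ω => GLCM.cost_nonneg (hR i hi) (hQ i hi) _ _
  have h2 := (Finset.single_le_sum h0 (Finset.mem_range.2 (Nat.lt_succ_of_le hi))).trans h1
  refine le_trans ?_ (mul_le_mul_of_nonneg_left h2 (inputBound_nonneg (hR i hi) c))
  rw [toBilin'_momentMatrix hA hB, ← (integrable_cost hA hB hi).2, ← integral_const_mul]
  simp only [evalForm_A _ _ hi, ← pow_two]
  exact integral_mono (hA i hi c).integrable_sq ((integrable_cost hA hB hi).1.const_mul _)
    fun ω => sq_le_inputBound_mul_cost (hR i hi) (hQ i hi) (fun k => A k ω) (fun k => B k ω) c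

end Moments

/-! ### Gaussian outputs maximize the entropy -/

lemma isProbabilityMeasure_withDensity_gaussPdf {ι : Type*} [Fintype ι] [DecidableEq ι]
    {K : Matrix ι ι ℝ} (hK : K.PosDef) (m : ι → ℝ) :
    IsProbabilityMeasure ((volume : Measure (ι → ℝ)).withDensity
      fun x => ENNReal.ofReal (gaussPdf m K x)) := by
  have h := map_ofLp_multivariateGaussian (WithLp.toLp 2 m) hK
  rw [← h]
  exact Measure.isProbabilityMeasure_map (by fun_prop)

/-- The entropy of the Gaussian law with covariance matrix `K`. -/
noncomputable def gaussEntropy {ι : Type*} [Fintype ι] [DecidableEq ι] (K : Matrix ι ι ℝ) : ℝ :=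
  (1 / 2) * (Fintype.card ι * Real.log (2 * Real.pi) + Real.log K.det + Fintype.card ι)

/-- The cross entropy of `X` relative to a Gaussian law depends only on the first two moments. -/
lemma integral_log_gaussPdf {Ω ι : Type*} [Fintype ι] [DecidableEq ι] [MeasurableSpace Ω]
    {μ : Measure Ω} [IsProbabilityMeasure μ] {X : Ω → ι → ℝ}
    (hX : ∀ c, MemLp (fun ω => X ω c) 2 μ) {m : ι → ℝ} {K : Matrix ι ι ℝ} (hK : K.PosDef)
    (hcov : ∀ j k, ∫ ω, (X ω j - m j) * (X ω k - m k) ∂μ = K j k) :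
    -∫ ω, Real.log (gaussPdf m K (X ω)) ∂μ = gaussEntropy K := by
  have h1 : ∀ ω, Real.log (gaussPdf m K (X ω))
      = -(1 / 2) * (Fintype.card ι * Real.log (2 * Real.pi)
      + Real.log K.det + ∑ j, ∑ k, K⁻¹ j k * ((X ω j - m j) * (X ω k - m k))) := by
    intro ω
    rw [log_gaussPdf]
    congr 2
    simp only [dotProduct, Matrix.mulVec, Finset.mul_sum, Pi.sub_apply]
    exact Finset.sum_congr rfl fun j _ => Finset.sum_congr rfl fun k _ => by ring
  have hd : ∀ j k, Integrable (fun ω => (X ω j - m j) * (X ω k - m k)) μ :=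
    fun j k => ((hX j).sub (memLp_const (m j))).integrable_mul ((hX k).sub (memLp_const (m k)))
  have hsum : Integrable (fun ω => ∑ j, ∑ k, K⁻¹ j k * ((X ω j - m j) * (X ω k - m k))) μ :=
    integrable_finsetSum _ fun j _ => integrable_finsetSum _ fun k _ => (hd j k).const_mul _
  have h2 : ∫ ω, ∑ j, ∑ k, K⁻¹ j k * ((X ω j - m j) * (X ω k - m k)) ∂μ = Fintype.card ι := by
    rw [integral_finsetSum _ fun j _ => integrable_finsetSum _ fun k _ =>
      (hd j k).const_mul (K⁻¹ j k)]
    have h3 : ∀ j, ∫ ω, ∑ k, K⁻¹ j k * ((X ω j - m j) * (X ω k - m k)) ∂μ = (K⁻¹ * K) j j := by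
      intro j
      rw [integral_finsetSum _ fun k _ => (hd j k).const_mul (K⁻¹ j k), Matrix.mul_apply]
      refine Finset.sum_congr rfl fun k _ => ?_
      rw [integral_const_mul, hcov]
      congr 1
      have := hK.isHermitian.apply k j
      simpa using this
    have hu : IsUnit K.det := (Matrix.isUnit_iff_isUnit_det K).1 hK.isUnit
    simp only [h3, Matrix.nonsing_inv_mul K hu]
    simp
  simp only [h1]
  rw [integral_const_mul, integral_add (integrable_const _) hsum, h2, integral_const]
  simp only [probReal_univ, one_smul, gaussEntropy]
  ring

/-- The joint density of `N` random vectors that are, when written as one vector, Gaussian. -/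
noncomputable def stackedPdf {N d : ℕ} (m : Fin N × Fin d → ℝ)
    (K : Matrix (Fin N × Fin d) (Fin N × Fin d) ℝ) (x : Fin N → Vec d) : ℝ :=
  gaussPdf m K fun j => x j.1 j.2

lemma map_curry_withDensity {N d : ℕ} (m : Fin N × Fin d → ℝ)
    (K : Matrix (Fin N × Fin d) (Fin N × Fin d) ℝ) :
    ((volume : Measure (Fin N × Fin d → ℝ)).withDensity
      fun x => ENNReal.ofReal (gaussPdf m K x)).map (MeasurableEquiv.curry (Fin N) (Fin d) ℝ)
    = volume.withDensity fun x => ENNReal.ofReal (stackedPdf m K x) := by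
  have hm1 : Measurable fun x => ENNReal.ofReal (gaussPdf m K x) := by fun_prop
  have hm2 : Measurable fun x : Fin N → Vec d => ENNReal.ofReal (stackedPdf m K x) := by
    unfold stackedPdf
    fun_prop
  refine Measure.ext_of_lintegral _ fun f hf => ?_
  rw [lintegral_map hf (MeasurableEquiv.measurable _),
    lintegral_withDensity_eq_lintegral_mul _ hm2 hf,
    ← (measurePreserving_curry (Fin N) (Fin d)).lintegral_comp (hm2.mul hf)]
  exact lintegral_withDensity_eq_lintegral_mul _ hm1 (hf.comp (MeasurableEquiv.measurable _))

section MaxEntropy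

variable {p q L M : ℕ} {ch : GLCM p q L M} {n : ℕ} {Ω : Type*} [MeasurableSpace Ω]
  {μ : Measure Ω} [IsProbabilityMeasure μ] {A : ℕ → Ω → Vec q} {B V : ℕ → Ω → Vec p}

variable (hA : ∀ i ≤ n, ∀ c, MemLp (fun ω => A i ω c) 2 μ)
  (hB : ∀ i ≤ n, ∀ c, MemLp (fun ω => B i ω c) 2 μ)
include hA hB

lemma integral_centered_output (j k : Fin (n + 1) × Fin p) :
    ∫ ω, (B j.1 ω j.2 - outMean ch (momentMatrix n μ A B) j)
        * (B k.1 ω k.2 - outMean ch (momentMatrix n μ A B) k) ∂μ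
      = outCov ch (momentMatrix n μ A B) j k := by
  set S := momentMatrix n μ A B with hS
  have hj := Nat.lt_succ_iff.1 j.1.2
  have hk := Nat.lt_succ_iff.1 k.1.2
  have h1 : ∀ r i c, i ≤ n → ∀ x : ℕ → Vec q, ∀ y : ℕ → Vec p,
      evalForm x y (formB n i c - r • formOne n) = y i c - r := by
    intro r i c hi x y
    rw [map_sub, map_smul, evalForm_one, evalForm_B x y hi, smul_eq_mul, mul_one]
  have h2 := toBilin'_momentMatrix hA hB (formB n j.1 j.2 - outMean ch S j • formOne n)
    (formB n k.1 k.2 - outMean ch S k • formOne n)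
  simp only [h1 _ _ _ hj, h1 _ _ _ hk, ← hS] at h2
  have hc : Matrix.toBilin' S (formB n j.1 j.2) (formOne n)
      = Matrix.toBilin' S (formOne n) (formB n j.1 j.2) :=
    toBilin'_comm (posSemidef_momentMatrix hA hB) _ _
  have h3 : Matrix.toBilin' S (formOne n) (formOne n) = 1 := by
    rw [toBilin'_momentMatrix hA hB]
    simp [evalForm_one]
  have hee : meanFlag ch * meanFlag ch = meanFlag ch := by
    rcases meanFlag_eq_zero_or_one (ch := ch) with h | h <;> simp [h]
  rw [← h2]
  simp only [map_sub, map_smul, LinearMap.sub_apply, LinearMap.smul_apply, smul_eq_mul, h3,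
    outCov, Matrix.of_apply, outMean, hc]
  linear_combination (Matrix.toBilin' S (formOne n) (formB n j.1 j.2))
    * (Matrix.toBilin' S (formOne n) (formB n k.1 k.2)) * hee

lemma integral_log_stackedPdf (hK : (outCov ch (momentMatrix n μ A B)).PosDef) :
    Integrable (fun ω => Real.log (stackedPdf (outMean ch (momentMatrix n μ A B))
      (outCov ch (momentMatrix n μ A B)) (seg B (n + 1) ω))) μ ∧
    -∫ ω, Real.log (stackedPdf (outMean ch (momentMatrix n μ A B))
      (outCov ch (momentMatrix n μ A B)) (seg B (n + 1) ω)) ∂μ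
      = gaussEntropy (outCov ch (momentMatrix n μ A B)) := by
  have hX : ∀ j : Fin (n + 1) × Fin p, MemLp (fun ω => B j.1 ω j.2) 2 μ :=
    fun j => hB _ (Nat.lt_succ_iff.1 j.1.2) _
  exact ⟨integrable_log_gaussPdf (X := fun ω (j : Fin (n + 1) × Fin p) => B j.1 ω j.2) hX _ _,
    integral_log_gaussPdf (X := fun ω (j : Fin (n + 1) × Fin p) => B j.1 ω j.2) hX hK
      (integral_centered_output hA hB)⟩

omit hB in
/-- Among all processes with given second moments, Gaussian outputs maximize the entropy. -/
lemma SatisfiesChannel.sum_condEntropy_le_gaussEntropy (hKV : ∀ i ≤ n, (ch.KV i).PosDef)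
    (h : SatisfiesChannel ch n μ A B V) :
    ∑ i ∈ Finset.range (n + 1), condEntropy (B i) (seg B i) μ
      ≤ gaussEntropy (outCov ch (momentMatrix n μ A B)) := by
  have hB := h.memLp_output hA
  have hK := posDef_outCov hKV (h.compatible hKV hA)
  obtain ⟨hi, he⟩ := integral_log_stackedPdf (ch := ch) hA hB hK
  rw [← he]
  refine h.sum_condEntropy_le hKV hB ?_ (fun x => gaussPdf_pos _ _ _) ?_ hi
  · unfold stackedPdf
    fun_prop
  · have := isProbabilityMeasure_withDensity_gaussPdf hK (outMean ch (momentMatrix n μ A B))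
    rw [← map_curry_withDensity]
    exact Measure.isProbabilityMeasure_map (MeasurableEquiv.measurable _).aemeasurable

omit hB in
/-- Gaussian outputs attain the bound of `SatisfiesChannel.sum_condEntropy_le_gaussEntropy`. The
hypothesis `hmean` says that they have mean zero if the initial data vanish. -/
lemma SatisfiesChannel.sum_condEntropy_eq_gaussEntropy (hKV : ∀ i ≤ n, (ch.KV i).PosDef)
    (h : SatisfiesChannel ch n μ A B V)
    (hG : IsGaussian (μ.map fun ω (j : Fin (n + 1) × Fin p) => B j.1 ω j.2))
    (hmean : ∀ j : Fin (n + 1) × Fin p,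
      Matrix.toBilin' (momentMatrix n μ A B) (formOne n) (formB n j.1 j.2)
        = outMean ch (momentMatrix n μ A B) j) :
    ∑ i ∈ Finset.range (n + 1), condEntropy (B i) (seg B i) μ
      = gaussEntropy (outCov ch (momentMatrix n μ A B)) := by
  have hB := h.memLp_output hA
  have hK := posDef_outCov hKV (h.compatible hKV hA)
  have hX : Measurable fun ω (j : Fin (n + 1) × Fin p) => B j.1 ω j.2 :=
    measurable_pi_lambda _ fun j =>
      (measurable_pi_apply j.2).comp (h.measurable_B _ (Nat.lt_succ_iff.1 j.1.2))
  have hm : ∀ j : Fin (n + 1) × Fin p,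
      ∫ ω, B j.1 ω j.2 ∂μ = outMean ch (momentMatrix n μ A B) j := by
    intro j
    rw [← hmean j, toBilin'_momentMatrix hA hB]
    simp only [evalForm_one, evalForm_B _ _ (Nat.lt_succ_iff.1 j.1.2), one_mul]
  have hlaw := eq_withDensity_gaussPdf_of_isGaussian
    (ν := μ.map fun ω (j : Fin (n + 1) × Fin p) => B j.1 ω j.2) hK
    (m := outMean ch (momentMatrix n μ A B))
    (fun j => by
      rw [integral_map hX.aemeasurable (measurable_pi_apply j).aestronglyMeasurable]
      exact hm j)
    (fun j k => by
      rw [covariance_map (measurable_pi_apply j).aestronglyMeasurable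
        (measurable_pi_apply k).aestronglyMeasurable hX.aemeasurable,
        ← integral_centered_output hA hB j k, covariance]
      simp only [Function.comp_def, hm])
  obtain ⟨hi, he⟩ := integral_log_stackedPdf (ch := ch) hA hB hK
  rw [← he]
  refine h.sum_condEntropy_eq hKV hB ?_ (fun x => gaussPdf_pos _ _ _) ?_
  · unfold stackedPdf
    fun_prop
  · rw [← map_curry_withDensity, ← hlaw, Measure.map_map (MeasurableEquiv.measurable _) hX]
    rfl

end MaxEntropy

/-! ### An optimal second-moment matrix -/

section Compactness

variable {p q L M : ℕ} (ch : GLCM p q L M) (n : ℕ)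

/-- The compatible second-moment matrices that satisfy the cost constraint. The explicit bounds on
the second moments of the inputs are a consequence of the cost constraint, and make this set
compact. -/
def admissible (κ : ℝ) : Set (Matrix (Idx p q n) (Idx p q n) ℝ) :=
  {S | Compatible ch n S ∧ ∑ i ∈ Finset.range (n + 1), costForm ch S i ≤ (n + 1) * κ ∧
    ∀ i ≤ n, ∀ c, Matrix.toBilin' S (formA n i c) (formA n i c)
      ≤ inputBound ch i c * ((n + 1) * κ)}

@[fun_prop]
lemma continuous_toBilin' {ι : Type*} [Fintype ι] [DecidableEq ι] (v w : ι → ℝ) :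
    Continuous fun S : Matrix ι ι ℝ => Matrix.toBilin' S v w := by
  simp only [Matrix.toBilin'_apply]
  fun_prop

lemma continuous_costForm (i : ℕ) :
    Continuous fun S : Matrix (Idx p q n) (Idx p q n) ℝ => costForm ch S i := by
  unfold costForm
  fun_prop

lemma continuous_det_outCov :
    Continuous fun S : Matrix (Idx p q n) (Idx p q n) ℝ => (outCov ch S).det := by
  refine Continuous.matrix_det (continuous_matrix fun j k => ?_)
  simp only [outCov, Matrix.of_apply]
  fun_prop

lemma isClosed_posSemidef {ι : Type*} [Fintype ι] [DecidableEq ι] :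
    IsClosed {S : Matrix ι ι ℝ | S.PosSemidef} := by
  have h : {S : Matrix ι ι ℝ | S.PosSemidef}
      = {S | S.conjTranspose = S} ∩ ⋂ v : ι → ℝ, {S | 0 ≤ Matrix.toBilin' S v v} := by
    ext S
    simp only [Set.mem_inter_iff, Set.mem_iInter, Set.mem_ofPred_eq]
    refine ⟨fun h => ⟨h.isHermitian, toBilin'_self_nonneg h⟩, fun h =>
      Matrix.PosSemidef.of_dotProduct_mulVec_nonneg h.1 fun v => ?_⟩
    simpa [Matrix.toBilin'_apply'] using h.2 v
  rw [h]
  exact (isClosed_eq (by fun_prop) continuous_id).inter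
    (isClosed_iInter fun v => isClosed_le continuous_const (by fun_prop))

lemma isClosed_admissible (κ : ℝ) : IsClosed (admissible ch n κ) := by
  have hc : {S | Compatible ch n S} = {S | S.PosSemidef} ∩ {S |
      Matrix.toBilin' S (formOne n) (formOne n) = 1 ∧
      (∀ i ≤ n, ∀ c, Matrix.toBilin' S (formV ch n i c) (formOne n) = 0) ∧
      (∀ i ≤ n, ∀ c d, Matrix.toBilin' S (formV ch n i c) (formV ch n i d) = ch.KV i c d) ∧
      (∀ i ≤ n, ∀ k ≤ i, ∀ c d, Matrix.toBilin' S (formV ch n i c) (formA n k d) = 0) ∧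
      ∀ i ≤ n, ∀ k < i, ∀ c d, Matrix.toBilin' S (formV ch n i c) (formB n k d) = 0} :=
    Set.ext fun S => ⟨fun h => ⟨h.1, h.2, h.3, h.4, h.5, h.6⟩,
      fun h => ⟨h.1, h.2.1, h.2.2.1, h.2.2.2.1, h.2.2.2.2.1, h.2.2.2.2.2⟩⟩
  have h1 : IsClosed {S | Compatible ch n S} := by
    rw [hc]
    refine isClosed_posSemidef.inter ?_
    simp only [Set.ofPred_and, Set.ofPred_forall]
    refine IsClosed.inter ?_ (IsClosed.inter ?_ (IsClosed.inter ?_ (IsClosed.inter ?_ ?_))) <;>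
    repeat' refine isClosed_iInter fun _ => ?_
    all_goals exact isClosed_eq (by fun_prop) continuous_const
  have h2 : IsClosed {S : Matrix (Idx p q n) (Idx p q n) ℝ | ∀ i ≤ n, ∀ c,
      Matrix.toBilin' S (formA n i c) (formA n i c) ≤ inputBound ch i c * ((n + 1) * κ)} := by
    simp only [Set.ofPred_forall]
    repeat' refine isClosed_iInter fun _ => ?_
    exact isClosed_le (by fun_prop) continuous_const
  exact h1.inter (IsClosed.inter (isClosed_le (continuous_finsetSum _ fun i _ =>
    continuous_costForm ch n i) continuous_const) h2)

/-- The forms whose second moments are bounded on the admissible set. -/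
def boundedForms (κ : ℝ) : Submodule ℝ (Form p q n) where
  carrier := {w | ∃ C, ∀ S ∈ admissible ch n κ, Matrix.toBilin' S w w ≤ C}
  zero_mem' := ⟨0, fun S _ => by simp⟩
  add_mem' := by
    rintro v w ⟨C, hC⟩ ⟨D, hD⟩
    refine ⟨2 * C + 2 * D, fun S hS => ?_⟩
    have h1 := toBilin'_self_nonneg hS.1.posSemidef (v - w)
    have h2 := hC S hS
    have h3 := hD S hS
    simp only [map_sub, map_add, LinearMap.sub_apply, LinearMap.add_apply] at h1 ⊢
    linarith
  smul_mem' := by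
    rintro r w ⟨C, hC⟩
    refine ⟨r ^ 2 * C, fun S hS => ?_⟩
    have h := mul_le_mul_of_nonneg_left (hC S hS) (sq_nonneg r)
    simp only [map_smul, LinearMap.smul_apply, smul_eq_mul]
    linarith

lemma formB_mem_boundedForms (κ : ℝ) : ∀ i ≤ n, ∀ c, formB n i c ∈ boundedForms ch n κ := by
  have h1 : formOne n ∈ boundedForms ch n κ := ⟨1, fun S hS => hS.1.one_one.le⟩
  have hA : ∀ i ≤ n, ∀ c, formA n i c ∈ boundedForms ch n κ :=
    fun i hi c => ⟨_, fun S hS => hS.2.2 i hi c⟩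
  intro i
  induction i using Nat.strong_induction_on with
  | _ i ih =>
    intro hi c
    have h : formB n i c = formV ch n i c
        + (∑ j : Fin M, ∑ d, ch.C i j c d • lagB ch n i (j + 1) d
          + ∑ j : Fin (L + 1), ∑ d, ch.D i j c d • lagA ch n i j d) := by
      rw [formV, sub_add_cancel]
    rw [h]
    refine Submodule.add_mem _ ⟨ch.KV i c c, fun S hS => (hS.1.noise_noise i hi c c).le⟩
      (Submodule.add_mem _ ?_ ?_) <;>
    refine Submodule.sum_mem _ fun j _ => Submodule.sum_mem _ fun d _ => Submodule.smul_mem _ _ ?_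
    · exact lagForm_mem h1 fun _ => ih _ (by omega) (by omega) d
    · exact lagForm_mem h1 fun _ => hA _ (by omega) d

lemma single_mem_boundedForms (κ : ℝ) (j : Idx p q n) :
    Pi.single j 1 ∈ boundedForms ch n κ := by
  rcases j with _ | ⟨k, c⟩ | ⟨k, c⟩
  · exact ⟨1, fun S hS => hS.1.one_one.le⟩
  · have h : formA n k c ∈ boundedForms ch n κ :=
      ⟨_, fun S hS => hS.2.2 k (Nat.lt_succ_iff.1 k.2) c⟩
    simpa [formA, Nat.lt_succ_iff.1 k.2] using h
  · simpa [formB, Nat.lt_succ_iff.1 k.2] using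
      formB_mem_boundedForms ch n κ k (Nat.lt_succ_iff.1 k.2) c

lemma isCompact_admissible (κ : ℝ) : IsCompact (admissible ch n κ) := by
  choose C hC using single_mem_boundedForms ch n κ
  refine IsCompact.of_isClosed_subset
    (isCompact_univ_pi fun j => isCompact_univ_pi fun k =>
      isCompact_Icc (a := -(C j + C k)) (b := C j + C k)) (isClosed_admissible ch n κ) ?_
  intro S hS j _ k _
  have h0 := fun j => toBilin'_self_nonneg hS.1.posSemidef (Pi.single j 1)
  have h1 := fun j => (h0 j).trans (hC j S hS)
  have h2 := toBilin'_sq_le hS.1.posSemidef (Pi.single j 1) (Pi.single k 1)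
  have h3 := h2.trans (mul_le_mul (hC j S hS) (hC k S hS) (h0 k) (h1 j))
  rw [Matrix.toBilin'_single] at h3
  exact abs_le.1 (abs_le_of_sq_le_sq (by nlinarith [h1 j, h1 k]) (add_nonneg (h1 j) (h1 k)))

lemma exists_isMaxOn_det_outCov {κ : ℝ} (h : (admissible ch n κ).Nonempty) :
    ∃ S ∈ admissible ch n κ, ∀ S' ∈ admissible ch n κ, (outCov ch S').det ≤ (outCov ch S).det :=
  (isCompact_admissible ch n κ).exists_isMaxOn h (continuous_det_outCov ch n).continuousOn

variable {ch n}

lemma gaussEntropy_le_gaussEntropy {ι : Type*} [Fintype ι] [DecidableEq ι] {K K' : Matrix ι ι ℝ}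
    (hK : K.PosDef) (h : K.det ≤ K'.det) : gaussEntropy K ≤ gaussEntropy K' := by
  have := Real.log_le_log hK.det_pos h
  unfold gaussEntropy
  linarith

end Compactness

/-! ### The canonical process -/

section Histories

variable {p q L M : ℕ} {ch : GLCM p q L M} {Ω : Type*}

/-- The history `(A^{N-1}, B^{N-1}, V^{N-1})` of a process. -/
def hist (A : ℕ → Ω → Vec q) (B V : ℕ → Ω → Vec p) (N : ℕ) (ω : Ω) : Hist p q N :=
  (seg A N ω, seg B N ω, seg V N ω)

lemma seg_succ {d : ℕ} (X : ℕ → Ω → Vec d) (N : ℕ) (ω : Ω) :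
    seg X (N + 1) ω = Fin.snoc (α := fun _ => Vec d) (seg X N ω) (X N ω) := by
  ext k c
  refine Fin.lastCases ?_ (fun k => ?_) k
  · simp [seg]
  · simp [seg]

/-- The channel equation at time `N` says that the history grows by the map `step`. -/
lemma hist_succ {A : ℕ → Ω → Vec q} {B V : ℕ → Ω → Vec p} {N : ℕ} {ω : Ω}
    (h : B N ω = ch.mean N (fun k => A k ω) (fun k => B k ω) + V N ω) :
    hist A B V (N + 1) ω = ch.step N ((hist A B V N ω, A N ω), V N ω) := by
  simp only [hist, GLCM.step, ← seg_succ]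
  rw [ch.mean_congr (x' := fun k => A k ω) (y' := fun k => B k ω)
    (fun k hk => extend_seg A ω (by omega)) (fun k hk => extend_seg B ω hk), ← h, ← seg_succ]

section

variable [MeasurableSpace Ω]

lemma measurable_lag {d m : ℕ} (init : Fin m → Vec d) {X : ℕ → Ω → Vec d} {i j : ℕ}
    (hX : j ≤ i → Measurable (X (i - j))) : Measurable fun ω => lag init (fun k => X k ω) i j := by
  unfold lag
  split_ifs with hj
  · exact hX hj
  · exact measurable_const
  · exact measurable_const

lemma measurable_mean {A : ℕ → Ω → Vec q} {B : ℕ → Ω → Vec p} {i : ℕ}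
    (hA : ∀ k ≤ i, Measurable (A k)) (hB : ∀ k < i, Measurable (B k)) :
    Measurable fun ω => ch.mean i (fun k => A k ω) (fun k => B k ω) := by
  unfold GLCM.mean
  refine Measurable.add (Finset.measurable_sum _ fun j _ => ?_)
    (Finset.measurable_sum _ fun j _ => ?_)
  · exact (GLCM.measurable_mulVec _).comp (measurable_lag _ fun hj => hB _ (by omega))
  · exact (GLCM.measurable_mulVec _).comp (measurable_lag _ fun hj => hA _ (by omega))

lemma measurable_hist {A : ℕ → Ω → Vec q} {B V : ℕ → Ω → Vec p} {N : ℕ}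
    (hA : ∀ k < N, Measurable (A k)) (hB : ∀ k < N, Measurable (B k))
    (hV : ∀ k < N, Measurable (V k)) : Measurable (hist A B V N) :=
  (measurable_seg hA).prodMk ((measurable_seg hB).prodMk (measurable_seg hV))

lemma indepFun_map {E F G : Type*} [MeasurableSpace E] [MeasurableSpace F] [MeasurableSpace G]
    {μ : Measure Ω} {f : Ω → E} {X : E → F} {Y : E → G} (hf : Measurable f) (hX : Measurable X)
    (hY : Measurable Y) (h : IndepFun (fun ω => X (f ω)) (fun ω => Y (f ω)) μ) :
    IndepFun X Y (μ.map f) := by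
  rw [indepFun_iff_measure_inter_preimage_eq_mul] at h ⊢
  intro s t hs ht
  rw [Measure.map_apply hf ((hX hs).inter (hY ht)), Measure.map_apply hf (hX hs),
    Measure.map_apply hf (hY ht)]
  exact h s t hs ht

lemma indepFun_of_map {E F G : Type*} [MeasurableSpace E] [MeasurableSpace F] [MeasurableSpace G]
    {μ : Measure Ω} {f : Ω → E} {X : E → F} {Y : E → G} (hf : Measurable f) (hX : Measurable X)
    (hY : Measurable Y) (h : IndepFun X Y (μ.map f)) :
    IndepFun (fun ω => X (f ω)) (fun ω => Y (f ω)) μ := by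
  rw [indepFun_iff_measure_inter_preimage_eq_mul] at h ⊢
  intro s t hs ht
  have := h s t hs ht
  rwa [Measure.map_apply hf ((hX hs).inter (hY ht)), Measure.map_apply hf (hX hs),
    Measure.map_apply hf (hY ht)] at this

end

section Canonical

variable {N : ℕ}

lemma measurable_inputs (k : ℕ) : Measurable (inputs k : Hist p q N → Vec q) :=
  (measurable_extend k).comp measurable_fst

lemma measurable_outputs (k : ℕ) : Measurable (outputs k : Hist p q N → Vec p) :=
  (measurable_extend k).comp measurable_snd.fst

lemma measurable_noises (k : ℕ) : Measurable (noises k : Hist p q N → Vec p) :=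
  (measurable_extend k).comp measurable_snd.snd

lemma extend_snoc_of_lt {d k : ℕ} (hk : k < N) (x : Fin N → Vec d) (a : Vec d) :
    extend (Fin.snoc (α := fun _ => Vec d) x a : Fin (N + 1) → Vec d) k = extend x k := by
  have h : (⟨k, hk.trans (Nat.lt_succ_self N)⟩ : Fin (N + 1)) = Fin.castSucc ⟨k, hk⟩ := rfl
  rw [extend, extend, dif_pos hk, dif_pos (hk.trans (Nat.lt_succ_self N)), h, Fin.snoc_castSucc]

lemma extend_snoc_self {d : ℕ} (x : Fin N → Vec d) (a : Vec d) :
    extend (Fin.snoc (α := fun _ => Vec d) x a : Fin (N + 1) → Vec d) N = a := by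
  have h : (⟨N, Nat.lt_succ_self N⟩ : Fin (N + 1)) = Fin.last N := rfl
  rw [extend, dif_pos (Nat.lt_succ_self N), h, Fin.snoc_last]

lemma hist_self (h : Hist p q N) : hist inputs outputs noises N h = h := by
  have hs : ∀ {d : ℕ} (x : Fin N → Vec d), (fun k : Fin N => extend x k) = x := by
    intro d x
    ext k
    simp [extend]
  exact Prod.ext (hs _) (Prod.ext (hs _) (hs _))

lemma hist_step {i : ℕ} (hi : i ≤ N) (x : (Hist p q N × Vec q) × Vec p) :
    hist inputs outputs noises i (ch.step N x) = hist inputs outputs noises i x.1.1 := by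
  refine Prod.ext ?_ (Prod.ext ?_ ?_) <;>
  exact funext fun k => extend_snoc_of_lt (k.2.trans_le hi) _ _

lemma measurable_hist_canonical (i : ℕ) :
    Measurable (hist inputs outputs noises i : Hist p q N → Hist p q i) :=
  measurable_hist (fun k _ => measurable_inputs k) (fun k _ => measurable_outputs k)
    fun k _ => measurable_noises k

variable (ch) (P : InputDist p q)

/-- The law of `(A^{N-1}, B^{N-1}, V^{N-1}, A_N, V_N)`. -/
noncomputable def stepLaw (N : ℕ) : Measure ((Hist p q N × Vec q) × Vec p) :=
  ((ch.jointLaw P N) ⊗ₘ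
    ((P.kernel N).comap (fun h : Hist p q N => (h.1, h.2.1)) (by fun_prop))).prod
    (gaussianLaw (ch.KV N))

lemma jointLaw_succ (N : ℕ) : ch.jointLaw P (N + 1) = (stepLaw ch P N).map (ch.step N) := rfl

lemma map_fst_fst_stepLaw (N : ℕ) :
    (stepLaw ch P N).map (fun x => x.1.1) = ch.jointLaw P N := by
  have := P.markov N
  have h : (fun x : (Hist p q N × Vec q) × Vec p => x.1.1) = Prod.fst ∘ Prod.fst := rfl
  rw [h, ← Measure.map_map measurable_fst measurable_fst, stepLaw]
  change Measure.fst (Measure.fst _) = _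
  rw [Measure.fst_prod, Measure.fst_compProd]

lemma map_hist_jointLaw {i : ℕ} (hi : i ≤ N) :
    (ch.jointLaw P N).map (hist inputs outputs noises i) = ch.jointLaw P i := by
  induction N with
  | zero =>
    obtain rfl : i = 0 := by omega
    have h : (hist inputs outputs noises 0 : Hist p q 0 → Hist p q 0) = id := funext hist_self
    rw [h, Measure.map_id]
  | succ N ih =>
    rcases hi.eq_or_lt with rfl | hlt
    · have h : (hist inputs outputs noises (N + 1) : Hist p q (N + 1) → Hist p q (N + 1)) = id :=
        funext hist_self
      rw [h, Measure.map_id]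
    · have hi' : i ≤ N := by omega
      rw [← ih hi', jointLaw_succ, Measure.map_map (measurable_hist_canonical i)
        (ch.measurable_step N), ← map_fst_fst_stepLaw,
        Measure.map_map (measurable_hist_canonical i) (by fun_prop)]
      exact congrArg (fun f => (stepLaw ch P N).map f) (funext fun x => hist_step hi' x)

/-- The law of the first `i + 1` steps of the canonical process is an explicit image of `stepLaw`,
in which the noise is independent of the past by construction. -/
lemma map_step_data {i : ℕ} (hi : i < N) :
    (ch.jointLaw P N).map (hist inputs outputs noises (i + 1))
      = (stepLaw ch P i).map (ch.step i) :=
  map_hist_jointLaw ch P hi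

lemma inputs_step (i : ℕ) (x : (Hist p q i × Vec q) × Vec p) :
    seg inputs (i + 1) (ch.step i x) = Fin.snoc (α := fun _ => Vec q) x.1.1.1 x.1.2 := by
  ext k c
  simp [seg, inputs, GLCM.step, extend, Nat.lt_succ_iff.1 k.2]

lemma outputs_step (i : ℕ) (x : (Hist p q i × Vec q) × Vec p) :
    seg outputs i (ch.step i x) = x.1.1.2.1 := by
  ext k c
  simp only [seg, outputs, GLCM.step]
  rw [extend_snoc_of_lt k.2]
  simp [extend]

lemma noises_step (i : ℕ) (x : (Hist p q i × Vec q) × Vec p) :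
    seg noises i (ch.step i x) = x.1.1.2.2 := by
  ext k c
  simp only [seg, noises, GLCM.step]
  rw [extend_snoc_of_lt k.2]
  simp [extend]

lemma noise_step (i : ℕ) (x : (Hist p q i × Vec q) × Vec p) : noises i (ch.step i x) = x.2 :=
  extend_snoc_self _ _

lemma output_step (i : ℕ) (x : (Hist p q i × Vec q) × Vec p) :
    outputs i (ch.step i x) = ch.mean i (fun k => inputs k (ch.step i x))
      (fun k => outputs k (ch.step i x)) + noises i (ch.step i x) := by
  rw [noise_step]
  refine (extend_snoc_self _ _).trans ?_
  congr 1
  exact ch.mean_congr (fun k _ => rfl) fun k hk => (extend_snoc_of_lt hk _ _).symm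

theorem satisfiesChannel_jointLaw (n : ℕ) :
    SatisfiesChannel ch n (ch.jointLaw P (n + 1)) inputs outputs noises := by
  have hm := fun i => measurable_hist_canonical (p := p) (q := q) (N := n + 1) i
  have hin : ∀ {i k : ℕ}, k < i → ∀ h : Hist p q (n + 1),
      inputs k (hist inputs outputs noises i h) = inputs k h := fun hk h => extend_seg inputs h hk
  have hout : ∀ {i k : ℕ}, k < i → ∀ h : Hist p q (n + 1),
      outputs k (hist inputs outputs noises i h) = outputs k h :=
    fun hk h => extend_seg outputs h hk
  have hno : ∀ {i k : ℕ}, k < i → ∀ h : Hist p q (n + 1),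
      noises k (hist inputs outputs noises i h) = noises k h := fun hk h => extend_seg noises h hk
  refine ⟨fun i _ => measurable_inputs i, fun i _ => measurable_outputs i,
    fun i _ => measurable_noises i, fun i hi => ?_, fun i hi => ?_, fun i hi => ?_⟩
  · have h1 : ∀ᵐ h ∂((stepLaw ch P i).map (ch.step i)), outputs i h
        = ch.mean i (fun k => inputs k h) (fun k => outputs k h) + noises i h := by
      refine (ae_map_iff (ch.measurable_step i).aemeasurable ?_).2
        (Filter.Eventually.of_forall (output_step ch i))
      exact measurableSet_eq_fun (measurable_outputs i)
        ((measurable_mean (fun k _ => measurable_inputs k) fun k _ => measurable_outputs k).add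
          (measurable_noises i))
    rw [← map_step_data ch P (Nat.lt_succ_of_le hi)] at h1
    filter_upwards [ae_of_ae_map (hm (i + 1)).aemeasurable h1] with h hh
    rw [hout (Nat.lt_succ_self i), hno (Nat.lt_succ_self i)] at hh
    rw [hh]
    congr 1
    exact ch.mean_congr (fun k hk => hin (by omega) h) fun k hk => hout (by omega) h
  · have h1 : (noises i : Hist p q (n + 1) → Vec p)
        = noises i ∘ hist inputs outputs noises (i + 1) :=
      funext fun h => (hno (Nat.lt_succ_self i) h).symm
    have := P.markov i
    rw [h1, ← Measure.map_map (measurable_noises i) (hm _),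
      map_step_data ch P (Nat.lt_succ_of_le hi), Measure.map_map (measurable_noises i)
        (ch.measurable_step i)]
    have h2 : noises i ∘ ch.step i = Prod.snd := funext (noise_step ch i)
    rw [h2, stepLaw, ← Measure.snd, Measure.snd_prod]
  · have h1 : IndepFun (noises i : Hist p q (i + 1) → Vec p)
        (fun h => (seg inputs (i + 1) h, seg outputs i h, seg noises i h))
        ((stepLaw ch P i).map (ch.step i)) := by
      refine indepFun_map (ch.measurable_step i) (measurable_noises i)
        ((measurable_seg fun k _ => measurable_inputs k).prodMk
          ((measurable_seg fun k _ => measurable_outputs k).prodMk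
            (measurable_seg fun k _ => measurable_noises k))) ?_
      have := P.markov i
      simp only [noise_step, inputs_step, outputs_step, noises_step, stepLaw]
      have hs : Measurable fun x : Hist p q i × Vec q =>
          ((Fin.snoc (α := fun _ => Vec q) x.1.1 x.2 : Fin (i + 1) → Vec q),
            x.1.2.1, x.1.2.2) := by
        refine Measurable.prodMk (measurable_pi_lambda _ fun k => ?_) (by fun_prop)
        refine Fin.lastCases ?_ (fun k => ?_) k
        · simpa using measurable_snd
        · simp only [Fin.snoc_castSucc]
          fun_prop
      exact (indepFun_prod hs measurable_id).symm
    rw [← map_step_data ch P (Nat.lt_succ_of_le hi)] at h1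
    have h2 := indepFun_of_map (hm (i + 1)) (measurable_noises i)
      ((measurable_seg fun k _ => measurable_inputs k).prodMk
          ((measurable_seg fun k _ => measurable_outputs k).prodMk
            (measurable_seg fun k _ => measurable_noises k))) h1
    have h3 : ∀ h : Hist p q (n + 1),
        (seg inputs (i + 1) (hist inputs outputs noises (i + 1) h),
          seg outputs i (hist inputs outputs noises (i + 1) h),
          seg noises i (hist inputs outputs noises (i + 1) h))
        = (seg inputs (i + 1) h, seg outputs i h, seg noises i h) := fun h =>
      Prod.ext (funext fun k => hin k.2 h) (Prod.ext
        (funext fun k => hout (by omega) h) (funext fun k => hno (by omega) h))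
    simpa only [h3, hno (Nat.lt_succ_self i)] using h2

end Canonical

end Histories

/-! ### Functionals of the joint law -/

section Invariance

variable {p q L M : ℕ} {ch : GLCM p q L M} {n : ℕ} {Ω : Type*} [MeasurableSpace Ω]
  {μ : Measure Ω} [IsProbabilityMeasure μ] {A : ℕ → Ω → Vec q} {B V : ℕ → Ω → Vec p}

lemma condEntropy_map {E F G : Type*} [MeasureSpace E] [StandardBorelSpace E] [Nonempty E]
    [MeasurableSpace F] [MeasurableSpace G] {X : G → E} {Y : G → F} (hX : Measurable X)
    (hY : Measurable Y) {f : Ω → G} (hf : Measurable f) [IsFiniteMeasure (μ.map f)] :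
    condEntropy X Y (μ.map f) = condEntropy (fun ω => X (f ω)) (fun ω => Y (f ω)) μ := by
  have h := condDistrib_map (ν := μ) (f := f) hY.aemeasurable hX.aemeasurable hf.aemeasurable
  rw [condEntropy, condEntropy, Measure.map_map hY hf]
  refine integral_congr_ae ?_
  filter_upwards [h] with y hy
  rw [hy]
  rfl

omit [MeasurableSpace Ω] in
lemma seg_congr {d N : ℕ} {X Y : ℕ → Ω → Vec d} (h : ∀ k < N, X k = Y k) : seg X N = seg Y N :=
  funext fun ω => funext fun k => congrFun (h k k.2) ω

omit [MeasurableSpace Ω] in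
lemma inputs_hist {k : ℕ} (hk : k ≤ n) :
    (fun ω => inputs k (hist A B V (n + 1) ω)) = A k :=
  funext fun ω => extend_seg A ω (by omega)

omit [MeasurableSpace Ω] in
lemma outputs_hist {k : ℕ} (hk : k ≤ n) :
    (fun ω => outputs k (hist A B V (n + 1) ω)) = B k :=
  funext fun ω => extend_seg B ω (by omega)

omit [MeasurableSpace Ω] in
lemma noises_hist {k : ℕ} (hk : k ≤ n) :
    (fun ω => noises k (hist A B V (n + 1) ω)) = V k :=
  funext fun ω => extend_seg V ω (by omega)

lemma entropyPayoff_map_hist (hf : Measurable (hist A B V (n + 1)))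
    [IsFiniteMeasure (μ.map (hist A B V (n + 1)))] :
    entropyPayoff n (μ.map (hist A B V (n + 1))) outputs noises = entropyPayoff n μ B V := by
  have hB : ∀ i ≤ n + 1, (fun ω => seg outputs i (hist A B V (n + 1) ω)) = seg B i := fun i hi =>
    seg_congr (X := fun k ω => outputs k (hist A B V (n + 1) ω))
      fun k hk => outputs_hist (by omega)
  have hV : (fun ω => seg noises (n + 1) (hist A B V (n + 1) ω)) = seg V (n + 1) :=
    seg_congr (X := fun k ω => noises k (hist A B V (n + 1) ω)) fun k hk => noises_hist (by omega)
  unfold entropyPayoff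
  congr 1
  · refine Finset.sum_congr rfl fun i hi => ?_
    have hi' := Finset.mem_range.1 hi
    rw [condEntropy_map (measurable_outputs i) (measurable_seg fun k _ => measurable_outputs k) hf,
      outputs_hist (by omega), hB i (by omega)]
  · rw [Measure.map_map (measurable_seg fun k _ => measurable_noises k) hf]
    exact congrArg (fun f => diffEntropy (μ.map f)) hV

lemma measurable_cost {i : ℕ} (hA : ∀ k ≤ i, Measurable (A k)) (hB : ∀ k ≤ i, Measurable (B k)) :
    Measurable fun ω => ch.cost i (fun k => A k ω) (fun k => B k ω) := by
  have h1 : ∀ j c, Measurable fun ω => lag ch.a (fun k => A k ω) i j c := fun j c =>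
    (measurable_pi_apply c).comp (measurable_lag _ fun _ => hA _ (by omega))
  have h2 : ∀ j c, Measurable fun ω => lag ch.b (fun k => B k ω) i j c := fun j c =>
    (measurable_pi_apply c).comp (measurable_lag _ fun _ => hB _ (by omega))
  simp only [GLCM.cost, dotProduct, Matrix.mulVec, GLCM.inputWindow, GLCM.outputWindow]
  fun_prop

omit [IsProbabilityMeasure μ] in
lemma avgCost_map_hist (hf : Measurable (hist A B V (n + 1))) :
    ch.avgCost n (μ.map (hist A B V (n + 1))) inputs outputs = ch.avgCost n μ A B := by
  unfold GLCM.avgCost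
  congr 1
  refine Finset.sum_congr rfl fun i hi => ?_
  have hi' := Finset.mem_range.1 hi
  rw [lintegral_map (measurable_cost (fun k _ => measurable_inputs k)
    fun k _ => measurable_outputs k).ennreal_ofReal hf]
  refine lintegral_congr fun ω => ?_
  rw [ch.cost_congr (fun k hk => congrFun (inputs_hist (A := A) (B := B) (V := V) (by omega)) ω)
    fun k hk => congrFun (outputs_hist (A := A) (B := B) (V := V) (by omega)) ω]

variable {P : InputDist p q}

lemma entropyPayoff_eq_payoff (hf : Measurable (hist A B V (n + 1)))
    (h : μ.map (hist A B V (n + 1)) = ch.jointLaw P (n + 1)) :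
    entropyPayoff n μ B V = ch.payoff n P := by
  have : IsProbabilityMeasure (μ.map (hist A B V (n + 1))) :=
    Measure.isProbabilityMeasure_map hf.aemeasurable
  rw [← entropyPayoff_map_hist hf, GLCM.payoff]
  congr 1

omit [IsProbabilityMeasure μ] in
lemma avgCost_le_iff_feasible {κ : ℝ} (hf : Measurable (hist A B V (n + 1)))
    (h : μ.map (hist A B V (n + 1)) = ch.jointLaw P (n + 1)) :
    ch.avgCost n μ A B ≤ ENNReal.ofReal κ ↔ ch.Feasible n κ P := by
  rw [← avgCost_map_hist hf, h, GLCM.Feasible]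

end Invariance

/-! ### The input distributions of linear realizations -/

section Shift

variable {E : Type*} [MeasurableSpace E] {d : ℕ}

/-- The kernel that maps `x` to the law of `f x + Z`, where `Z` has law `ν`. -/
noncomputable def shiftKernel (f : E → Vec d) (ν : Measure (Vec d)) : Kernel E (Vec d) :=
  (Kernel.id ×ₖ Kernel.const E ν).map fun x => f x.1 + x.2

lemma shiftKernel_apply {f : E → Vec d} (hf : Measurable f) (ν : Measure (Vec d))
    [IsProbabilityMeasure ν] (x : E) : shiftKernel f ν x = ν.map fun z => f x + z := by
  rw [shiftKernel, Kernel.map_apply _ (by fun_prop), Kernel.prod_apply, Kernel.id_apply,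
    Kernel.const_apply, Measure.dirac_prod, Measure.map_map (by fun_prop) (by fun_prop)]
  rfl

lemma isMarkovKernel_shiftKernel {f : E → Vec d} (hf : Measurable f) (ν : Measure (Vec d))
    [IsProbabilityMeasure ν] : IsMarkovKernel (shiftKernel f ν) :=
  Kernel.IsMarkovKernel.map _ (by fun_prop)

lemma compProd_eq_map_of_shift {ρ : Measure E} [SFinite ρ] {f : E → Vec d} (hf : Measurable f)
    {ν : Measure (Vec d)} [IsProbabilityMeasure ν] {η : Kernel E (Vec d)} [IsSFiniteKernel η]
    (hη : ∀ x, η x = ν.map fun z => f x + z) :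
    ρ ⊗ₘ η = (ρ.prod ν).map fun x => (x.1, f x.1 + x.2) := by
  refine Measure.ext_of_lintegral _ fun g hg => ?_
  rw [Measure.lintegral_compProd hg, lintegral_map hg (by fun_prop),
    lintegral_prod _ (by fun_prop)]
  refine lintegral_congr fun x => ?_
  rw [hη, lintegral_map (by fun_prop) (by fun_prop)]

end Shift

section Realization

variable {p q L M : ℕ} (ch : GLCM p q L M) (θ : LinearParams p q L M)

/-- `A_i - Z_i` in a linear realization, as a function of `a_{i-L}^{i-1}` and `b^{i-1}`. -/
def inputMean (i : ℕ) (w : Fin L → Vec q) (y : ℕ → Vec p) : Vec q :=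
  ∑ j : Fin (M + i), (θ.Γ i j).mulVec (lag ch.b y i (j + 1))
    + ∑ j : Fin L, (θ.Λ i j).mulVec (w j)
    + ∑ j : Fin L, (θ.Θ i j).mulVec (ch.a j)

lemma inputMean_congr {i : ℕ} {w w' : Fin L → Vec q} {y y' : ℕ → Vec p} (hw : w = w')
    (hy : ∀ k < i, y k = y' k) : inputMean ch θ i w y = inputMean ch θ i w' y' := by
  unfold inputMean
  rw [hw]
  congr 2
  refine Finset.sum_congr rfl fun j _ => ?_
  rw [lag_congr ch.b fun hj => hy _ (by omega)]

lemma measurable_inputMean {Ω : Type*} [MeasurableSpace Ω] {i : ℕ} {w : Ω → Fin L → Vec q}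
    {B : ℕ → Ω → Vec p} (hw : Measurable w) (hB : ∀ k < i, Measurable (B k)) :
    Measurable fun ω => inputMean ch θ i (w ω) (fun k => B k ω) := by
  unfold inputMean
  refine (Measurable.add (Finset.measurable_sum _ fun j _ => ?_)
    (Finset.measurable_sum _ fun j _ => ?_)).add measurable_const
  · exact (GLCM.measurable_mulVec _).comp (measurable_lag _ fun hj => hB _ (by omega))
  · exact (GLCM.measurable_mulVec _).comp ((measurable_pi_apply j).comp hw)

lemma measurable_inputMean_extend (i : ℕ) :
    Measurable fun h : (Fin L → Vec q) × (Fin i → Vec p) =>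
      inputMean ch θ i h.1 (extend h.2) :=
  measurable_inputMean ch θ (B := fun k (h : (Fin L → Vec q) × (Fin i → Vec p)) => extend h.2 k)
    measurable_fst fun k _ => (measurable_extend k).comp measurable_snd

/-- The input distribution `π_i(· | a_{i-L}^{i-1}, b^{i-1})` of a linear realization. -/
noncomputable def linearInput : LimitedInputDist p q L where
  kernel i := shiftKernel (fun h => inputMean ch θ i h.1 (extend h.2)) (gaussianLaw (θ.KZ i))
  markov i := isMarkovKernel_shiftKernel (measurable_inputMean_extend ch θ i) _

/-- `A_N - Z_N` as a function of the history. -/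
def histMean (N : ℕ) (h : Hist p q N) : Vec q :=
  inputMean ch θ N (fun j => lag ch.a (extend h.1) N (j + 1)) (extend h.2.1)

lemma measurable_histMean (N : ℕ) : Measurable (histMean ch θ N) :=
  measurable_inputMean ch θ (B := fun k (h : Hist p q N) => extend h.2.1 k)
    (measurable_pi_lambda _ fun _ => (measurable_lag_extend _ _ _).comp measurable_fst)
    fun k _ => (measurable_extend k).comp measurable_snd.fst

/-- Under the input distribution of a linear realization, `A_N` is the sum of a linear function of
the history and an independent Gaussian vector. -/
lemma stepLaw_linearInput (N : ℕ) :
    stepLaw ch (ch.ofLimited (linearInput ch θ)) N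
      = ((((ch.jointLaw (ch.ofLimited (linearInput ch θ)) N).prod (gaussianLaw (θ.KZ N))).map
        fun x => (x.1, histMean ch θ N x.1 + x.2)).prod (gaussianLaw (ch.KV N))) := by
  have := (ch.ofLimited (linearInput ch θ)).markov N
  rw [stepLaw, compProd_eq_map_of_shift (measurable_histMean ch θ N) (ν := gaussianLaw (θ.KZ N))]
  intro h
  rw [Kernel.comap_apply]
  exact shiftKernel_apply (measurable_inputMean_extend ch θ N) _ _

end Realization

section PastMeasurability

variable {p q L M : ℕ} {ch : GLCM p q L M} {Ω : Type*} [mΩ : MeasurableSpace Ω]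
  {A : ℕ → Ω → Vec q} {B V : ℕ → Ω → Vec p}

/-- The past outputs are functions of the past inputs and noises. -/
lemma measurable_output {i : ℕ}
    (hB : ∀ k < i, ∀ ω, B k ω = ch.mean k (fun l => A l ω) (fun l => B l ω) + V k ω)
    (hA : ∀ k < i, Measurable (A k)) (hV : ∀ k < i, Measurable (V k)) :
    ∀ k < i, Measurable (B k) := by
  intro k
  induction k using Nat.strong_induction_on with
  | _ k ih =>
    intro hk
    rw [funext (hB k hk)]
    exact (measurable_mean (fun l hl => hA l (by omega)) fun l hl => ih l hl (by omega)).add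
      (hV k hk)

/-- Stated for an arbitrary σ-algebra on `Ω`, so that it can be used for the one generated by the
past inputs and noises, where it gives the independence of the noise from the past outputs. -/
lemma measurable_past {i : ℕ}
    (hB : ∀ k < i, ∀ ω, B k ω = ch.mean k (fun l => A l ω) (fun l => B l ω) + V k ω)
    (hA : Measurable (seg A (i + 1))) (hV : Measurable (seg V i)) :
    Measurable fun ω => (seg A (i + 1) ω, seg B i ω, seg V i ω) := by
  refine hA.prodMk (Measurable.prodMk (measurable_seg (measurable_output hB (fun k hk => ?_)
    fun k hk => ?_)) hV)
  · exact (measurable_pi_apply (⟨k, by omega⟩ : Fin (i + 1))).comp hA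
  · exact (measurable_pi_apply (⟨k, hk⟩ : Fin i)).comp hV

/-- The history as a function of the past inputs and outputs. -/
def histOfPast (ch : GLCM p q L M) (i : ℕ) (x : (Fin i → Vec q) × (Fin i → Vec p)) : Hist p q i :=
  (x.1, x.2, fun k => x.2 k - ch.mean k (extend x.1) (extend x.2))

lemma measurable_histOfPast (ch : GLCM p q L M) (i : ℕ) : Measurable (histOfPast ch i) := by
  have h1 : ∀ k : ℕ, Measurable fun x : (Fin i → Vec q) × (Fin i → Vec p) =>
      ch.mean k (extend x.1) (extend x.2) := fun k =>
    measurable_mean (A := fun k (x : (Fin i → Vec q) × (Fin i → Vec p)) => extend x.1 k)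
      (B := fun k x => extend x.2 k) (fun k _ => (measurable_extend k).comp measurable_fst)
      fun k _ => (measurable_extend k).comp measurable_snd
  exact measurable_fst.prodMk (measurable_snd.prodMk (measurable_pi_lambda _ fun k =>
    ((measurable_pi_apply k).comp measurable_snd).sub (h1 k)))

end PastMeasurability

namespace IsLinearRealization

variable {p q L M : ℕ} {ch : GLCM p q L M} {n : ℕ} {θ : LinearParams p q L M} {Ω : Type*}
  [MeasurableSpace Ω] {μ : Measure Ω} {A : ℕ → Ω → Vec q}
  {B V : ℕ → Ω → Vec p} {Z : ℕ → Ω → Vec q} (h : IsLinearRealization ch n θ μ A B V Z)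

include h

lemma satisfiesChannel : SatisfiesChannel ch n μ A B V := by
  refine ⟨h.measurable_A, h.measurable_B, h.measurable_V,
    fun i hi => Filter.Eventually.of_forall (h.output_eq i hi), h.noise_law, fun i hi => ?_⟩
  set W : Ω → (Fin i → Vec p) × (Fin (i + 1) → Vec q) := fun ω => (seg V i ω, seg A (i + 1) ω)
    with hW
  have h1 := measurable_past (mΩ := MeasurableSpace.comap W inferInstance) (i := i)
    (fun k hk => h.output_eq k (by omega)) (measurable_snd.comp (comap_measurable W))
    (measurable_fst.comp (comap_measurable W))
  exact indep_of_indep_of_le_right (h.noise_indep i hi) h1.comap_le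

/-- The innovation is independent of the whole history, as the past noises are functions of the
past inputs and outputs. -/
lemma innov_indep_hist {i : ℕ} (hi : i ≤ n) : IndepFun (Z i) (hist A B V i) μ := by
  have h1 : hist A B V i = histOfPast ch i ∘ fun ω => (seg A i ω, seg B i ω) := by
    ext1 ω
    refine Prod.ext rfl (Prod.ext rfl (funext fun k => ?_))
    have hk := k.2
    change V k ω = B k ω - ch.mean k (extend (seg A i ω)) (extend (seg B i ω))
    rw [h.output_eq k (by omega) ω, ch.mean_congr (x' := fun k => A k ω) (y' := fun k => B k ω)
      (fun l hl => extend_seg A ω (by omega)) (fun l hl => extend_seg B ω (by omega)),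
      add_sub_cancel_left]
  rw [h1]
  exact (h.innov_indep_past i hi).comp measurable_id (measurable_histOfPast ch i)

lemma measurable_hist {N : ℕ} (hN : N ≤ n + 1) : Measurable (hist A B V N) :=
  FTFI.measurable_hist (fun k hk => h.measurable_A k (by omega))
    (fun k hk => h.measurable_B k (by omega)) fun k hk => h.measurable_V k (by omega)

lemma input_eq_hist {i : ℕ} (hi : i ≤ n) (ω : Ω) :
    A i ω = histMean ch θ i (hist A B V i ω) + Z i ω := by
  rw [h.input_eq i hi ω]
  congr 1
  refine inputMean_congr ch θ (w := fun j => lag ch.a (fun k => A k ω) i (j + 1))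
    (funext fun j => lag_congr ch.a fun hj => (extend_seg A ω (by omega)).symm)
    fun k hk => (extend_seg B ω hk).symm

/-- The joint law of a linear realization is determined by its coefficients. -/
lemma map_hist [IsProbabilityMeasure μ] {N : ℕ} (hN : N ≤ n + 1) :
    μ.map (hist A B V N) = ch.jointLaw (ch.ofLimited (linearInput ch θ)) N := by
  induction N with
  | zero =>
    have h0 : hist A B V 0 = fun _ => 0 := funext fun ω => Subsingleton.elim _ _
    rw [h0, Measure.map_const, measure_univ, one_smul, GLCM.jointLaw]
  | succ i ih =>
    have hi : i ≤ n := by omega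
    have hm := h.measurable_hist (N := i) (by omega)
    have hAm := h.measurable_A i hi
    have hVm := h.measurable_V i hi
    have h1 : hist A B V (i + 1) = ch.step i ∘ fun ω => ((hist A B V i ω, A i ω), V i ω) :=
      funext fun ω => hist_succ (h.output_eq i hi ω)
    have h2 : IndepFun (fun ω => (hist A B V i ω, A i ω)) (V i) μ := by
      let φ : (Fin (i + 1) → Vec q) × (Fin i → Vec p) × (Fin i → Vec p) → Hist p q i × Vec q :=
        fun x => ((fun k => x.1 k.castSucc, x.2.1, x.2.2), x.1 (Fin.last i))
      have hφ : Measurable φ := by fun_prop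
      exact ((h.satisfiesChannel.noise_indep i hi).comp measurable_id hφ).symm
    have h3 : μ.map (fun ω => (hist A B V i ω, A i ω))
        = ((μ.map (hist A B V i)).prod (gaussianLaw (θ.KZ i))).map
          fun x => (x.1, histMean ch θ i x.1 + x.2) := by
      have hmean := measurable_histMean ch θ i
      rw [← h.innov_law i hi, ← (indepFun_iff_map_prod_eq_prod_map_map hm.aemeasurable
        (h.measurable_Z i hi).aemeasurable).1 (h.innov_indep_hist hi).symm,
        Measure.map_map (by fun_prop) (hm.prodMk (h.measurable_Z i hi))]
      exact congrArg (fun f => μ.map f)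
        (funext fun ω => Prod.ext rfl (h.input_eq_hist hi ω))
    rw [h1, ← Measure.map_map (ch.measurable_step i) ((hm.prodMk hAm).prodMk hVm),
      (indepFun_iff_map_prod_eq_prod_map_map (hm.prodMk hAm).aemeasurable hVm.aemeasurable).1 h2,
      h3, h.noise_law i hi, ih (by omega), jointLaw_succ, stepLaw_linearInput]

end IsLinearRealization

/-! ### Gaussian joint laws -/

section Affine

variable {E F G : Type*} [NormedAddCommGroup E] [NormedSpace ℝ E] [NormedAddCommGroup F]
  [NormedSpace ℝ F] [NormedAddCommGroup G] [NormedSpace ℝ G]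

/-- `g` is a continuous affine map. -/
def IsAffine (g : E → F) : Prop := ∃ (l : E →L[ℝ] F) (c : F), ∀ x, g x = l x + c

namespace IsAffine

lemma const (c : F) : IsAffine fun _ : E => c := ⟨0, c, fun _ => by simp⟩

lemma of_clm (l : E →L[ℝ] F) : IsAffine fun x => l x := ⟨l, 0, fun _ => by simp⟩

lemma add {f g : E → F} (hf : IsAffine f) (hg : IsAffine g) : IsAffine fun x => f x + g x := by
  obtain ⟨l, c, hl⟩ := hf
  obtain ⟨m, d, hm⟩ := hg
  refine ⟨l + m, c + d, fun x => ?_⟩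
  simp only [hl, hm, _root_.add_apply]
  rw [add_add_add_comm]

lemma sum {ι : Type*} (s : Finset ι) {f : ι → E → F} (hf : ∀ i ∈ s, IsAffine (f i)) :
    IsAffine fun x => ∑ i ∈ s, f i x := by
  classical
  induction s using Finset.induction_on with
  | empty => simpa using const (0 : F)
  | insert i s hi ih =>
    simp only [Finset.sum_insert hi]
    exact (hf i (Finset.mem_insert_self i s)).add
      (ih fun j hj => hf j (Finset.mem_insert_of_mem hj))

lemma pi {ι : Type*} [Fintype ι] {F : ι → Type*} [∀ i, NormedAddCommGroup (F i)]
    [∀ i, NormedSpace ℝ (F i)] {f : ∀ i, E → F i} (hf : ∀ i, IsAffine (f i)) :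
    IsAffine fun x i => f i x := by
  choose l c h using hf
  exact ⟨ContinuousLinearMap.pi l, c, fun x => funext fun i => h i x⟩

lemma prodMk {f : E → F} {g : E → G} (hf : IsAffine f) (hg : IsAffine g) :
    IsAffine fun x => (f x, g x) := by
  obtain ⟨l, c, hl⟩ := hf
  obtain ⟨m, d, hm⟩ := hg
  exact ⟨l.prod m, (c, d), fun x => Prod.ext (hl x) (hm x)⟩

lemma comp {g : F → G} {f : E → F} (hg : IsAffine g) (hf : IsAffine f) :
    IsAffine fun x => g (f x) := by
  obtain ⟨l, c, hl⟩ := hf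
  obtain ⟨m, d, hm⟩ := hg
  refine ⟨m.comp l, m c + d, fun x => ?_⟩
  simp only [hm, hl, map_add, ContinuousLinearMap.comp_apply, add_assoc]

lemma fst {f : E → F × G} (hf : IsAffine f) : IsAffine fun x => (f x).1 :=
  (of_clm (ContinuousLinearMap.fst ℝ F G)).comp hf

lemma snd {f : E → F × G} (hf : IsAffine f) : IsAffine fun x => (f x).2 :=
  (of_clm (ContinuousLinearMap.snd ℝ F G)).comp hf

lemma apply {ι : Type*} [Fintype ι] {f : E → ι → F} (hf : IsAffine f) (i : ι) :
    IsAffine fun x => f x i :=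
  (of_clm (ContinuousLinearMap.proj (R := ℝ) (φ := fun _ : ι => F) i)).comp hf

lemma mulVec {d e : ℕ} (K : Matrix (Fin d) (Fin e) ℝ) {f : E → Vec e} (hf : IsAffine f) :
    IsAffine fun x => K.mulVec (f x) :=
  (of_clm (LinearMap.toContinuousLinearMap K.mulVecLin)).comp hf

lemma isGaussian_map [MeasurableSpace E] [BorelSpace E] [MeasurableSpace F] [BorelSpace F]
    [SecondCountableTopology F] {g : E → F} (hg : IsAffine g) (μ : Measure E) [IsGaussian μ] :
    IsGaussian (μ.map g) := by
  obtain ⟨l, c, hl⟩ := hg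
  have h : μ.map g = (μ.map l).map fun x => x + c := by
    rw [Measure.map_map (by fun_prop) (by fun_prop)]
    exact congrArg μ.map (funext hl)
  rw [h]
  infer_instance

lemma extend {d N : ℕ} {f : E → Fin N → Vec d} (hf : IsAffine f) (k : ℕ) :
    IsAffine fun x => extend (f x) k := by
  unfold FTFI.extend
  split_ifs
  · exact hf.apply _
  · exact const 0

lemma lag {d m : ℕ} (init : Fin m → Vec d) {X : E → ℕ → Vec d} (hX : ∀ k, IsAffine fun x => X x k)
    (i j : ℕ) : IsAffine fun x => lag init (X x) i j := by
  unfold FTFI.lag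
  split_ifs
  · exact hX _
  · exact const _
  · exact const 0

lemma snoc {d N : ℕ} {f : E → Fin N → Vec d} {g : E → Vec d} (hf : IsAffine f) (hg : IsAffine g) :
    IsAffine fun x => (Fin.snoc (α := fun _ => Vec d) (f x) (g x) : Fin (N + 1) → Vec d) := by
  refine pi fun k => ?_
  refine Fin.lastCases ?_ (fun k => ?_) k
  · simpa using hg
  · simpa using hf.apply k

variable {p q L M : ℕ} {ch : GLCM p q L M}

lemma mean {X : E → ℕ → Vec q} {Y : E → ℕ → Vec p} (hX : ∀ k, IsAffine fun x => X x k)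
    (hY : ∀ k, IsAffine fun x => Y x k) (i : ℕ) : IsAffine fun x => ch.mean i (X x) (Y x) := by
  unfold GLCM.mean
  exact add (sum _ fun j _ => mulVec _ (lag _ hY _ _)) (sum _ fun j _ => mulVec _ (lag _ hX _ _))

lemma step (ch : GLCM p q L M) (N : ℕ) : IsAffine (ch.step N) := by
  have hid : IsAffine fun x : (Hist p q N × Vec q) × Vec p => x :=
    of_clm (ContinuousLinearMap.id ℝ _)
  have hs := snoc hid.fst.fst.fst hid.fst.snd
  exact hs.prodMk ((snoc hid.fst.fst.snd.fst
    ((mean (fun k => hs.extend k) (fun k => hid.fst.fst.snd.fst.extend k) N).add hid.snd)).prodMk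
    (snoc hid.fst.fst.snd.snd hid.snd))

lemma histMean (ch : GLCM p q L M) (θ : LinearParams p q L M) (N : ℕ) :
    IsAffine (histMean ch θ N) := by
  have hid : IsAffine fun x : Hist p q N => x := of_clm (ContinuousLinearMap.id ℝ _)
  exact ((sum _ fun j _ => mulVec _ (lag _ (fun k => hid.snd.fst.extend k) _ _)).add
    (sum _ fun j _ => mulVec _ (lag _ (fun k => hid.fst.extend k) _ _))).add (const _)

end IsAffine

end Affine

section GaussianInputs

variable {p q L M : ℕ} (ch : GLCM p q L M) (θ : LinearParams p q L M)

lemma isGaussian_jointLaw_linearInput (N : ℕ) :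
    IsGaussian (ch.jointLaw (ch.ofLimited (linearInput ch θ)) N) := by
  induction N with
  | zero =>
    rw [GLCM.jointLaw]
    infer_instance
  | succ N ih =>
    rw [jointLaw_succ, stepLaw_linearInput]
    have hid : IsAffine fun x : Hist p q N × Vec q => x :=
      IsAffine.of_clm (ContinuousLinearMap.id ℝ _)
    have := (hid.fst.prodMk (((IsAffine.histMean ch θ N).comp hid.fst).add hid.snd)).isGaussian_map
      ((ch.jointLaw (ch.ofLimited (linearInput ch θ)) N).prod (gaussianLaw (θ.KZ N)))
    exact (IsAffine.step ch N).isGaussian_map _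

lemma gaussianInput_linearInput (n : ℕ) : ch.GaussianInput n (linearInput ch θ) := by
  refine ⟨fun i _ h => ?_, isGaussian_jointLaw_linearInput ch θ (n + 1)⟩
  have h1 : (linearInput ch θ).kernel i h = _ :=
    shiftKernel_apply (measurable_inputMean_extend ch θ i) (gaussianLaw (θ.KZ i)) h
  rw [h1]
  infer_instance

end GaussianInputs

namespace IsLinearRealization

variable {p q L M : ℕ} {ch : GLCM p q L M} {n : ℕ} {θ : LinearParams p q L M} {Ω : Type*}
  [MeasurableSpace Ω] {μ : Measure Ω} [IsProbabilityMeasure μ] {A : ℕ → Ω → Vec q}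
  {B V : ℕ → Ω → Vec p} {Z : ℕ → Ω → Vec q} (h : IsLinearRealization ch n θ μ A B V Z)

include h

lemma isGaussian_map_hist : IsGaussian (μ.map (hist A B V (n + 1))) := by
  rw [h.map_hist le_rfl]
  exact isGaussian_jointLaw_linearInput ch θ (n + 1)

lemma memLp_input : ∀ i ≤ n, ∀ c, MemLp (fun ω => A i ω c) 2 μ := by
  intro i hi c
  have hG := h.isGaussian_map_hist
  let l : Hist p q (n + 1) →L[ℝ] ℝ := (ContinuousLinearMap.proj c).comp
    ((ContinuousLinearMap.proj (R := ℝ) (φ := fun _ => Vec q)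
      (⟨i, Nat.lt_succ_of_le hi⟩ : Fin (n + 1))).comp (ContinuousLinearMap.fst ℝ _ _))
  have h1 := IsGaussian.memLp_dual (μ.map (hist A B V (n + 1))) l 2 (by simp)
  exact h1.comp_of_map (h.measurable_hist le_rfl).aemeasurable

lemma isGaussian_map_outputs :
    IsGaussian (μ.map fun ω (j : Fin (n + 1) × Fin p) => B j.1 ω j.2) := by
  have hG := h.isGaussian_map_hist
  have hid : IsAffine fun x : Hist p q (n + 1) => x := IsAffine.of_clm (ContinuousLinearMap.id ℝ _)
  have h1 : IsAffine fun (x : Hist p q (n + 1)) (j : Fin (n + 1) × Fin p) => x.2.1 j.1 j.2 :=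
    IsAffine.pi fun j => (hid.snd.fst.apply j.1).apply j.2
  have h2 := h1.isGaussian_map (μ.map (hist A B V (n + 1)))
  rwa [Measure.map_map (by fun_prop) (h.measurable_hist le_rfl)] at h2

omit [IsProbabilityMeasure μ] in
/-- The innovation has mean zero, so it is orthogonal to every variable independent of it. -/
lemma integral_innov_mul {i : ℕ} (hi : i ≤ n) (c : Fin q) {X : Ω → ℝ}
    (hX : AEStronglyMeasurable X μ) (hind : IndepFun (Z i) X μ) : ∫ ω, Z i ω c * X ω ∂μ = 0 := by
  have hm : Measurable fun ω => Z i ω c := (measurable_pi_apply c).comp (h.measurable_Z i hi)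
  have h0 : ∫ ω, Z i ω c ∂μ = 0 := by
    rw [← integral_eval_gaussianLaw (θ.KZ i) c, ← h.innov_law i hi,
      integral_map (h.measurable_Z i hi).aemeasurable
        (measurable_pi_apply c).aestronglyMeasurable]
  have hX' : IndepFun (fun ω => Z i ω c) X μ := hind.comp (measurable_pi_apply c) measurable_id
  rw [hX'.integral_fun_mul_eq_mul_integral hm.aestronglyMeasurable hX, h0, zero_mul]

omit [IsProbabilityMeasure μ] in
lemma evalForm_formZ {i : ℕ} (hi : i ≤ n) (c : Fin q) (ω : Ω) :
    evalForm (fun k => A k ω) (fun k => B k ω) (formZ ch n θ i c) = Z i ω c := by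
  rw [evalForm_Z ch _ _ θ hi, h.input_eq i hi ω]
  simp only [Pi.add_apply]
  ring

lemma one_formZ : ∀ i ≤ n, ∀ c,
    Matrix.toBilin' (momentMatrix n μ A B) (formOne n) (formZ ch n θ i c) = 0 := by
  intro i hi c
  rw [toBilin'_momentMatrix h.memLp_input (h.satisfiesChannel.memLp_output h.memLp_input)]
  simp only [evalForm_one, h.evalForm_formZ hi, one_mul]
  have := h.integral_innov_mul hi c (X := fun _ => 1) aestronglyMeasurable_const
    (indepFun_const_right _ 1)
  simpa using this

lemma regresses : Regresses ch n θ (momentMatrix n μ A B) := by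
  have hB := h.satisfiesChannel.memLp_output h.memLp_input
  refine ⟨fun i hi c t => ?_, fun i hi c d => ?_⟩
  · rw [toBilin'_momentMatrix h.memLp_input hB]
    simp only [h.evalForm_formZ hi]
    refine h.integral_innov_mul hi c (memLp_evalForm h.memLp_input hB _).aestronglyMeasurable ?_
    have h1 : ∀ x : ℕ → Vec q, ∀ y : ℕ → Vec p, ∀ x' y', (∀ k < i, x k = x' k) →
        (∀ k < i, y k = y' k) →
        evalForm x y (reg ch n i t) = evalForm x' y' (reg ch n i t) := by
      intro x y x' y' hx hy
      rcases t with ⟨j, d⟩ | ⟨j, d⟩ | ⟨j, d⟩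
      · simp only [reg, evalForm_lagB ch _ _ hi]
        rw [lag_congr ch.b fun hj => hy _ (by omega)]
      · simp only [reg, evalForm_lagA ch _ _ hi]
        rw [lag_congr ch.a fun hj => hx _ (by omega)]
      · simp only [reg, map_smul, evalForm_one]
    have h2 : (fun ω => evalForm (fun k => A k ω) (fun k => B k ω) (reg ch n i t))
        = (fun x : (Fin i → Vec q) × (Fin i → Vec p) =>
          evalForm (extend x.1) (extend x.2) (reg ch n i t)) ∘
            fun ω => (seg A i ω, seg B i ω) :=
      funext fun ω => h1 _ _ _ _ (fun k hk => (extend_seg A ω hk).symm)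
        fun k hk => (extend_seg B ω hk).symm
    rw [h2]
    refine (h.innov_indep_past i hi).comp measurable_id ?_
    refine Finset.measurable_sum _ fun j _ => measurable_const.mul ?_
    rcases j with _ | ⟨k, c⟩ | ⟨k, c⟩
    · exact measurable_const
    · exact (measurable_pi_apply c).comp ((measurable_extend k).comp measurable_fst)
    · exact (measurable_pi_apply c).comp ((measurable_extend k).comp measurable_snd)
  · rw [toBilin'_momentMatrix h.memLp_input hB]
    simp only [h.evalForm_formZ hi]
    rw [← integral_eval_mul_eval_gaussianLaw (h.innov_cov i hi) c d, ← h.innov_law i hi,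
      integral_map (h.measurable_Z i hi).aemeasurable (by fun_prop)]

end IsLinearRealization

/-! ### Existence of linear realizations -/

section Trajectory

variable {p q L M : ℕ} (ch : GLCM p q L M) (θ : LinearParams p q L M)

/-- The first `N` inputs and outputs that the innovations `z` and the noises `v` produce; the
later values are zero. -/
def trajectory (z : ℕ → Vec q) (v : ℕ → Vec p) : ℕ → (ℕ → Vec q) × (ℕ → Vec p)
  | 0 => (0, 0)
  | N + 1 =>
    let s := trajectory z v N
    let x := Function.update s.1 N
      (inputMean ch θ N (fun j => lag ch.a s.1 N (j + 1)) s.2 + z N)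
    (x, Function.update s.2 N (ch.mean N x s.2 + v N))

/-- The inputs that the innovations `z` and the noises `v` produce. -/
def trajInput (z : ℕ → Vec q) (v : ℕ → Vec p) (k : ℕ) : Vec q := (trajectory ch θ z v (k + 1)).1 k

/-- The outputs that the innovations `z` and the noises `v` produce. -/
def trajOutput (z : ℕ → Vec q) (v : ℕ → Vec p) (k : ℕ) : Vec p :=
  (trajectory ch θ z v (k + 1)).2 k

variable (z : ℕ → Vec q) (v : ℕ → Vec p)

lemma trajectory_apply {N k : ℕ} (hk : k < N) :
    (trajectory ch θ z v N).1 k = trajInput ch θ z v k ∧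
      (trajectory ch θ z v N).2 k = trajOutput ch θ z v k := by
  induction N with
  | zero => omega
  | succ N ih =>
    rcases (Nat.lt_succ_iff.1 hk).eq_or_lt with rfl | hlt
    · exact ⟨rfl, rfl⟩
    · rw [← (ih hlt).1, ← (ih hlt).2]
      exact ⟨Function.update_of_ne hlt.ne _ _, Function.update_of_ne hlt.ne _ _⟩

lemma trajInput_eq (i : ℕ) : trajInput ch θ z v i
    = inputMean ch θ i (fun j => lag ch.a (trajInput ch θ z v) i (j + 1)) (trajOutput ch θ z v)
      + z i := by
  rw [← inputMean_congr ch θ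
    (w := fun j => lag ch.a (trajectory ch θ z v i).1 i (j + 1)) (y := (trajectory ch θ z v i).2)
    (funext fun j => lag_congr ch.a fun hj => (trajectory_apply ch θ z v (by omega)).1)
    fun k hk => (trajectory_apply ch θ z v hk).2]
  exact Function.update_self _ _ _

lemma trajOutput_eq (i : ℕ) : trajOutput ch θ z v i
    = ch.mean i (trajInput ch θ z v) (trajOutput ch θ z v) + v i := by
  rw [← ch.mean_congr (x := (trajectory ch θ z v (i + 1)).1) (y := (trajectory ch θ z v i).2)
    (fun k hk => (trajectory_apply ch θ z v (by omega)).1)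
    fun k hk => (trajectory_apply ch θ z v hk).2]
  exact Function.update_self _ _ _

variable {ch θ}

lemma measurable_traj {Ω : Type*} [mΩ : MeasurableSpace Ω] {Z : ℕ → Ω → Vec q} {V : ℕ → Ω → Vec p}
    {i : ℕ} (hZ : ∀ k < i, Measurable (Z k)) (hV : ∀ k < i, Measurable (V k)) :
    ∀ k < i, (Measurable fun ω => trajInput ch θ (fun l => Z l ω) (fun l => V l ω) k) ∧
      Measurable fun ω => trajOutput ch θ (fun l => Z l ω) (fun l => V l ω) k := by
  intro k
  induction k using Nat.strong_induction_on with
  | _ k ih =>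
    intro hk
    have hA : Measurable fun ω => trajInput ch θ (fun l => Z l ω) (fun l => V l ω) k := by
      simp only [fun ω => trajInput_eq ch θ (fun l => Z l ω) (fun l => V l ω) k]
      refine (measurable_inputMean ch θ (measurable_pi_lambda _ fun j => measurable_lag
        (X := fun l ω => trajInput ch θ (fun l => Z l ω) (fun l => V l ω) l) ch.a fun hj =>
          (ih _ (by omega) (by omega)).1)
        (B := fun l ω => trajOutput ch θ (fun l => Z l ω) (fun l => V l ω) l)
        fun l hl => (ih l hl (by omega)).2).add (hZ k hk)
    refine ⟨hA, ?_⟩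
    simp only [fun ω => trajOutput_eq ch θ (fun l => Z l ω) (fun l => V l ω) k]
    refine (measurable_mean
      (A := fun l ω => trajInput ch θ (fun l => Z l ω) (fun l => V l ω) l)
      (B := fun l ω => trajOutput ch θ (fun l => Z l ω) (fun l => V l ω) l)
      (fun l hl => ?_) fun l hl => (ih l hl (by omega)).2).add (hV k hk)
    rcases hl.eq_or_lt with rfl | hlt
    · exact hA
    · exact (ih l hlt (by omega)).1

lemma measurable_trajInput {Ω : Type*} [mΩ : MeasurableSpace Ω] {Z : ℕ → Ω → Vec q}
    {V : ℕ → Ω → Vec p} {i : ℕ} (hZ : ∀ k ≤ i, Measurable (Z k)) (hV : ∀ k < i, Measurable (V k)) :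
    Measurable fun ω => trajInput ch θ (fun l => Z l ω) (fun l => V l ω) i := by
  have h := measurable_traj (ch := ch) (θ := θ) (fun k hk => hZ k hk.le) hV
  simp only [fun ω => trajInput_eq ch θ (fun l => Z l ω) (fun l => V l ω) i]
  exact (measurable_inputMean ch θ (measurable_pi_lambda _ fun j => measurable_lag
    (X := fun l ω => trajInput ch θ (fun l => Z l ω) (fun l => V l ω) l) ch.a fun hj =>
      (h _ (by omega)).1)
    (B := fun l ω => trajOutput ch θ (fun l => Z l ω) (fun l => V l ω) l)
    fun l hl => (h l hl).2).add (hZ i le_rfl)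

end Trajectory

section Base

variable (p q : ℕ)

/-- The dimension of `Z_k` (on the left) and of `V_k` (on the right). -/
abbrev baseDim : ℕ ⊕ ℕ → ℕ := Sum.elim (fun _ => q) fun _ => p

/-- The values of all innovations and noises. -/
abbrev Base : Type := ∀ t : ℕ ⊕ ℕ, Vec (baseDim p q t)

variable {p q} {L M : ℕ} (ch : GLCM p q L M) (θ : LinearParams p q L M)

/-- The laws of the innovations and noises. -/
noncomputable def baseLaw : ∀ t : ℕ ⊕ ℕ, Measure (Vec (baseDim p q t))
  | .inl k => gaussianLaw (θ.KZ k)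
  | .inr k => gaussianLaw (ch.KV k)

instance (t : ℕ ⊕ ℕ) : IsProbabilityMeasure (baseLaw ch θ t) := by
  rcases t with k | k
  · exact inferInstanceAs (IsProbabilityMeasure (gaussianLaw (θ.KZ k)))
  · exact inferInstanceAs (IsProbabilityMeasure (gaussianLaw (ch.KV k)))

lemma iIndepFun_base :
    iIndepFun (fun (t : ℕ ⊕ ℕ) (ω : Base p q) => ω t) (Measure.infinitePi (baseLaw ch θ)) :=
  iIndepFun_infinitePi (X := fun _ x => x) fun _ => measurable_id

/-- The σ-algebra generated by finitely many innovations and noises. -/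
abbrev baseSigma (S : Finset (ℕ ⊕ ℕ)) : MeasurableSpace (Base p q) :=
  MeasurableSpace.comap (fun ω (t : S) => ω t) inferInstance

lemma measurable_base {S : Finset (ℕ ⊕ ℕ)} {t : ℕ ⊕ ℕ} (ht : t ∈ S) :
    Measurable[baseSigma S] fun ω : Base p q => ω t :=
  fun s hs => ⟨(fun x : ∀ t : S, Vec (baseDim p q t) => x ⟨t, ht⟩) ⁻¹' s,
    measurable_pi_apply (⟨t, ht⟩ : S) hs, rfl⟩

lemma measurable_seg_prod {Ω : Type*} [mΩ : MeasurableSpace Ω] {d e N N' : ℕ}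
    {X : ℕ → Ω → Vec d} {Y : ℕ → Ω → Vec e} (hX : ∀ k < N, Measurable (X k))
    (hY : ∀ k < N', Measurable (Y k)) : Measurable fun ω => (seg X N ω, seg Y N' ω) :=
  (measurable_seg hX).prodMk (measurable_seg hY)

lemma indepFun_base {S T : Finset (ℕ ⊕ ℕ)} (hST : Disjoint S T) {E F : Type*}
    [MeasurableSpace E] [MeasurableSpace F] {X : Base p q → E} {Y : Base p q → F}
    (hX : Measurable[baseSigma S] X) (hY : Measurable[baseSigma T] Y) :
    IndepFun X Y (Measure.infinitePi (baseLaw ch θ)) :=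
  indep_of_indep_of_le_left (indep_of_indep_of_le_right
    ((iIndepFun_base ch θ).indepFun_finset S T hST fun t => measurable_pi_apply t) hY.comap_le)
    hX.comap_le

/-- The independence properties hold because the variables in question depend on disjoint sets of
innovations and noises. -/
theorem isLinearRealization_traj (hK : ∀ i, (θ.KZ i).PosSemidef) (n : ℕ) :
    IsLinearRealization ch n θ (Measure.infinitePi (baseLaw ch θ))
      (fun i ω => trajInput ch θ (fun k => ω (.inl k)) (fun k => ω (.inr k)) i)
      (fun i ω => trajOutput ch θ (fun k => ω (.inl k)) (fun k => ω (.inr k)) i)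
      (fun i ω => ω (.inr i)) (fun i ω => ω (.inl i)) := by
  have hZ : ∀ k, Measurable fun ω : Base p q => ω (.inl k) := fun k => measurable_pi_apply _
  have hV : ∀ k, Measurable fun ω : Base p q => ω (.inr k) := fun k => measurable_pi_apply _
  have hm := fun i => measurable_traj (ch := ch) (θ := θ) (Z := fun k (ω : Base p q) => ω (.inl k))
    (V := fun k ω => ω (.inr k)) (i := i + 1) (fun k _ => hZ k) (fun k _ => hV k) i
      (Nat.lt_succ_self i)
  refine
    { measurable_A := fun i _ => (hm i).1
      measurable_B := fun i _ => (hm i).2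
      measurable_V := fun i _ => hV i
      measurable_Z := fun i _ => hZ i
      input_eq := fun i _ ω => trajInput_eq ch θ _ _ i
      output_eq := fun i _ ω => trajOutput_eq ch θ _ _ i
      noise_law := fun i _ => Measure.infinitePi_map_eval (baseLaw ch θ) (.inr i)
      noise_indep := fun i _ => ?_
      innov_indep_past := fun i _ => ?_
      innov_indep_noise := fun i _ => ?_
      innov_cov := fun i _ => hK i
      innov_law := fun i _ => Measure.infinitePi_map_eval (baseLaw ch θ) (.inl i)
      innov_indep := ?_ }
  · refine indepFun_base ch θ (S := {.inr i})
      (T := (Finset.range (i + 1)).disjSum (Finset.range i)) (by simp)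
      (measurable_base (Finset.mem_singleton_self _)) ?_
    refine measurable_seg_prod
      (mΩ := baseSigma ((Finset.range (i + 1)).disjSum (Finset.range i)))
      (X := fun k (ω : Base p q) => ω (.inr k))
      (fun k hk => measurable_base (by simpa using hk)) fun k hk => ?_
    exact measurable_trajInput (mΩ := baseSigma _) (Z := fun k (ω : Base p q) => ω (.inl k))
      (V := fun k ω => ω (.inr k))
      (fun l hl => measurable_base (by simp; omega)) fun l hl => measurable_base (by simp; omega)
  · refine indepFun_base ch θ (S := {.inl i})
      (T := (Finset.range i).disjSum (Finset.range i)) (by simp)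
      (measurable_base (Finset.mem_singleton_self _)) ?_
    have h := measurable_traj (ch := ch) (θ := θ)
      (mΩ := baseSigma ((Finset.range i).disjSum (Finset.range i)))
      (Z := fun k (ω : Base p q) => ω (.inl k)) (V := fun k ω => ω (.inr k)) (i := i)
      (fun l hl => measurable_base (by simpa using hl))
      fun l hl => measurable_base (by simpa using hl)
    exact measurable_seg_prod (mΩ := baseSigma ((Finset.range i).disjSum (Finset.range i)))
      (fun k hk => (h k hk).1) fun k hk => (h k hk).2
  · refine indepFun_base ch θ (S := (Finset.range (i + 1)).disjSum ∅)
      (T := Finset.disjSum ∅ (Finset.range (i + 1))) ?_ ?_ ?_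
    · simp [Finset.disjoint_left]
    · exact @measurable_seg _ (baseSigma _) _ _ _ fun k hk => measurable_base (by simpa using hk)
    · exact @measurable_seg _ (baseSigma _) _ _ _ fun k hk => measurable_base (by simpa using hk)
  · exact (iIndepFun_base ch θ).precomp (g := fun k : Fin (n + 1) => Sum.inl (k : ℕ))
      fun k l hkl => Fin.ext (Sum.inl_injective hkl)

end Base

/-! ### Optimal inputs -/

section Optimal

variable {p q L M : ℕ} {ch : GLCM p q L M} {n : ℕ} (hKV : ∀ i ≤ n, (ch.KV i).PosDef)

include hKV

lemma SatisfiesChannel.entropyPayoff_eq {Ω : Type*} [MeasurableSpace Ω] {μ : Measure Ω}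
    [IsProbabilityMeasure μ] {A : ℕ → Ω → Vec q} {B V : ℕ → Ω → Vec p}
    (h : SatisfiesChannel ch n μ A B V) :
    entropyPayoff n μ B V = ∑ i ∈ Finset.range (n + 1), condEntropy (B i) (seg B i) μ
      + ∑ i ∈ Finset.range (n + 1), noiseLog ch i := by
  rw [entropyPayoff, (h.noise_entropy hKV).2, sub_neg_eq_add]

variable (hR : ∀ i ≤ n, (ch.R i).PosDef) (hQ : ∀ i ≤ n, (ch.Q i).PosSemidef) {κ : ℝ}
  {P : InputDist p q}

include hR hQ

omit hKV in
lemma GLCM.Feasible.memLp_inputs (hP : ch.Feasible n κ P) :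
    ∀ i ≤ n, ∀ c, MemLp (fun h : Hist p q (n + 1) => inputs i h c) 2 (ch.jointLaw P (n + 1)) :=
  memLp_input_of_avgCost_ne_top hR hQ (fun i _ => measurable_inputs i)
    (hP.trans_lt ENNReal.ofReal_lt_top).ne

lemma GLCM.Feasible.entropiesExist_and_info_eq (hP : ch.Feasible n κ P) :
    EntropiesExist n (ch.jointLaw P (n + 1)) outputs noises ∧
      (ch.info n P : EReal) = (ch.payoff n P : EReal) := by
  have h := satisfiesChannel_jointLaw ch P n
  have hB := h.memLp_output (hP.memLp_inputs hR hQ)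
  exact ⟨h.entropiesExist hKV hB, h.directedInfo_eq hKV hB⟩

lemma GLCM.Feasible.momentMatrix_mem_admissible (hκ : 0 ≤ κ) (hP : ch.Feasible n κ P) :
    momentMatrix n (ch.jointLaw P (n + 1)) inputs outputs ∈ admissible ch n κ := by
  have h := satisfiesChannel_jointLaw ch P n
  have hA := hP.memLp_inputs hR hQ
  have hB := h.memLp_output hA
  exact ⟨h.compatible hKV hA, (avgCost_le_iff hR hQ hA hB hκ).1 hP,
    fun i hi c => toBilin'_momentMatrix_formA_le hR hQ hA hB hκ hP hi c⟩

/-- An optimal second-moment matrix has a linear realization, which has the same cost. Its outputs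
are Gaussian, and their entropy is the largest that any feasible input distribution can reach. -/
theorem exists_optimal_linearInput (hκ : 0 ≤ κ) (hne : ∃ P : InputDist p q, ch.Feasible n κ P) :
    ∃ θ : LinearParams p q L M, (ch.a = 0 ∨ ch.b ≠ 0 → θ.Θ = 0) ∧
      (∀ i, (θ.KZ i).PosSemidef) ∧ ch.Feasible n κ (ch.ofLimited (linearInput ch θ)) ∧
      ∀ P, ch.Feasible n κ P → ch.payoff n P ≤ ch.payoff n (ch.ofLimited (linearInput ch θ)) := by
  obtain ⟨P₀, hP₀⟩ := hne
  obtain ⟨S, hS, hmax⟩ := exists_isMaxOn_det_outCov ch n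
    ⟨_, hP₀.momentMatrix_mem_admissible hKV hR hQ hκ⟩
  obtain ⟨θ, hr, hΘ, hΘ0, hK⟩ := exists_regresses (ch := ch) hS.1.posSemidef
  have h := isLinearRealization_traj ch θ hK n
  have hA := h.memLp_input
  have hB := h.satisfiesChannel.memLp_output hA
  have hc := h.satisfiesChannel.compatible hKV hA
  have hcov := outCov_eq hΘ hS.1 hc hr h.regresses
  have hmap := h.map_hist le_rfl
  have hm := h.measurable_hist le_rfl
  refine ⟨θ, hΘ0, hK, ?_, fun P hP => ?_⟩
  · rw [← avgCost_le_iff_feasible hm hmap, avgCost_le_iff hR hQ hA hB hκ]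
    refine le_of_eq_of_le (Finset.sum_congr rfl fun i hi => ?_) hS.2.1
    exact (costForm_eq hΘ hS.1 hc hr h.regresses (Nat.lt_succ_iff.1 (Finset.mem_range.1 hi))).symm
  · have hP' := satisfiesChannel_jointLaw ch P n
    have hmean : ∀ j : Fin (n + 1) × Fin p, Matrix.toBilin' (momentMatrix n _ _ _) (formOne n)
        (formB n j.1 j.2) = outMean ch (momentMatrix n _ _ _) j := fun j => by
      rcases meanFlag_eq_zero_or_one (ch := ch) with h0 | h1
      · rw [outMean, h0, zero_mul, one_orthogonal_stepSpan hΘ h0 hc h.one_formZ le_rfl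
          (formB_mem_stepSpan hΘ (Nat.lt_succ_iff.1 j.1.2) j.2)]
      · rw [outMean, h1, one_mul]
    rw [← entropyPayoff_eq_payoff hm hmap, h.satisfiesChannel.entropyPayoff_eq hKV,
      h.satisfiesChannel.sum_condEntropy_eq_gaussEntropy hA hKV h.isGaussian_map_outputs hmean,
      ← hcov, GLCM.payoff, hP'.entropyPayoff_eq hKV]
    have hPS := hP.momentMatrix_mem_admissible hKV hR hQ hκ
    gcongr
    exact (hP'.sum_condEntropy_le_gaussEntropy (hP.memLp_inputs hR hQ) hKV).trans
      (gaussEntropy_le_gaussEntropy (posDef_outCov hKV hPS.1) (hmax _ hPS))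

lemma payoff_le_capacity (hP : ch.Feasible n κ P) :
    (ch.payoff n P : EReal) ≤ ch.capacity n κ := by
  rw [← (hP.entropiesExist_and_info_eq hKV hR hQ).2]
  exact le_iSup₂_of_le P hP le_rfl

omit hKV hR hQ in
lemma capacity_eq_bot (hne : ¬∃ P : InputDist p q, ch.Feasible n κ P) :
    ch.capacity n κ = ⊥ :=
  iSup₂_eq_bot.2 fun P hP => absurd ⟨P, hP⟩ hne

/-- The capacity is attained by the input distribution of a linear realization, with `Θ = 0` if the
known outputs provide the constants, or no constants are needed. -/
theorem exists_capacity_eq_payoff (hκ : 0 ≤ κ) (hne : ∃ P : InputDist p q, ch.Feasible n κ P) :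
    ∃ θ : LinearParams p q L M, (ch.a = 0 ∨ ch.b ≠ 0 → θ.Θ = 0) ∧
      (∀ i, (θ.KZ i).PosSemidef) ∧ ch.Feasible n κ (ch.ofLimited (linearInput ch θ)) ∧
      ch.capacity n κ = (ch.payoff n (ch.ofLimited (linearInput ch θ)) : EReal) := by
  obtain ⟨θ, hΘ, hK, hfeas, hopt⟩ := exists_optimal_linearInput hKV hR hQ hκ hne
  refine ⟨θ, hΘ, hK, hfeas, le_antisymm (iSup₂_le fun P hP => ?_)
    (payoff_le_capacity hKV hR hQ hfeas)⟩
  rw [(hP.entropiesExist_and_info_eq hKV hR hQ).2]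
  exact EReal.coe_le_coe_iff.2 (hopt P hP)

lemma capacity_eq_iSup (hκ : 0 ≤ κ) {Q : LimitedInputDist p q L → Prop}
    (hQ' : ∀ θ, Q (linearInput ch θ)) :
    ch.capacity n κ = ⨆ (π : LimitedInputDist p q L) (_ : Q π ∧ ch.Feasible n κ (ch.ofLimited π)),
      (ch.payoff n (ch.ofLimited π) : EReal) := by
  refine le_antisymm ?_ (iSup₂_le fun π hπ => payoff_le_capacity hKV hR hQ hπ.2)
  by_cases hne : ∃ P : InputDist p q, ch.Feasible n κ P
  · obtain ⟨θ, -, -, hfeas, hcap⟩ := exists_capacity_eq_payoff hKV hR hQ hκ hne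
    rw [hcap]
    exact le_iSup₂_of_le (linearInput ch θ) ⟨hQ' θ, hfeas⟩ le_rfl
  · rw [capacity_eq_bot hne]
    exact bot_le

lemma capacity_eq_sSup_linearValues (hκ : 0 ≤ κ) {adm : LinearParams p q L M → Prop}
    (hadm : ∀ θ : LinearParams p q L M, (ch.a = 0 ∨ ch.b ≠ 0 → θ.Θ = 0) → adm θ) :
    ch.capacity n κ = sSup (linearValues ch n κ adm) := by
  refine le_antisymm ?_ (sSup_le ?_)
  · by_cases hne : ∃ P : InputDist p q, ch.Feasible n κ P
    · obtain ⟨θ, hΘ, hK, hfeas, hcap⟩ := exists_capacity_eq_payoff hKV hR hQ hκ hne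
      have h := isLinearRealization_traj ch θ hK n
      have hmap := h.map_hist le_rfl
      have hm := h.measurable_hist le_rfl
      rw [hcap, ← entropyPayoff_eq_payoff hm hmap]
      exact le_sSup ⟨θ, hadm θ hΘ, _, _, _, inferInstance, _, _, _, _, h,
        (avgCost_le_iff_feasible hm hmap).2 hfeas, rfl⟩
    · rw [capacity_eq_bot hne]
      exact bot_le
  · rintro x ⟨θ, -, Ω, _, μ, _, A, B, V, Z, h, hcost, rfl⟩
    have hmap := h.map_hist le_rfl
    have hm := h.measurable_hist le_rfl
    rw [entropyPayoff_eq_payoff hm hmap]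
    exact payoff_le_capacity hKV hR hQ ((avgCost_le_iff_feasible hm hmap).1 hcost)

end Optimal

end FTFI

theorem mainTheorem4 {p q L M : ℕ} (n : ℕ) (ch : GLCM p q L M)
    (hKV : ∀ i ≤ n, (ch.KV i).PosDef)
    (hR : ∀ i ≤ n, (ch.R i).PosDef)
    (hQ : ∀ i ≤ n, (ch.Q i).PosSemidef)
    (κ : ℝ) (hκ : 0 ≤ κ) :
    -- the entropies below exist, and directed information is their difference
    (∀ P : InputDist p q, ch.Feasible n κ P →
      EntropiesExist n (ch.jointLaw P (n + 1)) outputs noises ∧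
      (ch.info n P : EReal) = (ch.payoff n P : EReal)) ∧
    -- the supremum may be taken over inputs with memory `L` on past inputs
    ch.capacity n κ =
      ⨆ (π : LimitedInputDist p q L) (_ : ch.Feasible n κ (ch.ofLimited π)),
        (ch.payoff n (ch.ofLimited π) : EReal) ∧
    -- (a) the supremum may be taken over Gaussian ones
    ch.capacity n κ =
      ⨆ (π : LimitedInputDist p q L)
        (_ : ch.GaussianInput n π ∧ ch.Feasible n κ (ch.ofLimited π)),
        (ch.payoff n (ch.ofLimited π) : EReal) ∧
    -- (a), (b) an optimal Gaussian one exists, and it has a linear realization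
    ((∃ P : InputDist p q, ch.Feasible n κ P) →
      ∃ π : LimitedInputDist p q L, ch.GaussianInput n π ∧ ch.Feasible n κ (ch.ofLimited π) ∧
        (ch.info n (ch.ofLimited π) : EReal) = ch.capacity n κ ∧
        ∃ θ : LinearParams p q L M, (ch.a = 0 ∨ ch.b ≠ 0 → θ.Θ = 0) ∧
          ∃ (Ω : Type) (_ : MeasurableSpace Ω) (μ : Measure Ω) (_ : IsProbabilityMeasure μ)
            (A : ℕ → Ω → Vec q) (B V : ℕ → Ω → Vec p) (Z : ℕ → Ω → Vec q),
            Realizes ch n θ μ A B V Z (ch.ofLimited π)) ∧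
    -- (b) every linear realization comes from a Gaussian input distribution
    (∀ (θ : LinearParams p q L M) (Ω : Type) (_ : MeasurableSpace Ω) (μ : Measure Ω)
      (_ : IsProbabilityMeasure μ)
      (A : ℕ → Ω → Vec q) (B V : ℕ → Ω → Vec p) (Z : ℕ → Ω → Vec q),
      IsLinearRealization ch n θ μ A B V Z →
      ∃ π : LimitedInputDist p q L, ch.GaussianInput n π ∧
        Realizes ch n θ μ A B V Z (ch.ofLimited π)) ∧
    -- (b) the capacity is the supremum over linear realizations
    ch.capacity n κ = sSup (linearValues ch n κ fun _ => True) ∧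
    (ch.a = 0 ∨ ch.b ≠ 0 →
      ch.capacity n κ = sSup (linearValues ch n κ fun θ => θ.Θ = 0)) := by
  refine ⟨fun P hP => hP.entropiesExist_and_info_eq hKV hR hQ, ?_, ?_, fun hne => ?_, ?_, ?_, ?_⟩
  · simpa only [true_and] using
      capacity_eq_iSup hKV hR hQ hκ (Q := fun _ => True) fun _ => trivial
  · exact capacity_eq_iSup hKV hR hQ hκ (Q := ch.GaussianInput n)
      fun θ => gaussianInput_linearInput ch θ n
  · obtain ⟨θ, hΘ, hK, hfeas, hcap⟩ := exists_capacity_eq_payoff hKV hR hQ hκ hne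
    have h := isLinearRealization_traj ch θ hK n
    exact ⟨linearInput ch θ, gaussianInput_linearInput ch θ n, hfeas,
      (hfeas.entropiesExist_and_info_eq hKV hR hQ).2.trans hcap.symm, θ, hΘ,
      _, _, _, inferInstance, _, _, _, _, h, h.map_hist le_rfl⟩
  · intro θ Ω _ μ _ A B V Z h
    exact ⟨linearInput ch θ, gaussianInput_linearInput ch θ n, h, h.map_hist le_rfl⟩
  · exact capacity_eq_sSup_linearValues hKV hR hQ hκ fun _ _ => trivial
  · exact fun h => capacity_eq_sSup_linearValues hKV hR hQ hκ fun _ hΘ => hΘ h
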